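/- There is a universal constant $\tilde c\ge 3$ such that the following holds for all integers $d\ge 1$, $n\ge 0$, all real $L>0$ and all $p\in[1,\infty]$. Let $\mathbb T^d_L=[0,2\pi L]^d$ with Lebesgue measure, and for $f\in L^p(\mathbb T^d_L)$ (complex valued) let $$\hat f\Big(\tfrac{k}{L}\Big)=\frac1{(2\pi L)^d}\int_{\mathbb T^d_L} f(x)\,e^{-\frac{i}{L}x\cdot k}\,dx,\qquad k\in\mathbb Z^d,$$ so that $\operatorname{supp}\hat f\subset(\tfrac1L\mathbb Z)^d\subset\mathbb R^d$. Assume that $\operatorname{supp}\hat f\subset\bigcup_{l=1}^n J_l$, where each $J_l\subset\mathbb R^d$ is a closed parallelepiped with sides parallel to the coordinate axes and of lengths $b_1,\dots,b_d\ge 0$, at an arbitrary position. Let $\gamma\in(0,1]$, let $a=(a_1,\dots,a_d)$ with $0<a_j\le 2\pi L$ for all $j$, and let $S\subset\mathbb R^d$ be $(\gamma,a)$-thick, that is, measurable with $|S\cap P|\ge\gamma|P|$ for every parallelepiped $P\subset\mathbb R^d$ with sides parallel to the coordinate axes and of lengths $a_1,\dots,a_d$. Then $$\|f\|_{L^p(\mathbb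 T^d_L)}\le\Big(\frac{\tilde c^{\,d}}{\gamma}\Big)^{\big(\frac{\tilde c^{\,d}}{\gamma}\big)^n a\cdot b+n-\frac{p-1}{p}}\|f\|_{L^p(S\cap\mathbb T^d_L)},$$ where $a\cdot b=\sum_{j=1}^d a_jb_j$ and $\frac{p-1}{p}$ is read as $1$ for $p=\infty$. -/

import Mathlib

open MeasureTheory

noncomputable section

namespace LogvinenkoSereda

/-- The closed parallelepiped in `ℝ^d` with sides parallel to the coordinate axes, of lengths
`s 0, …, s (d-1)`, centred at `x`. -/
def box {d : ℕ} (x s : Fin d → ℝ) : Set (Fin d → ℝ) :=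
  {y | ∀ j, y j ∈ Set.Icc (x j - s j / 2) (x j + s j / 2)}

/-- The fundamental cell `[0, 2πL]^d`, representing the torus `𝕋^d_L`. -/
def torus (d : ℕ) (L : ℝ) : Set (Fin d → ℝ) :=
  {y | ∀ j, y j ∈ Set.Icc 0 (2 * Real.pi * L)}

/-- `S` is `(γ, a)`-thick: `|S ∩ P| ≥ γ |P|` for every axis-parallel parallelepiped `P` with
side lengths `a`. The standing conditions on `S`, `γ` and `a` are part of the notion. -/
structure IsThick {d : ℕ} (S : Set (Fin d → ℝ)) (γ : ℝ) (a : Fin d → ℝ) : Prop where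
  measurable : NullMeasurableSet S volume
  gamma_mem : γ ∈ Set.Ioc (0 : ℝ) 1
  side_pos : ∀ j, 0 < a j
  le_volume : ∀ x : Fin d → ℝ, ENNReal.ofReal γ * volume (box x a) ≤ volume (S ∩ box x a)

/-- The Fourier coefficient of `f` on `[0, 2πL]^d` at the frequency `k / L`, `k ∈ ℤ^d`:
`(2πL)^{-d} ∫ f(x) e^{-i x·k / L} dx`. -/
def fourierCoeffTorus {d : ℕ} (L : ℝ) (f : (Fin d → ℝ) → ℂ) (k : Fin d → ℤ) : ℂ :=
  (1 / ((2 * Real.pi * L : ℝ) : ℂ) ^ d) *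
    ∫ x in torus d L, f x * Complex.exp (-Complex.I * ((1 / L * ∑ j, x j * (k j : ℝ) : ℝ) : ℂ))

/-- The support of the Fourier transform of `f`, a subset of `((1/L) ℤ)^d ⊆ ℝ^d`. -/
def fourierSupport {d : ℕ} (L : ℝ) (f : (Fin d → ℝ) → ℂ) : Set (Fin d → ℝ) :=
  {ξ | ∃ k : Fin d → ℤ, (∀ j, ξ j = (k j : ℝ) / L) ∧ fourierCoeffTorus L f k ≠ 0}

end LogvinenkoSereda

end

noncomputable section

namespace LogvinenkoSereda

/-- The exponential sum `∑ k ∈ s, c k * exp (i * lam k * z)`. -/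
def expSum {ι : Type*} (s : Finset ι) (c : ι → ℂ) (lam : ι → ℝ) (z : ℂ) : ℂ :=
  ∑ k ∈ s, c k * Complex.exp (Complex.I * lam k * z)

section Turan

variable {ι : Type*}

open Classical in
theorem turan_power_sum (n : ℕ) : ∀ (M : ℕ) (s : Finset ι) (c z : ι → ℂ) (S : ℝ),
    s.card = n + 1 → (∀ k ∈ s, ‖z k‖ = 1) →
    (∀ k, M ≤ k → k ≤ M + n → ‖∑ j ∈ s, c j * z j ^ k‖ ≤ S) →
    ‖∑ j ∈ s, c j‖ ≤ 2 ^ n * ((M + n).choose n : ℝ) * S := by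
  induction n with
  | zero =>
    intro M s c z S hs hz h
    obtain ⟨j, rfl⟩ := Finset.card_eq_one.mp hs
    have := h M le_rfl le_rfl
    simpa [norm_pow, hz j (by simp)] using this
  | succ n ihn =>
    intro M
    induction M with
    | zero =>
      intro s c z S hs hz h
      have h0 := h 0 le_rfl (Nat.zero_le _)
      have hS : 0 ≤ S := (norm_nonneg _).trans h0
      simp only [pow_zero, mul_one] at h0
      refine h0.trans ?_
      simp only [zero_add, Nat.choose_self, Nat.cast_one, mul_one]
      have : (1 : ℝ) ≤ 2 ^ (n + 1) := one_le_pow₀ (by norm_num)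
      nlinarith
    | succ M ihM =>
      intro s c z S hs hz h
      obtain ⟨j, hj⟩ : s.Nonempty := Finset.card_pos.mp (by omega)
      have hcard : (s.erase j).card = n + 1 := by rw [Finset.card_erase_of_mem hj]; omega
      have hshift := ihM s (fun k => c k * z k) z S hs hz (by
        intro k h1 h2
        have := h (k + 1) (by omega) (by omega)
        refine le_of_eq_of_le ?_ this
        congr 1
        exact Finset.sum_congr rfl fun i _ => by ring)
      have hsum : ∀ k, ∑ i ∈ s.erase j, c i * (z i - z j) * z i ^ k =
          ∑ i ∈ s, c i * z i ^ (k + 1) - z j * ∑ i ∈ s, c i * z i ^ k := by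
        intro k
        rw [Finset.sum_erase _ (by simp), Finset.mul_sum, ← Finset.sum_sub_distrib]
        exact Finset.sum_congr rfl fun i _ => by ring
      have hb := ihn (M + 1) (s.erase j) (fun i => c i * (z i - z j)) z (2 * S) hcard
        (fun k hk => hz k (Finset.mem_of_mem_erase hk)) (by
          intro k h1 h2
          rw [hsum]
          refine (norm_sub_le _ _).trans ?_
          rw [norm_mul, hz j hj, one_mul]
          linarith [h k (by omega) (by omega), h (k + 1) (by omega) (by omega)])
      have h0 := hsum 0
      simp only [pow_zero, mul_one, zero_add, pow_one] at h0
      have h1 : z j * ∑ i ∈ s, c i = ∑ i ∈ s, c i * z i - ∑ i ∈ s.erase j, c i * (z i - z j) := by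
        rw [h0]; ring
      have h2 : ‖∑ i ∈ s, c i‖ ≤ ‖∑ i ∈ s, c i * z i‖ + ‖∑ i ∈ s.erase j, c i * (z i - z j)‖ := by
        have := norm_sub_le (∑ i ∈ s, c i * z i) (∑ i ∈ s.erase j, c i * (z i - z j))
        rw [← h1, norm_mul, hz j hj, one_mul] at this
        exact this
      have hp : ((M + 1 + (n + 1)).choose (n + 1) : ℝ) =
          ((M + 1 + n).choose n : ℝ) + ((M + (n + 1)).choose (n + 1) : ℝ) := by
        rw [show M + 1 + (n + 1) = (M + 1 + n) + 1 by ring, Nat.choose_succ_succ',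
          show M + (n + 1) = M + 1 + n by ring]
        push_cast; ring
      rw [hp]
      calc _ ≤ _ := h2
        _ ≤ _ := add_le_add hshift hb
        _ = _ := by ring

theorem succ_pow_le_eight_pow_mul_factorial (n : ℕ) :
    ((n : ℝ) + 1) ^ n ≤ 8 ^ n * (n.factorial : ℝ) := by
  rcases Nat.eq_zero_or_pos n with rfl | hn
  · simp
  have h := Real.pow_div_factorial_le_exp ((n : ℝ) + 1) (by positivity) (n + 1)
  have hf : (0 : ℝ) < n.factorial := by positivity
  rw [Nat.factorial_succ, pow_succ] at h
  push_cast at h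
  have h1 : ((n : ℝ) + 1) ^ n / n.factorial ≤ Real.exp (n + 1) := by
    refine le_trans (le_of_eq ?_) h
    field_simp
  have h2 : Real.exp ((n : ℝ) + 1) ≤ 8 ^ n := by
    have : Real.exp ((n : ℝ) + 1) ≤ Real.exp (2 * n) := by
      apply Real.exp_le_exp.mpr
      have : (1 : ℝ) ≤ n := by exact_mod_cast hn
      linarith
    refine this.trans ?_
    rw [show (2 * n : ℝ) = n * (2 : ℝ) by ring, Real.exp_nat_mul]
    gcongr
    have : Real.exp 2 = Real.exp 1 ^ 2 := by rw [← Real.exp_nat_mul]; norm_num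
    rw [this]
    have := Real.exp_one_lt_d9
    have := Real.exp_pos 1
    nlinarith
  rw [div_le_iff₀ hf] at h1
  nlinarith

theorem norm_expSum_le_left {n : ℕ} {s : Finset ι} (hs : s.card = n + 1) (c : ι → ℂ)
    (lam : ι → ℝ) {x w r S : ℝ} (hr : 0 < r) (hx : x ≤ w - r)
    (h : ∀ t : ℝ, |t - w| ≤ r → ‖expSum s c lam t‖ ≤ S) :
    ‖expSum s c lam x‖ ≤ (8 * (|x - w| + r) / r) ^ n * S := by
  set N : ℝ := (n : ℝ) + 1 with hN
  have hNpos : 0 < N := by positivity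
  set e : ℝ := 2 * r / N with he
  have hepos : 0 < e := by positivity
  set M : ℕ := ⌈(w - r - x) / e⌉₊ with hM
  have hM1 : w - r - x ≤ M * e := by
    have := Nat.le_ceil ((w - r - x) / e)
    rwa [div_le_iff₀ hepos] at this
  have hM2 : (M : ℝ) * e ≤ w - r - x + e := by
    have := (Nat.ceil_lt_add_one (a := (w - r - x) / e) (div_nonneg (by linarith) hepos.le)).le
    rw [← hM] at this
    calc (M : ℝ) * e ≤ ((w - r - x) / e + 1) * e := by gcongr
      _ = _ := by field_simp
  have heN : N * e = 2 * r := by rw [he]; field_simp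
  have hS : 0 ≤ S := (norm_nonneg _).trans (h w (by simpa using hr.le))
  have key := turan_power_sum n M s (fun k => c k * Complex.exp (Complex.I * lam k * x))
    (fun k => Complex.exp (Complex.I * lam k * e)) S hs (by
      intro k _
      rw [show Complex.I * lam k * e = ((lam k * e : ℝ) : ℂ) * Complex.I by push_cast; ring]
      exact Complex.norm_exp_ofReal_mul_I _) (by
      intro k h1 h2
      have h1' : (M : ℝ) ≤ k := by exact_mod_cast h1
      have h2' : (k : ℝ) ≤ M + n := by exact_mod_cast h2
      have := h (x + k * e) (by
        rw [abs_le]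
        constructor
        · nlinarith
        · nlinarith)
      refine le_of_eq_of_le ?_ this
      unfold expSum
      congr 1
      refine Finset.sum_congr rfl fun i _ => ?_
      rw [mul_assoc, ← Complex.exp_nat_mul, ← Complex.exp_add]
      congr 2
      push_cast; ring)
  refine le_trans key ?_
  gcongr
  have hc : ((M + n).choose n : ℝ) ≤ ((M + n : ℕ) : ℝ) ^ n / n.factorial :=
    Nat.choose_le_pow_div n (M + n)
  have hMn : ((M + n : ℕ) : ℝ) ≤ N * ((|x - w| + r) / (2 * r)) := by
    have habs : |x - w| = w - x := by rw [abs_sub_comm, abs_of_nonneg]; linarith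
    rw [habs]
    push_cast
    have : ((M : ℝ) + n) * e ≤ w - x + r := by nlinarith
    rw [← heN]
    rw [show N * ((w - x + r) / (N * e)) = (w - x + r) / e by field_simp, le_div_iff₀ hepos]
    exact this
  have hfac := succ_pow_le_eight_pow_mul_factorial n
  have hf : (0 : ℝ) < n.factorial := by positivity
  calc (2 : ℝ) ^ n * ((M + n).choose n : ℝ)
      ≤ 2 ^ n * ((N * ((|x - w| + r) / (2 * r))) ^ n / n.factorial) := by
        gcongr
        exact hc.trans (by gcongr)
    _ = (N ^ n / n.factorial) * ((|x - w| + r) / r) ^ n := by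
        rw [mul_pow, div_pow, div_pow, mul_pow]; field_simp
    _ ≤ 8 ^ n * ((|x - w| + r) / r) ^ n := by
        gcongr
        rw [div_le_iff₀ hf]; exact hfac
    _ = _ := by rw [← mul_pow]; congr 1; ring

theorem expSum_neg_arg (s : Finset ι) (c : ι → ℂ) (lam : ι → ℝ) (z : ℂ) :
    expSum s c (fun k => -lam k) z = expSum s c lam (-z) := by
  unfold expSum
  refine Finset.sum_congr rfl fun i _ => ?_
  push_cast
  congr 2; ring

/-- **Turán's lemma**: growth of an exponential sum with real frequencies from an interval. -/
theorem norm_expSum_le {n : ℕ} {s : Finset ι} (hs : s.card = n + 1) (c : ι → ℂ)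
    (lam : ι → ℝ) {x w r S : ℝ} (hr : 0 < r)
    (h : ∀ t : ℝ, |t - w| ≤ r → ‖expSum s c lam t‖ ≤ S) :
    ‖expSum s c lam x‖ ≤ (8 * (|x - w| + r) / r) ^ n * S := by
  have hS : 0 ≤ S := (norm_nonneg _).trans (h w (by simpa using hr.le))
  rcases le_or_gt (|x - w|) r with hx | hx
  · refine (h x hx).trans (le_mul_of_one_le_left hS (one_le_pow₀ ?_))
    rw [le_div_iff₀ hr]
    linarith [abs_nonneg (x - w)]
  rcases le_or_gt x (w - r) with hx1 | hx1
  · exact norm_expSum_le_left hs c lam hr hx1 h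
  · have hx2 : w + r ≤ x := by
      rcases le_total 0 (x - w) with h0 | h0
      · rw [abs_of_nonneg h0] at hx; linarith
      · rw [abs_of_nonpos h0] at hx; linarith
    have := norm_expSum_le_left hs c (fun k => -lam k) (x := -x) (w := -w) (r := r) (S := S) hr
      (by linarith) (by
        intro t ht
        rw [expSum_neg_arg]
        have := h (-t) (by rw [← abs_neg]; convert! ht using 2; ring)
        simpa using this)
    rw [expSum_neg_arg] at this
    have e1 : |(-x) - (-w)| = |x - w| := by rw [← abs_neg]; congr 1; ring
    rw [e1] at this
    simpa using this

theorem differentiable_expSum (s : Finset ι) (c : ι → ℂ) (lam : ι → ℝ) :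
    Differentiable ℂ (expSum s c lam) := by
  unfold expSum
  fun_prop

theorem norm_expSum_complex_le_of_im_nonneg {n : ℕ} {s : Finset ι} (hs : s.card = n + 1)
    (c : ι → ℂ) (lam : ι → ℝ) {σ S : ℝ} (hσ : ∀ k ∈ s, |lam k| ≤ σ)
    (h : ∀ t : ℝ, |t| ≤ 1 / 2 → ‖expSum s c lam t‖ ≤ S) {ζ : ℂ} (hζ : 0 ≤ ζ.re) :
    ‖expSum s c lam (Complex.I * ζ)‖ ≤ (24 * ‖ζ + 1‖) ^ n * Real.exp (σ * ζ.re) * S := by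
  set f : ℂ → ℂ := fun ζ => expSum s c lam (Complex.I * ζ) * Complex.exp (-σ * ζ) / (ζ + 1) ^ n
    with hf
  have hne : ∀ ζ : ℂ, 0 ≤ ζ.re → 1 ≤ ‖ζ + 1‖ := by
    intro ζ hζ
    have := Complex.abs_re_le_norm (ζ + 1)
    rw [Complex.add_re, Complex.one_re, abs_of_nonneg (by linarith)] at this
    linarith
  have hpos : ∀ ζ : ℂ, 0 ≤ ζ.re → ζ + 1 ≠ 0 := fun ζ hζ h0 => by
    have := hne ζ hζ
    rw [h0, norm_zero] at this; linarith
  have hS : 0 ≤ S := (norm_nonneg _).trans (h 0 (by norm_num))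
  have hbd : ∀ ζ : ℂ, 0 ≤ ζ.re → ‖f ζ‖ ≤ ∑ k ∈ s, ‖c k‖ := by
    intro ζ hζ
    rw [hf]
    simp only [norm_div, norm_pow]
    refine (div_le_self (norm_nonneg _) (one_le_pow₀ (hne ζ hζ))).trans ?_
    unfold expSum
    rw [Finset.sum_mul]
    refine norm_sum_le_of_le _ fun k hk => ?_
    rw [mul_assoc, ← Complex.exp_add, norm_mul, Complex.norm_exp]
    refine mul_le_of_le_one_right (norm_nonneg _) (Real.exp_le_one_iff.mpr ?_)
    have : (Complex.I * (lam k : ℂ) * (Complex.I * ζ) + -(σ : ℂ) * ζ) =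
        ((-(lam k) - σ : ℝ) : ℂ) * ζ := by
      push_cast
      linear_combination (lam k * ζ : ℂ) * Complex.I_mul_I
    rw [this, Complex.re_ofReal_mul]
    have := (abs_le.mp (hσ k hk)).1
    exact mul_nonpos_of_nonpos_of_nonneg (by linarith) hζ
  have hdiff : DiffContOnCl ℂ f {z | 0 < z.re} := by
    have hD : DifferentiableOn ℂ f {z | 0 ≤ z.re} := by
      refine DifferentiableOn.div ?_ (by fun_prop) fun z hz => pow_ne_zero _ (hpos z hz)
      have := differentiable_expSum s c lam
      exact Differentiable.differentiableOn (by fun_prop)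
    refine ⟨hD.mono fun z (hz : 0 < z.re) => show 0 ≤ z.re from hz.le, ?_⟩
    rw [Complex.closure_setOfPred_lt_re]
    exact hD.continuousOn
  have hPL := PhragmenLindelof.right_half_plane_of_bounded_on_real (f := f) (C := 24 ^ n * S)
    hdiff ⟨1, by norm_num, 0, by
      simp only [zero_mul, Real.exp_zero]
      refine Asymptotics.IsBigO.of_bound (∑ k ∈ s, ‖c k‖) ?_
      rw [Filter.eventually_inf_principal]
      refine Filter.Eventually.of_forall fun z hz => ?_
      simpa using hbd z (le_of_lt hz)⟩
    ⟨∑ k ∈ s, ‖c k‖, by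
      rw [Filter.eventually_map]
      filter_upwards [Filter.eventually_ge_atTop 0] with x hx
      exact hbd _ (by simpa using hx)⟩ (by
      intro x
      rw [hf]
      simp only [norm_div, norm_pow, norm_mul]
      have hx1 : ‖((x : ℂ) * Complex.I + 1)‖ = √(x ^ 2 + 1) := by
        rw [Complex.norm_eq_sqrt_sq_add_sq]; simp; ring_nf
      have h1 : ‖Complex.exp (-(σ : ℂ) * (x * Complex.I))‖ = 1 := by
        rw [show (-(σ : ℂ) * (x * Complex.I)) = ((-σ * x : ℝ) : ℂ) * Complex.I by push_cast; ring]
        exact Complex.norm_exp_ofReal_mul_I _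
      have h2 : Complex.I * ((x : ℂ) * Complex.I) = ((-x : ℝ) : ℂ) := by
        push_cast; linear_combination (x : ℂ) * Complex.I_mul_I
      rw [h1, mul_one, h2, hx1]
      have h3 := norm_expSum_le hs c lam (x := -x) (w := 0) (r := 1 / 2) (S := S) (by norm_num)
        (by simpa using h)
      have hsq : 0 < √(x ^ 2 + 1) := Real.sqrt_pos.mpr (by positivity)
      rw [div_le_iff₀ (by positivity)]
      refine h3.trans ?_
      rw [mul_right_comm, ← mul_pow]
      gcongr
      simp only [sub_zero, abs_neg]
      have h8 : (1:ℝ) ≤ √(x ^ 2 + 1) := by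
        rw [Real.one_le_sqrt]; nlinarith [sq_nonneg x]
      have h9 : |x| ≤ √(x ^ 2 + 1) := Real.abs_le_sqrt (by linarith)
      linarith) hζ
  rw [hf] at hPL
  simp only [norm_div, norm_pow, norm_mul] at hPL
  have hp := hne ζ hζ
  rw [div_le_iff₀ (by positivity)] at hPL
  have he : ‖Complex.exp (-(σ : ℂ) * ζ)‖ = (Real.exp (σ * ζ.re))⁻¹ := by
    rw [Complex.norm_exp, ← Real.exp_neg]
    congr 1
    rw [show (-(σ : ℂ) * ζ) = ((-σ : ℝ) : ℂ) * ζ by push_cast; ring, Complex.re_ofReal_mul]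
    ring
  rw [he, ← div_eq_mul_inv, div_le_iff₀ (Real.exp_pos _)] at hPL
  refine hPL.trans (le_of_eq ?_)
  rw [mul_pow]; ring

theorem norm_expSum_complex_le {n : ℕ} {s : Finset ι} (hs : s.card = n + 1)
    (c : ι → ℂ) (lam : ι → ℝ) {σ S : ℝ} (hσ : ∀ k ∈ s, |lam k| ≤ σ)
    (h : ∀ t : ℝ, |t| ≤ 1 / 2 → ‖expSum s c lam t‖ ≤ S) {z : ℂ} (hz : ‖z‖ ≤ 8) :
    ‖expSum s c lam z‖ ≤ Real.exp (6 * n + 8 * σ) * S := by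
  have hS : 0 ≤ S := (norm_nonneg _).trans (h 0 (by norm_num))
  have hσ0 : 0 ≤ σ := by
    obtain ⟨j, hj⟩ : s.Nonempty := Finset.card_pos.mp (by omega)
    exact (abs_nonneg _).trans (hσ j hj)
  have hfin : ∀ ζ : ℂ, ‖ζ‖ ≤ 8 → (24 * ‖ζ + 1‖) ^ n * Real.exp (σ * ζ.re) * S ≤
      Real.exp (6 * n + 8 * σ) * S := by
    intro ζ hζ
    gcongr
    rw [Real.exp_add, show (6 * n : ℝ) = n * 6 by ring, Real.exp_nat_mul]
    have h1 : ‖ζ + 1‖ ≤ 9 := (norm_add_le _ _).trans (by simp; linarith)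
    have h2 : ζ.re ≤ 8 := (Complex.re_le_norm _).trans hζ
    have h3 : (216 : ℝ) ≤ Real.exp 6 := by
      have : Real.exp 6 = Real.exp 1 ^ 6 := by rw [← Real.exp_nat_mul]; norm_num
      rw [this]
      have := Real.exp_one_gt_d9
      calc (216 : ℝ) ≤ 2.7 ^ 6 := by norm_num
        _ ≤ _ := by gcongr; linarith
    gcongr ?_ ^ n * Real.exp ?_
    · linarith
    · nlinarith
  rcases le_total 0 z.im with hz0 | hz0
  · have := norm_expSum_complex_le_of_im_nonneg hs c lam hσ h (ζ := -Complex.I * z)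
      (by simpa using hz0)
    rw [show Complex.I * (-Complex.I * z) = z by linear_combination (-z) * Complex.I_mul_I] at this
    exact this.trans (hfin _ (by simpa using hz))
  · have := norm_expSum_complex_le_of_im_nonneg hs c (fun k => -lam k) (σ := σ) (S := S)
      (by simpa using hσ) (by
        intro t ht
        rw [expSum_neg_arg]
        have := h (-t) (by simpa using ht)
        simpa using this) (ζ := Complex.I * z)
      (by simpa using hz0)
    rw [expSum_neg_arg,
      show -(Complex.I * (Complex.I * z)) = z by linear_combination (-z) * Complex.I_mul_I] at this
    exact this.trans (hfin _ (by simpa using hz))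

end Turan

section Factorization

open Metric

theorem exists_zero_factorization {w : ℂ} (hw : ‖w‖ ≤ 1 / 2) (N : ℕ) :
    ∀ (f : ℂ → ℂ) (A : ℝ), Differentiable ℂ f → f w ≠ 0 → A < N / 2 →
    (∀ z, ‖z‖ ≤ 8 → ‖f z‖ ≤ Real.exp A * ‖f w‖) →
    ∃ (Z : Multiset ℂ) (g : ℂ → ℂ), Differentiable ℂ g ∧
      (∀ z, f z = (Z.map fun a => z - a).prod * g z) ∧ (∀ z, ‖z‖ ≤ 2 → g z ≠ 0) ∧
      (Z.card : ℝ) / 2 ≤ A ∧ ∀ z, ‖z‖ ≤ 8 → ‖g z‖ ≤ Real.exp A * ‖g w‖ := by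
  induction N with
  | zero =>
    intro f A hf hfw hA h
    exfalso
    have h1 := h w (by linarith)
    have h2 : 1 ≤ Real.exp A := by
      have : 0 < ‖f w‖ := norm_pos_iff.mpr hfw
      by_contra! h3
      nlinarith
    rw [Real.one_le_exp_iff] at h2
    simp at hA; linarith
  | succ N ih =>
    intro f A hf hfw hA h
    have hA0 : 0 ≤ A := by
      have h1 := h w (by linarith)
      rw [← Real.one_le_exp_iff]
      have : 0 < ‖f w‖ := norm_pos_iff.mpr hfw
      by_contra! h3
      nlinarith
    by_cases hz : ∀ z, ‖z‖ ≤ 2 → f z ≠ 0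
    · exact ⟨0, f, hf, by simp, hz, by simpa using hA0, h⟩
    push Not at hz
    obtain ⟨a, ha, hfa⟩ := hz
    set f₁ := dslope f a with hf₁
    have hf₁d : Differentiable ℂ f₁ := by
      rw [← differentiableOn_univ, hf₁, Complex.differentiableOn_dslope Filter.univ_mem]
      exact hf.differentiableOn
    have hfac : ∀ z, f z = (z - a) * f₁ z := by
      intro z
      have := sub_smul_dslope f a z
      rw [hfa, sub_zero, smul_eq_mul] at this
      exact this.symm
    have hwa : ‖w - a‖ ≤ 5 / 2 := (norm_sub_le _ _).trans (by linarith)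
    have hf₁w : f₁ w ≠ 0 := fun h0 => hfw (by rw [hfac, h0, mul_zero])
    have hbd : ∀ z, ‖z‖ ≤ 8 → ‖f₁ z‖ ≤ Real.exp (A - 1 / 2) * ‖f₁ w‖ := by
      intro z hz
      refine Complex.norm_le_of_forall_mem_frontier_norm_le (U := ball (0 : ℂ) 8) isBounded_ball
        hf₁d.diffContOnCl ?_ (by rw [closure_ball _ (by norm_num)]; simpa using hz)
      intro ζ hζ
      rw [frontier_ball _ (by norm_num), mem_sphere_zero_iff_norm] at hζ
      have h1 := h ζ hζ.le
      rw [hfac ζ, hfac w, norm_mul, norm_mul] at h1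
      have h2 : 6 ≤ ‖ζ - a‖ := by
        have := norm_sub_norm_le ζ a
        linarith
      have h3 : Real.exp A = Real.exp (A - 1 / 2) * Real.exp (1 / 2) := by
        rw [← Real.exp_add]; ring_nf
      have h4 : Real.exp (1 / 2) ≤ 12 / 5 := by
        have h5 : Real.exp (1 / 2) ^ 2 = Real.exp 1 := by rw [← Real.exp_nat_mul]; norm_num
        have := Real.exp_one_lt_d9
        have h6 := Real.exp_pos (1 / 2 : ℝ)
        nlinarith
      have h7 := norm_nonneg (f₁ ζ)
      have h8 : Real.exp A * (‖w - a‖ * ‖f₁ w‖) ≤ 6 * (Real.exp (A - 1 / 2) * ‖f₁ w‖) := by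
        rw [h3]
        calc Real.exp (A - 1 / 2) * Real.exp (1 / 2) * (‖w - a‖ * ‖f₁ w‖)
            ≤ Real.exp (A - 1 / 2) * (12 / 5) * (5 / 2 * ‖f₁ w‖) := by gcongr
          _ = _ := by ring
      nlinarith
    obtain ⟨Z, g, hg, hprod, hne, hcard, hgb⟩ := ih f₁ (A - 1 / 2) hf₁d hf₁w
      (by push_cast at hA; linarith) hbd
    refine ⟨a ::ₘ Z, g, hg, fun z => ?_, hne, ?_, fun z hz => (hgb z hz).trans ?_⟩
    · rw [hfac, hprod, Multiset.map_cons, Multiset.prod_cons, mul_assoc]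
    · rw [Multiset.card_cons]; push_cast; linarith
    · gcongr; linarith

theorem log_norm_bounds_of_zero_free {g : ℂ → ℂ} {w : ℂ} {A : ℝ} (hg : Differentiable ℂ g)
    (hA : 0 < A) (hne : ∀ z ∈ ball w (3 / 2), g z ≠ 0)
    (hb : ∀ z ∈ ball w (3 / 2), ‖g z‖ ≤ Real.exp A * ‖g w‖) :
    (∀ z, ‖z - w‖ ≤ 5 / 4 → |Real.log ‖g z‖ - Real.log ‖g w‖| ≤ 10 * A) ∧
    (∀ z, ‖z - w‖ ≤ 1 → ‖deriv g z / g z‖ ≤ 40 * A) := by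
  have hw : w ∈ ball w (3 / 2 : ℝ) := mem_ball_self (by norm_num)
  have hdg : Differentiable ℂ (deriv g) := by
    have := hg.contDiff (n := 2)
    exact (this.differentiable_deriv_two)
  have hld : DifferentiableOn ℂ (fun z => deriv g z / g z) (ball w (3 / 2)) :=
    hdg.differentiableOn.div hg.differentiableOn hne
  obtain ⟨L, hL0, hL⟩ := hld.isExactOn_ball.with_val_at w (0 : ℂ)
  have hLg : ∀ z ∈ ball w (3 / 2), g z = g w * Complex.exp (L z) := by
    have hconst : ∀ z ∈ ball w (3 / 2), HasDerivAt (fun z => g z * Complex.exp (-L z)) 0 z := by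
      intro z hz
      have h1 := (hg z).hasDerivAt.mul (hL z hz).neg.cexp
      convert! h1 using 1
      field_simp [hne z hz]
      ring
    intro z hz
    have h2 := (convex_ball w (3 / 2 : ℝ)).is_const_of_fderivWithin_eq_zero (𝕜 := ℂ)
      (f := fun z => g z * Complex.exp (-L z))
      (fun z hz => (hconst z hz).differentiableAt.differentiableWithinAt) (by
        intro z hz
        rw [fderivWithin_of_isOpen isOpen_ball hz]
        ext
        simp [(hconst z hz).deriv]) hz hw
    simp only [hL0, neg_zero, Complex.exp_zero, mul_one] at h2
    rw [← h2, mul_assoc, ← Complex.exp_add]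
    simp
  have hgw : 0 < ‖g w‖ := norm_pos_iff.mpr (hne w hw)
  have hnorm : ∀ z ∈ ball w (3 / 2), ‖g z‖ = ‖g w‖ * Real.exp (L z).re := by
    intro z hz
    rw [hLg z hz, norm_mul, Complex.norm_exp]
  have hre : ∀ z ∈ ball w (3 / 2), (L z).re ≤ A := by
    intro z hz
    have := hb z hz
    rw [hnorm z hz, mul_comm] at this
    exact Real.exp_le_exp.mp (le_of_mul_le_mul_right this hgw)
  have hBC : ∀ z, ‖z - w‖ ≤ 5 / 4 → ‖L z‖ ≤ 10 * A := by
    intro z hz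
    have h1 := Complex.borelCaratheodory_zero (f := fun ζ => L (w + ζ)) (M := A) (R := 3 / 2)
      (z := z - w) hA (by
        intro ζ hζ
        have : w + ζ ∈ ball w (3 / 2 : ℝ) := by simpa using hζ
        exact ((hL _ this).comp_const_add w ζ).differentiableAt.differentiableWithinAt) (by
        intro ζ hζ
        exact hre _ (by simpa using hζ)) (by norm_num) (by
        rw [mem_ball_zero_iff]; linarith) (by simpa using hL0)
    simp only [add_sub_cancel] at h1
    refine h1.trans ?_
    rw [div_le_iff₀ (by linarith)]
    nlinarith
  constructor
  · intro z hz
    have hzb : z ∈ ball w (3 / 2 : ℝ) := by rw [mem_ball_iff_norm]; linarith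
    rw [hnorm z hzb, Real.log_mul hgw.ne' (Real.exp_pos _).ne', Real.log_exp, add_sub_cancel_left]
    exact (Complex.abs_re_le_norm _).trans (hBC z hz)
  · intro z hz
    have hzb : z ∈ ball w (3 / 2 : ℝ) := by rw [mem_ball_iff_norm]; linarith
    rw [← (hL z hzb).deriv]
    have hsub : closedBall z (1 / 4 : ℝ) ⊆ ball w (3 / 2) := by
      intro ζ hζ
      rw [mem_closedBall_iff_norm] at hζ
      rw [mem_ball_iff_norm]
      calc ‖ζ - w‖ = ‖(ζ - z) + (z - w)‖ := by ring_nf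
        _ ≤ ‖ζ - z‖ + ‖z - w‖ := norm_add_le _ _
        _ < _ := by linarith
    have := Complex.norm_deriv_le_of_forall_mem_sphere_norm_le (c := z) (R := 1 / 4) (C := 10 * A)
      (f := L) (by norm_num) (by
        refine DifferentiableOn.diffContOnCl_ball (U := ball w (3 / 2)) ?_ hsub
        exact fun ζ hζ => (hL ζ hζ).differentiableAt.differentiableWithinAt) (by
        intro ζ hζ
        rw [mem_sphere_iff_norm] at hζ
        apply hBC
        calc ‖ζ - w‖ = ‖(ζ - z) + (z - w)‖ := by ring_nf
          _ ≤ ‖ζ - z‖ + ‖z - w‖ := norm_add_le _ _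
          _ ≤ _ := by linarith)
    linarith

end Factorization

section CauchyKernel

open Metric Complex

/-- The sum of Cauchy kernels `∑ 1 / (z - a)` over the multiset `Z` of poles. -/
def cauchySum (Z : Multiset ℂ) (z : ℂ) : ℂ := (Z.map fun a => (z - a)⁻¹).sum

/-- The kernel `1 / (z - a)` in the disc coordinate `w`, where `z = i (1 + w) / (1 - w)`. -/
def discKernel (a w : ℂ) : ℂ := (1 - w) / ((I - a) + (I + a) * w)

theorem discKernel_denom_ne_zero {a w : ℂ} (ha : a.im < 0) (hw : ‖w‖ ≤ 1) :
    (I - a) + (I + a) * w ≠ 0 := by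
  intro h
  have h1 : normSq (I - a) = normSq (I + a) * normSq w := by
    rw [← map_mul, ← normSq_neg ((I + a) * w)]
    congr 1
    linear_combination h
  have h2 : normSq w ≤ 1 := by
    rw [normSq_eq_norm_sq]; nlinarith [norm_nonneg w]
  have h3 : normSq (I + a) < normSq (I - a) := by
    simp only [normSq_apply, add_re, add_im, sub_re, sub_im, I_re, I_im]; nlinarith
  nlinarith [normSq_nonneg (I + a)]

theorem discKernel_re_nonneg {a w : ℂ} (ha : a.im < 0) (hw : ‖w‖ ≤ 1) :
    0 ≤ (I * discKernel a w).re := by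
  have h2 : w.re * w.re + w.im * w.im ≤ 1 := by
    rw [← normSq_apply, normSq_eq_norm_sq]; nlinarith [norm_nonneg w]
  unfold discKernel
  rw [← mul_div_assoc, div_re, ← add_div]
  apply div_nonneg _ (normSq_nonneg _)
  simp only [mul_re, mul_im, add_re, add_im, sub_re, sub_im, I_re, I_im, one_re, one_im]
  nlinarith [mul_nonneg (neg_nonneg.mpr ha.le) (add_nonneg (mul_self_nonneg (1 - w.re))
    (mul_self_nonneg w.im))]

theorem sum_map_re_nonneg (Z : Multiset ℂ) (φ : ℂ → ℂ) (h : ∀ a ∈ Z, 0 ≤ (I * φ a).re) :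
    0 ≤ (I * (Z.map φ).sum).re := by
  induction Z using Multiset.induction_on with
  | empty => simp
  | cons a Z ih =>
    rw [Multiset.map_cons, Multiset.sum_cons, mul_add, add_re]
    exact add_nonneg (h a (Multiset.mem_cons_self a Z))
      (ih fun b hb => h b (Multiset.mem_cons_of_mem hb))

theorem norm_sum_map_le_card (Z : Multiset ℂ) (φ : ℂ → ℂ) (h : ∀ a ∈ Z, ‖φ a‖ ≤ 1) :
    ‖(Z.map φ).sum‖ ≤ Z.card := by
  induction Z using Multiset.induction_on with
  | empty => simp
  | cons a Z ih =>
    rw [Multiset.map_cons, Multiset.sum_cons, Multiset.card_cons]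
    push_cast
    refine (norm_add_le _ _).trans ?_
    linarith [h a (Multiset.mem_cons_self a Z), ih fun b hb => h b (Multiset.mem_cons_of_mem hb)]

theorem differentiableOn_discKernel_sum (Z : Multiset ℂ) (hZ : ∀ a ∈ Z, a.im < 0) :
    DifferentiableOn ℂ (fun w => (Z.map fun a => discKernel a w).sum) (closedBall 0 1) := by
  induction Z using Multiset.induction_on with
  | empty => simp
  | cons a Z ih =>
    simp only [Multiset.map_cons, Multiset.sum_cons]
    refine DifferentiableOn.add ?_ (ih fun b hb => hZ b (Multiset.mem_cons_of_mem hb))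
    unfold discKernel
    refine DifferentiableOn.div (by fun_prop) (by fun_prop) fun w hw => ?_
    exact discKernel_denom_ne_zero (hZ a (Multiset.mem_cons_self a Z)) (by simpa using hw)

theorem circleMap_two_arctan (t : ℝ) :
    circleMap 0 1 (2 * Real.arctan t + Real.pi) = -(1 + I * t) / (1 - I * t) := by
  have hne : (1 - I * t : ℂ) ≠ 0 := fun h => by
    have := congrArg re h; simp at this
  have hne2 : (1 + t ^ 2 : ℂ) ≠ 0 := by
    have : (1 + t ^ 2 : ℝ) ≠ 0 := by positivity
    exact_mod_cast this
  rw [circleMap_zero]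
  rw [show ((2 * Real.arctan t + Real.pi : ℝ) : ℂ) * I =
      (2 : ℕ) * ((Real.arctan t : ℝ) * I) + Real.pi * I by
      simp only [ofReal_add, ofReal_mul, ofReal_ofNat, Nat.cast_ofNat]; ring,
    ofReal_one, one_mul, Complex.exp_add, Complex.exp_pi_mul_I, Complex.exp_nat_mul, Complex.exp_mul_I, ← Complex.ofReal_cos, ← Complex.ofReal_sin,
    Real.cos_arctan, Real.sin_arctan]
  have hs : (√(1 + t ^ 2) : ℂ) ^ 2 = 1 + t ^ 2 := by
    rw [← ofReal_pow, Real.sq_sqrt (by positivity)]; push_cast; ring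
  have hs0 : (√(1 + t ^ 2) : ℂ) ≠ 0 := fun h => hne2 (by rw [← hs, h]; ring)
  push_cast
  rw [show (1 / (√(1 + t ^ 2) : ℂ) + t / (√(1 + t ^ 2) : ℂ) * I) = (1 + t * I) / √(1 + t ^ 2) by
    field_simp, div_pow, hs]
  rw [div_mul_eq_mul_div, div_eq_div_iff hne2 hne]
  linear_combination (t ^ 2 * (1 + t * I) : ℂ) * I_sq

theorem discKernel_circleMap {a : ℂ} (t : ℝ) (ha : a.im < 0) :
    discKernel a (circleMap 0 1 (2 * Real.arctan t + Real.pi)) = ((t : ℂ) - a)⁻¹ := by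
  have hd := discKernel_denom_ne_zero (w := circleMap 0 1 (2 * Real.arctan t + Real.pi)) ha
    (by simp)
  have hne : (1 - I * t : ℂ) ≠ 0 := fun h => by
    have := congrArg re h; simp at this
  have hta : (t : ℂ) - a ≠ 0 := fun h => by
    have := congrArg im h; simp at this; linarith
  unfold discKernel
  rw [circleMap_two_arctan] at hd ⊢
  rw [div_eq_iff hd, ← div_eq_inv_mul, eq_div_iff hta]
  field_simp
  linear_combination (2 * t : ℂ) * I_sq

theorem integral_log_cauchySum_le (Z : Multiset ℂ) (hZ : ∀ a ∈ Z, a.im < 0) {T : ℝ} (hT : 0 < T) :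
    (∀ t : ℝ, 0 ≤ Real.log ‖1 + I / T * cauchySum Z t‖) ∧
    Continuous (fun t : ℝ => Real.log ‖1 + I / T * cauchySum Z t‖) ∧
    ∫ t in (-1 : ℝ)..1, Real.log ‖1 + I / T * cauchySum Z t‖ ≤ 2 * Real.pi * Z.card / T := by
  set H : ℂ → ℂ := fun w => 1 + I / T * (Z.map fun a => discKernel a w).sum with hH
  have hHre : ∀ w, ‖w‖ ≤ 1 → 1 ≤ (H w).re := by
    intro w hw
    have := sum_map_re_nonneg Z (fun a => discKernel a w) fun a ha => discKernel_re_nonneg (hZ a ha) hw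
    rw [hH]
    simp only [add_re, one_re]
    rw [div_mul_eq_mul_div, div_ofReal_re]
    have := div_nonneg this hT.le
    linarith
  have hHd : DifferentiableOn ℂ H (closedBall 0 1) := by
    rw [hH]
    exact (differentiableOn_const _).add ((differentiableOn_discKernel_sum Z hZ).const_mul _)
  have hslit : ∀ w, ‖w‖ ≤ 1 → H w ∈ slitPlane := fun w hw => Or.inl (by linarith [hHre w hw])
  have hLd : DifferentiableOn ℂ (fun w => Complex.log (H w)) (closedBall 0 1) :=
    hHd.clog fun w hw => hslit w (by simpa using hw)
  set U : ℝ → ℝ := fun θ => Real.log ‖H (circleMap 0 1 θ)‖ with hU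
  have hU0 : ∀ θ, 0 ≤ U θ := fun θ =>
    Real.log_nonneg ((hHre _ (by simp)).trans (re_le_norm _))
  have hmap : ∀ θ : ℝ, circleMap 0 1 θ ∈ closedBall (0 : ℂ) 1 := fun θ => by simp
  have hLc : Continuous fun θ : ℝ => Complex.log (H (circleMap 0 1 θ)) :=
    hLd.continuousOn.comp_continuous (continuous_circleMap 0 1) hmap
  have hUc : Continuous U := by
    have : U = fun θ => (Complex.log (H (circleMap 0 1 θ))).re := by
      ext θ; rw [Complex.log_re]
    rw [this]
    exact continuous_re.comp hLc
  have hmean : ∫ θ in (0 : ℝ)..2 * Real.pi, U θ ≤ 2 * Real.pi * Z.card / T := by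
    have h1 := circleAverage_of_differentiable_on_off_countable (c := (0 : ℂ)) (R := 1)
      (f := fun w => Complex.log (H w)) Set.countable_empty (by simpa using hLd.continuousOn) (by
        intro z hz
        have hz' : z ∈ ball (0 : ℂ) 1 := by simpa using hz
        exact (hLd z (ball_subset_closedBall hz')).differentiableAt
          (Filter.mem_of_superset (isOpen_ball.mem_nhds hz') ball_subset_closedBall))
    rw [Real.circleAverage_def] at h1
    have h2 : (∫ θ in (0 : ℝ)..2 * Real.pi, Complex.log (H (circleMap 0 1 θ))).re =
        ∫ θ in (0 : ℝ)..2 * Real.pi, U θ := by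
      have := (reCLM.intervalIntegral_comp_comm (hLc.intervalIntegrable (μ := volume) 0 (2 * Real.pi))).symm
      simp only [reCLM_apply] at this
      rw [this]
      exact intervalIntegral.integral_congr fun θ _ => by simp [hU, Complex.log_re]
    have h3 := congrArg re h1
    rw [Complex.smul_re, h2, Complex.log_re, smul_eq_mul, inv_mul_eq_iff_eq_mul₀ (by positivity)] at h3
    rw [h3, mul_div_assoc]
    gcongr
    have h4 : ‖H 0‖ ≤ 1 + Z.card / T := by
      rw [hH]
      refine (norm_add_le _ _).trans ?_
      rw [norm_one, norm_mul, norm_div, norm_I, norm_real, Real.norm_of_nonneg hT.le,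
        div_mul_eq_mul_div, one_mul]
      gcongr
      refine norm_sum_map_le_card Z _ fun a ha => ?_
      unfold discKernel
      simp only [sub_zero, mul_zero, add_zero, norm_div, norm_one]
      apply div_le_one_of_le₀ _ (norm_nonneg _)
      have := abs_im_le_norm (I - a)
      rw [sub_im, I_im, abs_of_nonneg (by linarith [hZ a ha])] at this
      linarith [hZ a ha]
    have h5 : 0 < ‖H 0‖ := by
      have := (hHre 0 (by simp)).trans (re_le_norm _); linarith
    have h6 := Real.log_le_sub_one_of_pos h5
    linarith
  have hUt : ∀ t : ℝ, U (2 * Real.arctan t + Real.pi) = Real.log ‖1 + I / T * cauchySum Z t‖ := by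
    intro t
    simp only [hU, hH, cauchySum]
    congr 5
    exact Multiset.map_congr rfl fun a ha => discKernel_circleMap t (hZ a ha)
  simp_rw [← hUt]
  refine ⟨fun t => hU0 _, hUc.comp (by fun_prop), ?_⟩
  have hcv := intervalIntegral.integral_comp_mul_deriv (a := -1) (b := 1) (f := Real.arctan)
    (f' := fun t => 1 / (1 + t ^ 2)) (g := fun φ => U (2 * φ + Real.pi))
    (fun x _ => Real.hasDerivAt_arctan x) (by
      refine Continuous.continuousOn ?_
      exact continuous_const.div (by fun_prop) fun x => by positivity) (by fun_prop)
  rw [Real.arctan_neg, Real.arctan_one] at hcv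
  have h7 : ∫ φ in (-(Real.pi / 4))..(Real.pi / 4), U (2 * φ + Real.pi) =
      2⁻¹ * ∫ θ in (Real.pi / 2)..(3 * Real.pi / 2), U θ := by
    have := intervalIntegral.integral_comp_mul_add (a := -(Real.pi / 4)) (b := Real.pi / 4) U
      (c := 2) (by norm_num) Real.pi
    rw [this, smul_eq_mul]
    congr 2 <;> ring
  have h8 : ∫ θ in (Real.pi / 2)..(3 * Real.pi / 2), U θ ≤ ∫ θ in (0 : ℝ)..2 * Real.pi, U θ := by
    have := Real.pi_pos
    apply intervalIntegral.integral_mono_interval (by positivity) (by linarith) (by linarith)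
    · exact Filter.Eventually.of_forall hU0
    · exact hUc.intervalIntegrable _ _
  have h9 : ∫ t in (-1 : ℝ)..1, U (2 * Real.arctan t + Real.pi) ≤
      ∫ t in (-1 : ℝ)..1, 2 * (((fun φ => U (2 * φ + Real.pi)) ∘ Real.arctan) t * (1 / (1 + t ^ 2))) := by
    apply intervalIntegral.integral_mono_on (by norm_num)
    · exact (hUc.comp (by fun_prop)).intervalIntegrable _ _
    · refine Continuous.intervalIntegrable ?_ _ _
      refine continuous_const.mul ((hUc.comp (by fun_prop)).mul ?_)
      exact continuous_const.div (by fun_prop) fun x => by positivity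
    · intro t ht
      have h10 := hU0 (2 * Real.arctan t + Real.pi)
      simp only [Function.comp]
      have h11 : (1 : ℝ) / 2 ≤ 1 / (1 + t ^ 2) := by
        apply one_div_le_one_div_of_le (by positivity)
        nlinarith [ht.1, ht.2]
      nlinarith
  rw [intervalIntegral.integral_const_mul, hcv, h7] at h9
  linarith

theorem cauchySum_re_nonneg {Z : Multiset ℂ} (hZ : ∀ a ∈ Z, a.im ≤ 0) (t : ℝ) :
    0 ≤ (I * cauchySum Z t).re := by
  refine sum_map_re_nonneg Z _ fun a ha => ?_
  rw [mul_re, I_re, I_im, inv_im, inv_re]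
  simp only [sub_im, ofReal_im, zero_sub, neg_neg, zero_mul, one_mul]
  have := div_nonneg_of_nonpos (hZ a ha) (neg_nonpos.mpr (normSq_nonneg ((t : ℂ) - a)))
  rw [div_neg] at this
  linarith

theorem measurable_cauchySum (Z : Multiset ℂ) : Measurable (cauchySum Z) := by
  unfold cauchySum
  induction Z using Multiset.induction_on with
  | empty => simp
  | cons a Z ih =>
    simp only [Multiset.map_cons, Multiset.sum_cons]
    exact Measurable.add (by fun_prop) ih

theorem lintegral_log_cauchySum_le (Z : Multiset ℂ) (hZ : ∀ a ∈ Z, a.im ≤ 0) {T : ℝ} (hT : 0 < T) :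
    ∫⁻ t in Set.Icc (-1 : ℝ) 1, ENNReal.ofReal (Real.log ‖1 + I / T * cauchySum Z t‖) ≤
      ENNReal.ofReal (2 * Real.pi * Z.card / T) := by
  set e : ℕ → ℝ := fun n => 1 / ((n : ℝ) + 1) with he
  have hepos : ∀ n, 0 < e n := fun n => by positivity
  set Zn : ℕ → Multiset ℂ := fun n => Z.map fun a => a - e n * I with hZn
  have hcs : ∀ n (t : ℝ), cauchySum (Zn n) t = cauchySum Z (t + e n * I) := by
    intro n t
    simp only [cauchySum, hZn, Multiset.map_map, Function.comp]
    congr 2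
    ext a
    congr 1; ring
  have hlim : ∀ᵐ t : ℝ, Filter.Tendsto (fun n => ENNReal.ofReal
      (Real.log ‖1 + I / T * cauchySum (Zn n) t‖)) Filter.atTop
      (nhds (ENNReal.ofReal (Real.log ‖1 + I / T * cauchySum Z t‖))) := by
    have hfin : (Z.toFinset.image re : Set ℝ).Finite := Finset.finite_toSet _
    filter_upwards [hfin.countable.ae_notMem volume] with t ht
    refine (ENNReal.continuous_ofReal.tendsto _).comp ?_
    have hne : 1 + I / T * cauchySum Z t ≠ 0 := by
      intro h
      have h1 := cauchySum_re_nonneg hZ t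
      have h2 := congrArg re h
      rw [add_re, one_re, div_mul_eq_mul_div, div_ofReal_re, zero_re] at h2
      have := div_nonneg h1 hT.le
      linarith
    refine Filter.Tendsto.log ?_ (norm_ne_zero_iff.mpr hne)
    refine Filter.Tendsto.norm (Filter.Tendsto.const_add _ (Filter.Tendsto.const_mul _ ?_))
    simp_rw [hcs]
    have hcont : ∀ Y : Multiset ℂ, (∀ a ∈ Y, (t : ℂ) ≠ a) → ContinuousAt (cauchySum Y) t := by
      intro Y
      unfold cauchySum
      induction Y using Multiset.induction_on with
      | empty => intro _; simpa using continuousAt_const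
      | cons a Y ih =>
        intro hY
        simp only [Multiset.map_cons, Multiset.sum_cons]
        refine ContinuousAt.add (ContinuousAt.inv₀ (by fun_prop) ?_)
          (ih fun b hb => hY b (Multiset.mem_cons_of_mem hb))
        exact sub_ne_zero.mpr (hY a (Multiset.mem_cons_self a Y))
    have := hcont Z (by
      intro a ha h
      apply ht
      simp only [Finset.coe_image, Set.mem_image, Finset.mem_coe, Multiset.mem_toFinset]
      exact ⟨a, ha, by rw [← h, ofReal_re]⟩)
    refine this.tendsto.comp ?_
    have h0 : Filter.Tendsto (fun n => (e n : ℂ)) Filter.atTop (nhds ((0 : ℝ) : ℂ)) :=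
      (continuous_ofReal.tendsto _).comp tendsto_one_div_add_atTop_nhds_zero_nat
    simpa using (h0.mul_const I).const_add (t : ℂ)
  have hZnim : ∀ n, ∀ a ∈ Zn n, a.im < 0 := by
    intro n a ha
    simp only [hZn, Multiset.mem_map] at ha
    obtain ⟨b, hb, rfl⟩ := ha
    simp only [sub_im, mul_im, ofReal_re, I_im, mul_one, ofReal_im, I_re, mul_zero, add_zero]
    linarith [hZ b hb, hepos n]
  have hbound : ∀ n, ∫⁻ t in Set.Icc (-1 : ℝ) 1,
      ENNReal.ofReal (Real.log ‖1 + I / T * cauchySum (Zn n) t‖) ≤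
      ENNReal.ofReal (2 * Real.pi * Z.card / T) := by
    intro n
    obtain ⟨h1, h2, h3⟩ := integral_log_cauchySum_le (Zn n) (hZnim n) hT
    rw [← ofReal_integral_eq_lintegral_ofReal (h2.continuousOn.integrableOn_compact isCompact_Icc)
      (Filter.Eventually.of_forall h1), integral_Icc_eq_integral_Ioc,
      ← intervalIntegral.integral_of_le (by norm_num)]
    apply ENNReal.ofReal_le_ofReal
    simpa [hZn] using h3
  calc ∫⁻ t in Set.Icc (-1 : ℝ) 1, ENNReal.ofReal (Real.log ‖1 + I / T * cauchySum Z t‖)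
      = ∫⁻ t in Set.Icc (-1 : ℝ) 1, Filter.liminf (fun n => ENNReal.ofReal
          (Real.log ‖1 + I / T * cauchySum (Zn n) t‖)) Filter.atTop := by
        apply lintegral_congr_ae
        filter_upwards [ae_restrict_of_ae hlim] with t ht
        exact ht.liminf_eq.symm
    _ ≤ Filter.liminf (fun n => ∫⁻ t in Set.Icc (-1 : ℝ) 1, ENNReal.ofReal
          (Real.log ‖1 + I / T * cauchySum (Zn n) t‖)) Filter.atTop := by
        apply lintegral_liminf_le
        intro n
        have := measurable_cauchySum (Zn n)
        fun_prop
    _ ≤ _ := by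
        refine Filter.liminf_le_of_frequently_le' ?_
        exact Filter.Frequently.of_forall hbound

theorem norm_one_add_ge {T : ℝ} (hT : 0 < T) {F : ℂ} (hF : 0 ≤ (I * F).re) :
    1 ≤ ‖1 + I / T * F‖ ∧ ‖F‖ / T ≤ ‖1 + I / T * F‖ := by
  have h1 : 0 ≤ (I / T * F).re := by
    rw [div_mul_eq_mul_div, div_ofReal_re]; exact div_nonneg hF hT.le
  refine ⟨?_, ?_⟩
  · refine le_trans ?_ (re_le_norm _)
    rw [add_re, one_re]; linarith
  · have h2 : ‖F‖ / T = ‖I / T * F‖ := by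
      rw [norm_mul, norm_div, norm_I, norm_real, Real.norm_of_nonneg hT.le]; ring
    rw [h2, ← sq_le_sq₀ (norm_nonneg _) (norm_nonneg _), ← normSq_eq_norm_sq, ← normSq_eq_norm_sq,
      normSq_apply, normSq_apply, add_re, add_im, one_re, one_im]
    nlinarith

/-- A logarithmic weak-type bound for sums of Cauchy kernels on the real line. -/
theorem lintegral_log_max_cauchySum_le (Z : Multiset ℂ) {T : ℝ} (hT : 0 < T) :
    ∫⁻ t in Set.Icc (-1 : ℝ) 1,
      ENNReal.ofReal (Real.log (max 1 (‖cauchySum Z t‖ / (2 * T)))) ≤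
      ENNReal.ofReal (2 * Real.pi * Z.card / T) := by
  classical
  set Y₁ := Z.filter fun a => a.im ≤ 0 with hY₁
  set Y₂ := (Z.filter fun a => ¬ a.im ≤ 0).map (starRingEnd ℂ) with hY₂
  have hY₁im : ∀ a ∈ Y₁, a.im ≤ 0 := fun a ha => (Multiset.mem_filter.mp ha).2
  have hY₂im : ∀ a ∈ Y₂, a.im ≤ 0 := by
    intro a ha
    simp only [hY₂, Multiset.mem_map, Multiset.mem_filter] at ha
    obtain ⟨b, ⟨_, hb⟩, rfl⟩ := ha
    rw [conj_im]; linarith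
  have hcard : Z.card = Y₁.card + Y₂.card := by
    rw [hY₂, Multiset.card_map, hY₁, ← Multiset.card_add, Multiset.filter_add_not]
  have hsplit : ∀ t : ℝ, cauchySum Z t = cauchySum Y₁ t + (starRingEnd ℂ) (cauchySum Y₂ t) := by
    intro t
    have h1 : (starRingEnd ℂ) (cauchySum Y₂ t) = cauchySum (Z.filter fun a => ¬ a.im ≤ 0) t := by
      simp only [cauchySum, hY₂, Multiset.map_map, map_multiset_sum, Function.comp, map_inv₀,
        map_sub, conj_ofReal, conj_conj]
    rw [h1]
    simp only [cauchySum, hY₁]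
    rw [← Multiset.sum_add, ← Multiset.map_add, Multiset.filter_add_not]
  have hpt : ∀ t : ℝ, ENNReal.ofReal (Real.log (max 1 (‖cauchySum Z t‖ / (2 * T)))) ≤
      ENNReal.ofReal (Real.log ‖1 + I / T * cauchySum Y₁ t‖) +
      ENNReal.ofReal (Real.log ‖1 + I / T * cauchySum Y₂ t‖) := by
    intro t
    obtain ⟨a1, a2⟩ := norm_one_add_ge hT (cauchySum_re_nonneg hY₁im t)
    obtain ⟨b1, b2⟩ := norm_one_add_ge hT (cauchySum_re_nonneg hY₂im t)
    rw [← ENNReal.ofReal_add (Real.log_nonneg a1) (Real.log_nonneg b1),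
      ← Real.log_mul (by linarith) (by linarith)]
    apply ENNReal.ofReal_le_ofReal
    apply Real.log_le_log (by positivity)
    apply max_le
    · nlinarith
    · have h1 : ‖cauchySum Z t‖ ≤ ‖cauchySum Y₁ t‖ + ‖cauchySum Y₂ t‖ := by
        rw [hsplit]
        refine (norm_add_le _ _).trans ?_
        rw [RCLike.norm_conj]
      have h2 : ‖cauchySum Z t‖ / (2 * T) ≤
          (‖cauchySum Y₁ t‖ / T + ‖cauchySum Y₂ t‖ / T) / 2 := by
        rw [← add_div, div_div, mul_comm T 2]
        gcongr
      nlinarith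
  calc _ ≤ ∫⁻ t in Set.Icc (-1 : ℝ) 1,
      (ENNReal.ofReal (Real.log ‖1 + I / T * cauchySum Y₁ t‖) +
      ENNReal.ofReal (Real.log ‖1 + I / T * cauchySum Y₂ t‖)) := lintegral_mono fun t => hpt t
    _ = _ := lintegral_add_left (by
        have := measurable_cauchySum Y₁
        fun_prop) _
    _ ≤ _ := add_le_add (lintegral_log_cauchySum_le Y₁ hY₁im hT)
        (lintegral_log_cauchySum_le Y₂ hY₂im hT)
    _ = _ := by
        rw [← ENNReal.ofReal_add (by positivity) (by positivity), hcard]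
        push_cast
        congr 1; ring

end CauchyKernel

section LogAverage

theorem analyticAt_comp_ofReal {f : ℂ → ℂ} (hf : Differentiable ℂ f) (t : ℝ) :
    AnalyticAt ℝ (fun t : ℝ => f t) t :=
  ((hf.analyticAt (t : ℂ)).restrictScalars (𝕜 := ℝ)).comp (Complex.ofRealCLM.analyticAt t)

theorem ae_ne_zero_of_differentiable {f : ℂ → ℂ} (hf : Differentiable ℂ f) {x : ℝ}
    (hx : f x ≠ 0) : ∀ᵐ t : ℝ, f t ≠ 0 := by
  have h : AnalyticOnNhd ℝ (fun t : ℝ => f t) Set.univ := fun t _ => analyticAt_comp_ofReal hf t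
  have h2 := h.preimage_zero_mem_codiscrete hx
  have h3 := ae_restrict_le_codiscreteWithin (μ := (volume : Measure ℝ)) MeasurableSet.univ h2
  rw [Measure.restrict_univ] at h3
  filter_upwards [h3] with t ht
  simpa using ht

theorem integrableOn_log_norm {f : ℂ → ℂ} (hf : Differentiable ℂ f) {E : Set ℝ}
    (hE : E ⊆ Set.Icc (-1 / 2) (1 / 2)) : IntegrableOn (fun t : ℝ => Real.log ‖f t‖) E := by
  have h : MeromorphicOn (fun t : ℝ => f t) (Set.uIcc (-1 / 2) (1 / 2)) :=
    fun t _ => (analyticAt_comp_ofReal hf t).meromorphicAt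
  have h2 := h.intervalIntegrable_log_norm
  rw [intervalIntegrable_iff_integrableOn_Icc_of_le (by norm_num)] at h2
  exact h2.mono_set hE

/-- The excess of `log |t - x|` truncated at scale `s` over `log |t - x|`. -/
def logExcess (s x t : ℝ) : ℝ := Real.log (max |t - x| s) - Real.log |t - x|

theorem logExcess_nonneg {s x t : ℝ} (h : t ≠ x) : 0 ≤ logExcess s x t :=
  sub_nonneg.mpr (Real.log_le_log (abs_pos.mpr (sub_ne_zero.mpr h)) (le_max_left _ _))

theorem logExcess_eq_zero {s x t : ℝ} (h : t ∉ Set.Icc (x - s) (x + s)) : logExcess s x t = 0 := by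
  unfold logExcess
  rw [max_eq_left, sub_self]
  by_contra! h2
  exact h ⟨by linarith [(abs_lt.mp h2).1], by linarith [(abs_lt.mp h2).2]⟩

theorem integral_logExcess {s : ℝ} (hs : 0 < s) (x : ℝ) :
    Integrable (logExcess s x) ∧ ∫ t, logExcess s x t = 2 * s := by
  have hsupp : Function.support (logExcess s x) ⊆ Set.Icc (x - s) (x + s) := by
    intro t ht
    by_contra h
    exact ht (logExcess_eq_zero h)
  have hEq : Set.EqOn (fun t => Real.log s - Real.log (t - x)) (logExcess s x)
      (Set.Icc (x - s) (x + s)) := by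
    intro t ht
    have : |t - x| ≤ s := abs_le.mpr ⟨by linarith [ht.1], by linarith [ht.2]⟩
    simp only [logExcess, max_eq_right this, Real.log_abs]
  have hII : IntervalIntegrable (fun t => Real.log s - Real.log (t - x)) volume (x - s) (x + s) := by
    refine intervalIntegrable_const.sub ?_
    have := intervalIntegral.intervalIntegrable_log' (a := -s) (b := s)
    have h2 := this.comp_sub_right x
    convert h2 using 1 <;> ring
  constructor
  · rw [← integrableOn_iff_integrable_of_support_subset hsupp]
    rw [intervalIntegrable_iff_integrableOn_Icc_of_le (by linarith)] at hII
    exact hII.congr_fun hEq measurableSet_Icc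
  · rw [← setIntegral_eq_integral_of_forall_compl_eq_zero (s := Set.Icc (x - s) (x + s))
      (fun t ht => logExcess_eq_zero ht), ← setIntegral_congr_fun measurableSet_Icc hEq,
      integral_Icc_eq_integral_Ioc, ← intervalIntegral.integral_of_le (by linarith),
      intervalIntegral.integral_comp_sub_right (fun t => Real.log s - Real.log t),
      intervalIntegral.integral_sub (by simp) intervalIntegral.intervalIntegrable_log',
      integral_log]
    simp only [intervalIntegral.integral_const, smul_eq_mul]
    rw [show x - s - x = -s by ring, Real.log_neg_eq_log]
    ring_nf

theorem setIntegral_logExcess_le {s : ℝ} (hs : 0 < s) (x : ℝ) (E : Set ℝ) :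
    ∫ t in E, logExcess s x t ≤ 2 * s := by
  rw [← (integral_logExcess hs x).2]
  refine setIntegral_le_integral (integral_logExcess hs x).1 ?_
  have : ∀ᵐ t : ℝ, t ≠ x := by simp [ae_iff]
  filter_upwards [this] with t ht using logExcess_nonneg ht

theorem setIntegral_sum_logExcess_le {s : ℝ} (hs : 0 < s) (Z : Multiset ℂ) (E : Set ℝ) :
    IntegrableOn (fun t => (Z.map fun a => logExcess s a.re t).sum) E ∧
    ∫ t in E, (Z.map fun a => logExcess s a.re t).sum ≤ 2 * s * Z.card := by
  induction Z using Multiset.induction_on with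
  | empty => simp
  | cons a Z ih =>
    have h1 : IntegrableOn (logExcess s a.re) E := (integral_logExcess hs a.re).1.integrableOn
    simp only [Multiset.map_cons, Multiset.sum_cons, Multiset.card_cons]
    refine ⟨h1.add ih.1, ?_⟩
    rw [integral_add h1 ih.1]
    push_cast
    linarith [setIntegral_logExcess_le hs a.re E, ih.2]

theorem log_norm_prod_le {s : ℝ} (hs : 0 < s) {u t : ℝ} (hu : |u - t| ≤ s) (Z : Multiset ℂ)
    (hZ : ∀ a ∈ Z, t ≠ a.re ∧ (u : ℂ) ≠ a) :
    Real.log ‖(Z.map fun a => (u : ℂ) - a).prod‖ ≤ Real.log ‖(Z.map fun a => (t : ℂ) - a).prod‖ +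
      Z.card * Real.log 2 + (Z.map fun a => logExcess s a.re t).sum := by
  induction Z using Multiset.induction_on with
  | empty => simp
  | cons a Z ih =>
    have ih' := ih fun b hb => hZ b (Multiset.mem_cons_of_mem hb)
    obtain ⟨h1, h2⟩ := hZ a (Multiset.mem_cons_self a Z)
    have h3 : ∀ b ∈ Z, (t : ℂ) ≠ b := fun b hb h =>
      (hZ b (Multiset.mem_cons_of_mem hb)).1 (by rw [← h, Complex.ofReal_re])
    have h4 : (t : ℂ) ≠ a := fun h => h1 (by rw [← h, Complex.ofReal_re])
    have hne : ∀ v : ℂ, (∀ b ∈ Z, v ≠ b) → ‖(Z.map fun a => v - a).prod‖ ≠ 0 := by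
      intro v hv
      rw [norm_ne_zero_iff]
      apply Multiset.prod_ne_zero
      rw [Multiset.mem_map]
      rintro ⟨b, hb, hb0⟩
      exact hv b hb (sub_eq_zero.mp hb0)
    simp only [Multiset.map_cons, Multiset.prod_cons, Multiset.sum_cons, Multiset.card_cons, norm_mul]
    rw [Real.log_mul (norm_ne_zero_iff.mpr (sub_ne_zero.mpr h2))
        (hne _ fun b hb => (hZ b (Multiset.mem_cons_of_mem hb)).2),
      Real.log_mul (norm_ne_zero_iff.mpr (sub_ne_zero.mpr h4)) (hne _ h3)]
    have hx : 0 < |t - a.re| := abs_pos.mpr (sub_ne_zero.mpr h1)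
    have hta : |t - a.re| ≤ ‖(t : ℂ) - a‖ := by
      have := Complex.abs_re_le_norm ((t : ℂ) - a)
      simpa using this
    have hua : ‖(u : ℂ) - a‖ ≤ s + ‖(t : ℂ) - a‖ := by
      calc ‖(u : ℂ) - a‖ = ‖((u - t : ℝ) : ℂ) + ((t : ℂ) - a)‖ := by push_cast; ring_nf
        _ ≤ _ := norm_add_le _ _
        _ ≤ _ := by rw [Complex.norm_real, Real.norm_eq_abs]; gcongr
    have hkey : Real.log ‖(u : ℂ) - a‖ ≤
        Real.log ‖(t : ℂ) - a‖ + Real.log 2 + logExcess s a.re t := by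
      have hua0 : 0 < ‖(u : ℂ) - a‖ := norm_pos_iff.mpr (sub_ne_zero.mpr h2)
      have hta0 : 0 < ‖(t : ℂ) - a‖ := hx.trans_le hta
      have hm : 0 < max |t - a.re| s := lt_max_of_lt_right hs
      unfold logExcess
      rw [← Real.log_mul hta0.ne' (by norm_num), ← Real.log_div hm.ne' hx.ne',
        ← Real.log_mul (by positivity) (by positivity)]
      apply Real.log_le_log hua0
      rw [← mul_div_assoc, le_div_iff₀ hx]
      have e1 : |t - a.re| ≤ max |t - a.re| s := le_max_left _ _
      have e2 : s ≤ max |t - a.re| s := le_max_right _ _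
      calc ‖(u : ℂ) - a‖ * |t - a.re| ≤ (s + ‖(t : ℂ) - a‖) * |t - a.re| := by gcongr
        _ = s * |t - a.re| + ‖(t : ℂ) - a‖ * |t - a.re| := by ring
        _ ≤ max |t - a.re| s * ‖(t : ℂ) - a‖ + ‖(t : ℂ) - a‖ * max |t - a.re| s := by gcongr
        _ = _ := by ring
    push_cast
    linarith

end LogAverage

section Local

variable {ι : Type*}

/-- Local factorization of an exponential sum of order `n + 1` with frequencies in `[-σ, σ]`. -/
theorem expSum_factorization {n : ℕ} {s : Finset ι} (hs : s.card = n + 1) (c : ι → ℂ) (lam : ι → ℝ)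
    {σ : ℝ} (hσ : ∀ k ∈ s, |lam k| ≤ σ) {w : ℝ} (hw : |w| ≤ 1 / 2) (hpw : expSum s c lam w ≠ 0)
    (hmax : ∀ t : ℝ, |t| ≤ 1 / 2 → ‖expSum s c lam t‖ ≤ ‖expSum s c lam w‖) :
    ∃ (Z : Multiset ℂ) (g : ℂ → ℂ), Differentiable ℂ g ∧
      (∀ z, expSum s c lam z = (Z.map fun a => z - a).prod * g z) ∧
      (Z.card : ℝ) ≤ 2 * (6 * n + 8 * σ + 1) ∧
      (∀ z, ‖z‖ ≤ 3 / 4 → g z ≠ 0) ∧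
      (∀ z z', ‖z‖ ≤ 3 / 4 → ‖z'‖ ≤ 3 / 4 →
        Real.log ‖g z‖ ≤ Real.log ‖g z'‖ + 20 * (6 * n + 8 * σ + 1)) ∧
      (∀ z, ‖z‖ ≤ 1 / 2 → ‖deriv g z / g z‖ ≤ 40 * (6 * n + 8 * σ + 1)) := by
  have hσ0 : 0 ≤ σ := by
    obtain ⟨j, hj⟩ : s.Nonempty := Finset.card_pos.mp (by omega)
    exact (abs_nonneg _).trans (hσ j hj)
  set A : ℝ := 6 * n + 8 * σ + 1 with hA
  have hA0 : 0 < A := by positivity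
  have hwn : ‖(w : ℂ)‖ ≤ 1 / 2 := by simpa using hw
  obtain ⟨N, hN⟩ := exists_nat_gt (2 * A)
  obtain ⟨Z, g, hg, hprod, hne, hcard, hgb⟩ := exists_zero_factorization hwn N (expSum s c lam) A
    (differentiable_expSum s c lam) hpw (by linarith) (by
      intro z hz
      refine (norm_expSum_complex_le hs c lam hσ hmax hz).trans ?_
      gcongr
      linarith)
  have hball : ∀ z ∈ Metric.ball (w : ℂ) (3 / 2), ‖z‖ ≤ 2 := by
    intro z hz
    rw [mem_ball_iff_norm] at hz
    have := norm_sub_norm_le z w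
    linarith
  obtain ⟨h1, h2⟩ := log_norm_bounds_of_zero_free (w := w) hg hA0 (fun z hz => hne z (hball z hz))
    (fun z hz => hgb z (by linarith [hball z hz]))
  refine ⟨Z, g, hg, hprod, by linarith, fun z hz => hne z (by linarith), ?_, ?_⟩
  · intro z z' hz hz'
    have a1 := (abs_le.mp (h1 z ((norm_sub_le _ _).trans (by linarith)))).2
    have a2 := (abs_le.mp (h1 z' ((norm_sub_le _ _).trans (by linarith)))).1
    linarith
  · intro z hz
    exact h2 z ((norm_sub_le _ _).trans (by linarith))

theorem log_average_of_small_spread {n : ℕ} {s : Finset ι} (hs : s.card = n + 1) (c : ι → ℂ)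
    (lam : ι → ℝ) {σ : ℝ} (hσ : ∀ k ∈ s, |lam k| ≤ σ) {w : ℝ} (hw : |w| ≤ 1 / 2)
    (hpw : expSum s c lam w ≠ 0)
    (hmax : ∀ t : ℝ, |t| ≤ 1 / 2 → ‖expSum s c lam t‖ ≤ ‖expSum s c lam w‖)
    {E : Set ℝ} (hE : MeasurableSet E) (hEI : E ⊆ Set.Icc (-1 / 2) (1 / 2))
    (hE0 : 0 < volume.real E) :
    volume.real E * (Real.log ‖expSum s c lam w‖ - n * (Real.log 40 - Real.log (volume.real E)) -
      26 * (6 * n + 8 * σ + 1)) ≤ ∫ t in E, Real.log ‖expSum s c lam t‖ := by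
  have hσ0 : 0 ≤ σ := by
    obtain ⟨j, hj⟩ : s.Nonempty := Finset.card_pos.mp (by omega)
    exact (abs_nonneg _).trans (hσ j hj)
  obtain ⟨Z, g, hg, hprod, hcard, hgne, hglog, -⟩ := expSum_factorization hs c lam hσ hw hpw hmax
  set A : ℝ := 6 * n + 8 * σ + 1 with hA
  set p := expSum s c lam with hp
  set r := volume.real E with hr
  have hEfin : volume E ≠ ⊤ := ne_top_of_le_ne_top (by simp) (measure_mono hEI)
  have hr1 : r ≤ 1 := by
    have := measureReal_mono (μ := volume) hEI (by simp)
    refine this.trans ?_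
    rw [measureReal_def, Real.volume_Icc]; norm_num
  have hpd : Differentiable ℂ p := differentiable_expSum s c lam
  have hae1 : ∀ᵐ t : ℝ, p t ≠ 0 := ae_ne_zero_of_differentiable hpd hpw
  have hae2 : ∀ᵐ t : ℝ, ∀ a ∈ Z, t ≠ a.re := by
    have hfin : (Complex.re '' {a | a ∈ Z}).Finite :=
      ((Z.finite_toSet).image Complex.re)
    filter_upwards [hfin.countable.ae_notMem volume] with t ht a ha h
    exact ht ⟨a, ha, h.symm⟩
  obtain ⟨hint, hle⟩ := setIntegral_sum_logExcess_le hE0 Z E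
  have hpoint : ∀ᵐ t ∂(volume.restrict E),
      (Real.log ‖p w‖ - n * (Real.log 40 - Real.log r) - 22 * A) -
        (Z.map fun a => logExcess r a.re t).sum ≤ Real.log ‖p t‖ := by
    filter_upwards [ae_restrict_of_ae hae1, ae_restrict_of_ae hae2, ae_restrict_mem hE]
      with t hpt htZ htE
    have htI := hEI htE
    have htabs : |t| ≤ 1 / 2 := abs_le.mpr ⟨by linarith [htI.1], htI.2⟩
    obtain ⟨u, hu, humax⟩ := (isCompact_Icc (a := t - r / 4) (b := t + r / 4)).exists_isMaxOn
      ⟨t, by constructor <;> linarith⟩ (f := fun x : ℝ => ‖p x‖)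
      ((hpd.continuous.comp Complex.continuous_ofReal).norm.continuousOn)
    have hu' : |u - t| ≤ r / 4 := abs_le.mpr ⟨by linarith [hu.1], by linarith [hu.2]⟩
    have hpu : ‖p w‖ ≤ (40 / r) ^ n * ‖p u‖ := by
      refine (norm_expSum_le hs c lam (x := w) (w := t) (r := r / 4) (S := ‖p u‖) (by linarith)
        fun x hx => humax ?_).trans ?_
      · rw [abs_le] at hx
        exact ⟨by linarith [hx.1], by linarith [hx.2]⟩
      · gcongr ?_ ^ n * _
        rw [div_le_div_iff₀ (by linarith) hE0]
        have : |w - t| ≤ 1 := (abs_sub _ _).trans (by linarith)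
        nlinarith
    have hpw0 : 0 < ‖p w‖ := norm_pos_iff.mpr hpw
    have hpu0 : 0 < ‖p u‖ := by
      by_contra! h
      have : ‖p u‖ = 0 := le_antisymm h (norm_nonneg _)
      rw [this, mul_zero] at hpu; linarith
    have hlog1 : Real.log ‖p w‖ ≤ n * (Real.log 40 - Real.log r) + Real.log ‖p u‖ := by
      have := Real.log_le_log hpw0 hpu
      rwa [Real.log_mul (by positivity) hpu0.ne', Real.log_pow, Real.log_div (by norm_num)
        hE0.ne'] at this
    have hpu_ne : p u ≠ 0 := norm_pos_iff.mp hpu0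
    have hun : ‖(u : ℂ)‖ ≤ 3 / 4 := by
      rw [Complex.norm_real, Real.norm_eq_abs]
      have := abs_add_le (u - t) t
      rw [sub_add_cancel] at this
      linarith
    have htn : ‖(t : ℂ)‖ ≤ 3 / 4 := by
      rw [Complex.norm_real, Real.norm_eq_abs]; linarith
    have hprod0 : ∀ v : ℂ, p v ≠ 0 → ‖(Z.map fun a => v - a).prod‖ ≠ 0 ∧ ∀ a ∈ Z, v ≠ a := by
      intro v hv
      have h0 : (Z.map fun a => v - a).prod ≠ 0 := by
        intro h; apply hv; rw [hprod, h, zero_mul]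
      refine ⟨norm_ne_zero_iff.mpr h0, fun a ha h => h0 ?_⟩
      apply Multiset.prod_eq_zero
      rw [Multiset.mem_map]
      exact ⟨a, ha, sub_eq_zero.mpr h⟩
    have hlp : ∀ v : ℂ, p v ≠ 0 → ‖v‖ ≤ 3 / 4 →
        Real.log ‖p v‖ = Real.log ‖(Z.map fun a => v - a).prod‖ + Real.log ‖g v‖ := by
      intro v hv hv2
      rw [hprod, norm_mul, Real.log_mul (hprod0 v hv).1 (norm_ne_zero_iff.mpr (hgne v hv2))]
    have hl := log_norm_prod_le hE0 (u := u) (t := t) (hu'.trans (by linarith)) Z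
      fun a ha => ⟨htZ a ha, (hprod0 u hpu_ne).2 a ha⟩
    have hgg := hglog u t hun htn
    have hlog2 : Real.log 2 ≤ 1 := by linarith [Real.log_two_lt_d9]
    have hlog20 : 0 ≤ Real.log 2 := Real.log_nonneg (by norm_num)
    have hk : (Z.card : ℝ) * Real.log 2 ≤ 2 * A := by nlinarith
    linarith [hlp u hpu_ne hun, hlp t hpt htn]
  have hci : Integrable (fun _ : ℝ => Real.log ‖p w‖ - n * (Real.log 40 - Real.log r) - 22 * A)
    (volume.restrict E) := integrableOn_const hEfin
  have hmono := integral_mono_ae (hci.sub hint) (integrableOn_log_norm hpd hEI) hpoint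
  rw [integral_sub' hci hint, setIntegral_const, smul_eq_mul] at hmono
  refine le_trans ?_ hmono
  have : r * (4 * A) ≥ ∫ t in E, (Z.map fun a => logExcess r a.re t).sum := by
    refine le_trans hle ?_
    nlinarith
  nlinarith

theorem deriv_expSum (s : Finset ι) (c : ι → ℂ) (lam : ι → ℝ) (z : ℂ) :
    deriv (expSum s c lam) z = expSum s (fun k => c k * (Complex.I * lam k)) lam z := by
  have : HasDerivAt (expSum s c lam) (expSum s (fun k => c k * (Complex.I * lam k)) lam z) z := by
    unfold expSum
    refine HasDerivAt.fun_sum fun k _ => ?_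
    have h := ((hasDerivAt_id z).const_mul (Complex.I * (lam k : ℂ))).cexp.const_mul (c k)
    convert! h using 1
    simp; ring
  exact this.deriv

theorem deriv_prod_sub (Z : Multiset ℂ) (z : ℂ) (hz : ∀ a ∈ Z, z ≠ a) :
    HasDerivAt (fun z => (Z.map fun a => z - a).prod)
      ((Z.map fun a => z - a).prod * cauchySum Z z) z := by
  induction Z using Multiset.induction_on with
  | empty => simpa [cauchySum] using hasDerivAt_const z (1 : ℂ)
  | cons a Z ih =>
    have ih' := ih fun b hb => hz b (Multiset.mem_cons_of_mem hb)
    have h1 : z - a ≠ 0 := sub_ne_zero.mpr (hz a (Multiset.mem_cons_self a Z))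
    simp only [Multiset.map_cons, Multiset.prod_cons]
    convert! ((hasDerivAt_id z).sub_const a).mul ih' using 1
    simp only [cauchySum, Multiset.map_cons, Multiset.sum_cons, id]
    field_simp

theorem log_average_ratio_of_large_spread {n : ℕ} {s : Finset ι} (hs : s.card = n + 1) (c : ι → ℂ)
    (lam : ι → ℝ) {σ : ℝ} (hσ : ∀ k ∈ s, |lam k| ≤ σ) (hσn : (n : ℝ) ≤ σ) (hσ1 : 1 ≤ σ)
    {w : ℝ} (hw : |w| ≤ 1 / 2)
    (hpw : expSum s c lam w ≠ 0)
    (hmax : ∀ t : ℝ, |t| ≤ 1 / 2 → ‖expSum s c lam t‖ ≤ ‖expSum s c lam w‖)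
    {E : Set ℝ} (hE : MeasurableSet E) (hEI : E ⊆ Set.Icc (-1 / 2) (1 / 2))
    (hE0 : 0 < volume.real E) {μ : ℝ} (hμ : |μ| ≤ σ) {q : ℂ → ℂ} (hq : Differentiable ℂ q)
    (hqp : ∀ z, q z = (deriv (expSum s c lam) z - Complex.I * μ * expSum s c lam z) / (2 * σ))
    {x : ℝ} (hqx : q x ≠ 0) :
    ∫ t in E, Real.log ‖q t‖ ≤ (∫ t in E, Real.log ‖expSum s c lam t‖) +
      volume.real E * (500 - Real.log (volume.real E)) := by
  obtain ⟨Z, g, hg, hprod, hcard, hgne, -, hgder⟩ := expSum_factorization hs c lam hσ hw hpw hmax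
  set A : ℝ := 6 * n + 8 * σ + 1 with hA
  have hA15 : A ≤ 15 * σ := by rw [hA]; linarith
  set p := expSum s c lam with hp
  set r := volume.real E with hr
  have hEfin : volume E ≠ ⊤ := ne_top_of_le_ne_top (by simp) (measure_mono hEI)
  have hr1 : r ≤ 1 := by
    have := measureReal_mono (μ := volume) hEI (by simp)
    refine this.trans ?_
    rw [measureReal_def, Real.volume_Icc]; norm_num
  have hpd : Differentiable ℂ p := differentiable_expSum s c lam
  set T : ℝ := σ / r with hT
  have hT0 : 0 < T := by positivity
  set ℓ : ℝ → ℝ := fun t => Real.log (max 1 (‖cauchySum Z t‖ / (2 * T))) with hℓ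
  have hℓ0 : ∀ t, 0 ≤ ℓ t := fun t => Real.log_nonneg (le_max_left _ _)
  have hpoint : ∀ᵐ t : ℝ ∂(volume.restrict E),
      Real.log ‖q t‖ - Real.log ‖p t‖ - (Real.log 302 - Real.log r) ≤ ℓ t := by
    filter_upwards [ae_restrict_of_ae (ae_ne_zero_of_differentiable hpd hpw),
      ae_restrict_of_ae (ae_ne_zero_of_differentiable hq hqx), ae_restrict_mem hE]
      with t hpt hqt htE
    have htI := hEI htE
    have htn : ‖(t : ℂ)‖ ≤ 1 / 2 := by
      rw [Complex.norm_real, Real.norm_eq_abs]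
      exact abs_le.mpr ⟨by linarith [htI.1], htI.2⟩
    have hgt := hgne t (by linarith)
    have hprod0 : (Z.map fun a => (t : ℂ) - a).prod ≠ 0 := by
      intro h; apply hpt; rw [hprod, h, zero_mul]
    have htZ : ∀ a ∈ Z, (t : ℂ) ≠ a := by
      intro a ha h
      apply hprod0
      apply Multiset.prod_eq_zero
      rw [Multiset.mem_map]
      exact ⟨a, ha, sub_eq_zero.mpr h⟩
    have hder : deriv p t = p t * (cauchySum Z t + deriv g t / g t) := by
      have h1 := (deriv_prod_sub Z t htZ).mul (hg t).hasDerivAt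
      have h2 : p = fun z => (Z.map fun a => z - a).prod * g z := funext hprod
      rw [h2]
      rw [show deriv (fun z => (Z.map fun a => z - a).prod * g z) t = _ from h1.deriv]
      field_simp
    have hqn : ‖q t‖ ≤ ‖p t‖ * (302 / r * max 1 (‖cauchySum Z t‖ / (2 * T))) := by
      have h1 : q t = p t * ((cauchySum Z t + deriv g t / g t - Complex.I * μ) / (2 * σ)) := by
        rw [hqp, hder]; ring
      rw [h1, norm_mul]
      gcongr
      rw [norm_div, show ‖(2 * σ : ℂ)‖ = 2 * σ by
        rw [norm_mul, Complex.norm_real, Real.norm_of_nonneg (by linarith)]; simp,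
        div_le_iff₀ (by linarith)]
      have h2 : ‖cauchySum Z t + deriv g t / g t - Complex.I * μ‖ ≤
          ‖cauchySum Z t‖ + 40 * A + σ := by
        refine (norm_sub_le _ _).trans (add_le_add ((norm_add_le _ _).trans ?_) ?_)
        · gcongr; exact hgder t htn
        · simpa using hμ
      have h3 : ‖cauchySum Z t‖ ≤ 2 * T * max 1 (‖cauchySum Z t‖ / (2 * T)) := by
        have := le_max_right 1 (‖cauchySum Z t‖ / (2 * T))
        rwa [div_le_iff₀ (by linarith), mul_comm] at this
      have h4 : 1 ≤ max 1 (‖cauchySum Z t‖ / (2 * T)) := le_max_left _ _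
      have h5 : 302 / r * max 1 (‖cauchySum Z t‖ / (2 * T)) * (2 * σ) =
          2 * 302 * T * max 1 (‖cauchySum Z t‖ / (2 * T)) := by rw [hT]; ring
      rw [h5]
      have h6 : σ ≤ T := by rw [hT, le_div_iff₀ hE0]; nlinarith
      nlinarith
    have hlog := Real.log_le_log (norm_pos_iff.mpr hqt) hqn
    rw [Real.log_mul (norm_ne_zero_iff.mpr hpt) (by positivity), Real.log_mul (by positivity)
      (by positivity), Real.log_div (by norm_num) hE0.ne'] at hlog
    simp only [hℓ]
    linarith
  have hEI' : E ⊆ Set.Icc (-1 : ℝ) 1 := fun t ht => by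
    have := hEI ht
    exact ⟨by linarith [this.1], by linarith [this.2]⟩
  have hlin : ∫⁻ t in E, ENNReal.ofReal (ℓ t) ≤ ENNReal.ofReal (2 * Real.pi * Z.card / T) :=
    (lintegral_mono_set hEI').trans (lintegral_log_max_cauchySum_le Z hT0)
  have hℓm : Measurable ℓ := by
    have := measurable_cauchySum Z
    rw [hℓ]
    fun_prop
  have hℓint : IntegrableOn ℓ E := by
    refine ⟨hℓm.aestronglyMeasurable, ?_⟩
    rw [hasFiniteIntegral_iff_ofReal (Filter.Eventually.of_forall hℓ0)]
    exact hlin.trans_lt ENNReal.ofReal_lt_top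
  have hℓle : ∫ t in E, ℓ t ≤ 480 * r := by
    rw [integral_eq_lintegral_of_nonneg_ae (Filter.Eventually.of_forall hℓ0)
      hℓm.aestronglyMeasurable]
    refine (ENNReal.toReal_mono ENNReal.ofReal_ne_top hlin).trans ?_
    rw [ENNReal.toReal_ofReal (by positivity), hT, div_div_eq_mul_div, div_le_iff₀ (by linarith)]
    have hpi : Real.pi ≤ 4 := Real.pi_le_four
    have hc : (Z.card : ℝ) ≤ 30 * σ := by linarith
    calc 2 * Real.pi * Z.card * r ≤ 2 * 4 * (30 * σ) * r := by gcongr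
      _ ≤ 480 * r * σ := by nlinarith [mul_pos hE0 (by linarith : 0 < σ)]
  have hqi := integrableOn_log_norm hq hEI
  have hpi := integrableOn_log_norm hpd hEI
  have hci : Integrable (fun _ : ℝ => Real.log 302 - Real.log r) (volume.restrict E) :=
    integrableOn_const hEfin
  have hmono := integral_mono_ae ((hqi.sub hpi).sub hci) hℓint hpoint
  rw [integral_sub' (hqi.sub hpi) hci, integral_sub' hqi hpi,
    setIntegral_const, smul_eq_mul] at hmono
  have h302 : Real.log 302 ≤ 20 := by
    have : (302 : ℝ) ≤ Real.exp 1 ^ 20 := by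
      have := Real.exp_one_gt_d9
      calc (302 : ℝ) ≤ 2 ^ 20 := by norm_num
        _ ≤ _ := by gcongr; linarith
    rw [Real.log_le_iff_le_exp (by norm_num)]
    rw [← Real.exp_nat_mul] at this
    simpa using this
  nlinarith

end Local

section NazarovTuran

variable {ι : Type*}

theorem expSum_shift_freq (s : Finset ι) (c : ι → ℂ) (lam : ι → ℝ) (μ : ℝ) (z : ℂ) :
    expSum s c (fun k => lam k - μ) z = Complex.exp (-(Complex.I * μ * z)) * expSum s c lam z := by
  unfold expSum
  rw [Finset.mul_sum]
  refine Finset.sum_congr rfl fun k _ => ?_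
  rw [mul_left_comm, ← Complex.exp_add]
  congr 2
  push_cast; ring

theorem norm_expSum_shift_freq (s : Finset ι) (c : ι → ℂ) (lam : ι → ℝ) (μ : ℝ) (t : ℝ) :
    ‖expSum s c (fun k => lam k - μ) t‖ = ‖expSum s c lam t‖ := by
  rw [expSum_shift_freq, norm_mul,
    show -(Complex.I * μ * t) = ((-(μ * t) : ℝ) : ℂ) * Complex.I by push_cast; ring,
    Complex.norm_exp_ofReal_mul_I, one_mul]

theorem exists_max_norm {f : ℂ → ℂ} (hf : Differentiable ℂ f) :
    ∃ w : ℝ, |w| ≤ 1 / 2 ∧ ∀ t : ℝ, |t| ≤ 1 / 2 → ‖f t‖ ≤ ‖f w‖ := by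
  obtain ⟨w, hw, hmax⟩ := (isCompact_Icc (a := (-1 / 2 : ℝ)) (b := 1 / 2)).exists_isMaxOn
    ⟨0, by norm_num⟩ (f := fun x : ℝ => ‖f x‖)
    ((hf.continuous.comp Complex.continuous_ofReal).norm.continuousOn)
  refine ⟨w, abs_le.mpr ⟨by linarith [hw.1], hw.2⟩, fun t ht => hmax ?_⟩
  rw [abs_le] at ht
  exact ⟨by linarith [ht.1], ht.2⟩

theorem log_forty_le : Real.log 40 ≤ 4 := by
  have : (40 : ℝ) ≤ Real.exp 1 ^ 4 := by
    have := Real.exp_one_gt_d9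
    calc (40 : ℝ) ≤ 2.7 ^ 4 := by norm_num
      _ ≤ _ := by gcongr; linarith
  rw [Real.log_le_iff_le_exp (by norm_num)]
  rw [← Real.exp_nat_mul] at this
  simpa using this

/-- The geometric mean of an exponential sum of order `n + 1` over a set `E` controls its maximum. -/
theorem log_average_expSum {E : Set ℝ} (hE : MeasurableSet E) (hEI : E ⊆ Set.Icc (-1 / 2) (1 / 2))
    (hE0 : 0 < volume.real E) (n : ℕ) : ∀ (s : Finset ι) (c : ι → ℂ) (lam : ι → ℝ) (w : ℝ),
    s.card = n + 1 → |w| ≤ 1 / 2 → expSum s c lam w ≠ 0 →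
    (∀ t : ℝ, |t| ≤ 1 / 2 → ‖expSum s c lam t‖ ≤ ‖expSum s c lam w‖) →
    volume.real E * (Real.log ‖expSum s c lam w‖ - n * (501 - Real.log (volume.real E))) ≤
      ∫ t in E, Real.log ‖expSum s c lam t‖ := by
  classical
  have hEfin : volume E ≠ ⊤ := ne_top_of_le_ne_top (by simp) (measure_mono hEI)
  induction n with
  | zero =>
    intro s c lam w hs hw hpw hmax
    obtain ⟨k, rfl⟩ := Finset.card_eq_one.mp hs
    have hconst : ∀ t : ℝ, ‖expSum {k} c lam t‖ = ‖c k‖ := by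
      intro t
      simp only [expSum, Finset.sum_singleton, norm_mul]
      rw [show Complex.I * (lam k : ℂ) * t = ((lam k * t : ℝ) : ℂ) * Complex.I by push_cast; ring,
        Complex.norm_exp_ofReal_mul_I, mul_one]
    simp only [hconst, setIntegral_const, smul_eq_mul]
    simp
  | succ n ih =>
    suffices H : ∀ (s : Finset ι) (c : ι → ℂ) (lam : ι → ℝ) (w σ : ℝ) (i j : ι),
        s.card = n + 1 + 1 → |w| ≤ 1 / 2 → expSum s c lam w ≠ 0 →
        (∀ t : ℝ, |t| ≤ 1 / 2 → ‖expSum s c lam t‖ ≤ ‖expSum s c lam w‖) →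
        i ∈ s → j ∈ s → lam i = -σ → lam j = σ → (∀ k ∈ s, |lam k| ≤ σ) →
        volume.real E * (Real.log ‖expSum s c lam w‖ -
          (n + 1) * (501 - Real.log (volume.real E))) ≤
        ∫ t in E, Real.log ‖expSum s c lam t‖ by
      intro s c lam w hs hw hpw hmax
      have hne : s.Nonempty := Finset.card_pos.mp (by omega)
      obtain ⟨i, hi, himin⟩ := s.exists_min_image lam hne
      obtain ⟨j, hj, hjmax⟩ := s.exists_max_image lam hne
      have h := H s c (fun k => lam k - (lam i + lam j) / 2) w ((lam j - lam i) / 2) i j hs hw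
        (by rw [← norm_ne_zero_iff, norm_expSum_shift_freq]; exact norm_ne_zero_iff.mpr hpw)
        (by simpa only [norm_expSum_shift_freq] using hmax) hi hj (by ring) (by ring) (by
          intro k hk
          rw [abs_le]
          constructor <;> linarith [himin k hk, hjmax k hk])
      simp only [norm_expSum_shift_freq] at h
      push_cast
      exact h
    intro s c lam w σ i j hs hw hpw hmax hi hj hlami hlamj hσ
    set r := volume.real E with hr
    have hr1 : r ≤ 1 := by
      have := measureReal_mono (μ := volume) hEI (by simp)
      refine this.trans ?_
      rw [measureReal_def, Real.volume_Icc]; norm_num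
    have hlr : Real.log r ≤ 0 := Real.log_nonpos hE0.le hr1
    have hnn : (0 : ℝ) ≤ n := Nat.cast_nonneg n
    rcases le_or_gt σ (n + 1) with hcase | hcase
    · refine le_trans ?_ (log_average_of_small_spread hs c lam hσ hw hpw hmax hE hEI hE0)
      refine mul_le_mul_of_nonneg_left ?_ hE0.le
      push_cast
      have := log_forty_le
      nlinarith
    · have hσ1 : 1 ≤ σ := by linarith
      have hσ2 : (σ : ℂ) ≠ 0 := by
        have : σ ≠ 0 := by linarith
        exact_mod_cast this
      set q : ι → ℂ → ℂ := fun k₀ => expSum (s.erase k₀)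
        (fun k => c k * (Complex.I * lam k - Complex.I * lam k₀) / (2 * σ)) lam with hq
      have hqp : ∀ k₀ z, q k₀ z = (deriv (expSum s c lam) z -
          Complex.I * lam k₀ * expSum s c lam z) / (2 * σ) := by
        intro k₀ z
        rw [deriv_expSum]
        simp only [hq, expSum]
        rw [Finset.sum_erase _ (by simp), Finset.mul_sum, ← Finset.sum_sub_distrib, Finset.sum_div]
        exact Finset.sum_congr rfl fun k _ => by ring
      have hstep : ∀ k₀ ∈ s, ‖expSum s c lam w‖ ≤ 2 * ‖q k₀ w‖ →
          r * (Real.log ‖expSum s c lam w‖ - (n + 1) * (501 - Real.log r)) ≤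
            ∫ t in E, Real.log ‖expSum s c lam t‖ := by
        intro k₀ hk₀ hqw
        have hqd : Differentiable ℂ (q k₀) := differentiable_expSum _ _ _
        obtain ⟨w', hw', hmax'⟩ := exists_max_norm hqd
        have hpw0 : 0 < ‖expSum s c lam w‖ := norm_pos_iff.mpr hpw
        have hw'w := hmax' w hw
        have hqw0 : q k₀ w' ≠ 0 := norm_pos_iff.mp (by linarith)
        have hI := ih (s.erase k₀) _ lam w' (by rw [Finset.card_erase_of_mem hk₀]; omega) hw' hqw0
          hmax'
        have hR := log_average_ratio_of_large_spread hs c lam hσ (by push_cast; linarith) hσ1 hw hpw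
          hmax hE hEI hE0 (hσ k₀ hk₀) hqd (hqp k₀) hqw0
        have hlog : Real.log ‖expSum s c lam w‖ ≤ Real.log 2 + Real.log ‖q k₀ w'‖ := by
          rw [← Real.log_mul (by norm_num) (norm_ne_zero_iff.mpr hqw0)]
          exact Real.log_le_log hpw0 (by linarith)
        have hlog2 : Real.log 2 ≤ 1 := by linarith [Real.log_two_lt_d9]
        have h1 : r * (Real.log ‖expSum s c lam w‖ - (n + 1) * (501 - Real.log r)) ≤
            r * (Real.log ‖q k₀ w'‖ - n * (501 - Real.log r)) - r * (500 - Real.log r) := by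
          rw [← mul_sub]
          refine mul_le_mul_of_nonneg_left ?_ hE0.le
          linarith
        linarith
      have hsum : Complex.I * expSum s c lam w = q i w - q j w := by
        rw [hqp, hqp, hlami, hlamj]
        field_simp
        push_cast
        ring
      have hn : ‖expSum s c lam w‖ ≤ ‖q i w‖ + ‖q j w‖ := by
        have := norm_sub_le (q i w) (q j w)
        rwa [← hsum, norm_mul, Complex.norm_I, one_mul] at this
      rcases le_total ‖q i w‖ ‖q j w‖ with h | h
      · exact hstep j hj (by linarith)
      · exact hstep i hi (by linarith)

/-- **Nazarov–Turán lemma** on `[-1/2, 1/2]`. -/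
theorem nazarov_turan_centered {E : Set ℝ} (hE : MeasurableSet E)
    (hEI : E ⊆ Set.Icc (-1 / 2) (1 / 2)) (hE0 : 0 < volume.real E) {n : ℕ} {s : Finset ι}
    (hs : s.card = n + 1) (c : ι → ℂ) (lam : ι → ℝ) {B : ℝ}
    (hB : ∀ t ∈ E, ‖expSum s c lam t‖ ≤ B) {x : ℝ} (hx : |x| ≤ 1 / 2) :
    ‖expSum s c lam x‖ ≤ (Real.exp 501 / volume.real E) ^ n * B := by
  have hEfin : volume E ≠ ⊤ := ne_top_of_le_ne_top (by simp) (measure_mono hEI)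
  have hpd : Differentiable ℂ (expSum s c lam) := differentiable_expSum s c lam
  have hB0 : 0 ≤ B := by
    have : E.Nonempty := by
      by_contra h
      rw [Set.not_nonempty_iff_eq_empty] at h
      simp [h] at hE0
    obtain ⟨t, ht⟩ := this
    exact (norm_nonneg _).trans (hB t ht)
  obtain ⟨w, hw, hmax⟩ := exists_max_norm hpd
  refine (hmax x hx).trans ?_
  by_cases hpw : expSum s c lam w = 0
  · rw [hpw, norm_zero]; positivity
  have hkey := log_average_expSum hE hEI hE0 n s c lam w hs hw hpw hmax
  have hae := ae_ne_zero_of_differentiable hpd hpw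
  have hBpos : 0 < B := by
    have : ∃ t ∈ E, expSum s c lam t ≠ 0 := by
      by_contra! h
      have h0 : volume E = 0 := measure_mono_null (fun t ht => by simpa using h t ht) hae
      rw [measureReal_def, h0] at hE0
      simp at hE0
    obtain ⟨t, ht, hne⟩ := this
    exact (norm_pos_iff.mpr hne).trans_le (hB t ht)
  have hup : ∫ t in E, Real.log ‖expSum s c lam t‖ ≤ volume.real E * Real.log B := by
    rw [← smul_eq_mul, ← setIntegral_const]
    refine integral_mono_ae (integrableOn_log_norm hpd hEI) (integrableOn_const hEfin) ?_
    filter_upwards [ae_restrict_of_ae hae, ae_restrict_mem hE] with t ht htE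
    exact Real.log_le_log (norm_pos_iff.mpr ht) (hB t htE)
  have h1 := le_of_mul_le_mul_left (hkey.trans hup) hE0
  rw [← Real.log_le_log_iff (norm_pos_iff.mpr hpw) (by positivity),
    Real.log_mul (by positivity) hBpos.ne', Real.log_pow, Real.log_div (Real.exp_pos _).ne' hE0.ne',
    Real.log_exp]
  linarith

/-- **Nazarov–Turán lemma** on `[0, 1]`. -/
theorem nazarov_turan {E : Set ℝ} (hE : MeasurableSet E)
    (hEI : E ⊆ Set.Icc 0 1) (hE0 : 0 < volume.real E) {n : ℕ} {s : Finset ι}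
    (hs : s.card = n + 1) (c : ι → ℂ) (lam : ι → ℝ) {B : ℝ}
    (hB : ∀ t ∈ E, ‖expSum s c lam t‖ ≤ B) {x : ℝ} (hx : x ∈ Set.Icc (0 : ℝ) 1) :
    ‖expSum s c lam x‖ ≤ (Real.exp 501 / volume.real E) ^ n * B := by
  have hshift : ∀ z : ℂ, expSum s (fun k => c k * Complex.exp (Complex.I * lam k * (1 / 2))) lam z =
      expSum s c lam (z + 1 / 2) := by
    intro z
    refine Finset.sum_congr rfl fun k _ => ?_
    rw [mul_assoc, ← Complex.exp_add]
    congr 2; ring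
  have hvol : volume.real ((fun t : ℝ => t + 1 / 2) ⁻¹' E) = volume.real E := by
    rw [measureReal_def, measure_preimage_add_right, measureReal_def]
  have h := nazarov_turan_centered (E := (fun t : ℝ => t + 1 / 2) ⁻¹' E)
    (hE.preimage (by fun_prop)) (by
      intro t ht
      have := hEI ht
      exact ⟨by linarith [this.1], by linarith [this.2]⟩) (by rwa [hvol]) hs
    (fun k => c k * Complex.exp (Complex.I * lam k * (1 / 2))) lam (B := B) (by
      intro t ht
      rw [hshift]
      have := hB _ ht
      push_cast at this
      exact this) (x := x - 1 / 2) (abs_le.mpr ⟨by linarith [hx.1], by linarith [hx.2]⟩)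
  rw [hshift, hvol] at h
  push_cast at h
  rwa [sub_add_cancel] at h

open Polynomial in
/-- **Nazarov–Turán lemma** for exponential polynomials with polynomial coefficients. -/
theorem nazarov_turan_polynomial {E : Set ℝ} (hE : MeasurableSet E)
    (hEI : E ⊆ Set.Icc 0 1) (hE0 : 0 < volume.real E) {N m : ℕ} {s : Finset ι}
    (hs : s.card * m = N + 1) (P : ι → ℂ[X]) (hP : ∀ l ∈ s, (P l).natDegree < m) (ω : ι → ℝ) {B : ℝ}
    (hB : ∀ t ∈ E, ‖∑ l ∈ s, (P l).eval (t : ℂ) * Complex.exp (Complex.I * ω l * t)‖ ≤ B)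
    {x : ℝ} (hx : x ∈ Set.Icc (0 : ℝ) 1) :
    ‖∑ l ∈ s, (P l).eval (x : ℂ) * Complex.exp (Complex.I * ω l * x)‖ ≤
      (Real.exp 501 / volume.real E) ^ N * B := by
  set K : ℝ := (Real.exp 501 / volume.real E) ^ N with hK
  have hK0 : 0 ≤ K := by positivity
  set h : ℝ × ℂ → ℂ := fun y => ∑ l ∈ s, (P l).eval y.2 * Complex.exp (Complex.I * ω l * y.1) with hh
  have hc : Continuous h := by
    rw [hh]
    refine continuous_finsetSum _ fun l _ => ?_
    exact ((P l).continuous.comp continuous_snd).mul (by fun_prop)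
  have huc : UniformContinuousOn h (Set.Icc (0 : ℝ) 1 ×ˢ Metric.closedBall (0 : ℂ) 2) :=
    (isCompact_Icc.prod (isCompact_closedBall _ _)).uniformContinuousOn_of_continuous hc.continuousOn
  have happrox : ∀ δ > 0, ∃ (c : ι × ℕ → ℂ) (lam : ι × ℕ → ℝ), ∀ t ∈ Set.Icc (0 : ℝ) 1,
      ‖expSum (s ×ˢ Finset.range m) c lam t - h (t, t)‖ ≤ δ := by
    intro δ hδ
    obtain ⟨η, hη, hηu⟩ := Metric.uniformContinuousOn_iff.mp huc δ hδ
    set ε : ℝ := min (η / 2) 1 with hε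
    have hε0 : 0 < ε := lt_min (by linarith) one_pos
    have hε1 : ε ≤ 1 := min_le_right _ _
    have hεη : ε < η := (min_le_left _ _).trans_lt (by linarith)
    set D : ℂ := Complex.I * ε with hD
    have hD0 : D ≠ 0 := mul_ne_zero Complex.I_ne_zero (by exact_mod_cast hε0.ne')
    have hDn : ‖D‖ = ε := by
      rw [hD, norm_mul, Complex.norm_I, one_mul, Complex.norm_real, Real.norm_of_nonneg hε0.le]
    set Q : ι → ℂ[X] := fun l => (P l).comp (C D⁻¹ * (X - C 1)) with hQ
    refine ⟨fun y => (Q y.1).coeff y.2, fun y => ω y.1 + ε * y.2, fun t ht => ?_⟩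
    set φ : ℂ := D⁻¹ * (Complex.exp (D * t) - 1) with hφ
    have hsum : expSum (s ×ˢ Finset.range m) (fun y => (Q y.1).coeff y.2)
        (fun y => ω y.1 + ε * y.2) t = h (t, φ) := by
      unfold expSum
      rw [Finset.sum_product]
      refine Finset.sum_congr rfl fun l hl => ?_
      have hdeg : (Q l).natDegree < m := by
        refine lt_of_le_of_lt natDegree_comp_le ?_
        have h1 : (C D⁻¹ * (X - C 1) : ℂ[X]).natDegree ≤ 1 := by
          refine (natDegree_C_mul_le _ _).trans ?_
          exact natDegree_X_sub_C_le _
        calc (P l).natDegree * _ ≤ (P l).natDegree * 1 := Nat.mul_le_mul_left _ h1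
          _ < m := by rw [mul_one]; exact hP l hl
      have hev : (P l).eval φ = (Q l).eval (Complex.exp (D * t)) := by
        simp [hQ, hφ]
      simp only
      rw [hev, eval_eq_sum_range' hdeg, Finset.sum_mul]
      refine Finset.sum_congr rfl fun q _ => ?_
      rw [← Complex.exp_nat_mul, mul_assoc ((Q l).coeff q), ← Complex.exp_add]
      congr 2
      rw [hD]; push_cast; ring
    rw [hsum, ← dist_eq_norm]
    have htn : ‖(t : ℂ)‖ ≤ 1 := by
      rw [Complex.norm_real, Real.norm_of_nonneg ht.1]; exact ht.2
    have hDt : ‖D * t‖ ≤ ε := by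
      rw [norm_mul, hDn]; exact mul_le_of_le_one_right hε0.le htn
    have hφt : ‖φ - t‖ ≤ ε := by
      have h1 := Complex.norm_exp_sub_one_sub_id_le (hDt.trans hε1)
      have h2 : φ - t = D⁻¹ * (Complex.exp (D * t) - 1 - D * t) := by
        rw [hφ]; field_simp
      rw [h2, norm_mul, norm_inv, hDn, inv_mul_le_iff₀ hε0]
      refine h1.trans ?_
      rw [sq]
      gcongr
    refine (hηu (t, φ) ⟨ht, ?_⟩ (t, t) ⟨ht, ?_⟩ ?_).le
    · rw [mem_closedBall_zero_iff]
      have := norm_add_le (φ - t) (t : ℂ)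
      rw [sub_add_cancel] at this
      simp only
      linarith
    · rw [mem_closedBall_zero_iff]; simp only; linarith
    · rw [Prod.dist_eq]
      simp only [dist_self, dist_eq_norm]
      exact max_lt hη (hφt.trans_lt hεη)
  refine le_of_forall_pos_le_add fun δ hδ => ?_
  set δ' : ℝ := δ / (K + 1) with hδ'
  have hδ'0 : 0 < δ' := by positivity
  obtain ⟨c, lam, hcl⟩ := happrox δ' hδ'0
  have h1 := nazarov_turan hE hEI hE0 (n := N) (s := s ×ˢ Finset.range m)
    (by rw [Finset.card_product, Finset.card_range, hs]) c lam (B := B + δ') (by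
      intro t ht
      have a1 := hcl t (hEI ht)
      have a2 := hB t ht
      have a3 := norm_add_le (expSum (s ×ˢ Finset.range m) c lam t - h (t, t)) (h (t, t))
      rw [sub_add_cancel] at a3
      simp only [hh] at a3 a1
      linarith) hx
  have a1 := hcl x hx
  have a3 := norm_sub_norm_le (h (x, x)) (expSum (s ×ˢ Finset.range m) c lam x)
  rw [norm_sub_rev] at a1
  have a4 : δ' * (K + 1) = δ := by rw [hδ']; field_simp
  simp only [hh] at a3 a1
  rw [← hK] at h1
  nlinarith

end NazarovTuran

section Segments

open Metric

variable {V : Type*} [NormedAddCommGroup V] [NormedSpace ℝ V] [FiniteDimensional ℝ V]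
  [MeasurableSpace V] [BorelSpace V]

theorem measure_eq_lintegral_polar [Nontrivial V] (μ : Measure V) [μ.IsAddHaarMeasure] {A : Set V}
    (hA : MeasurableSet A) :
    μ A = ∫⁻ θ, Measure.volumeIoiPow (Module.finrank ℝ V - 1)
      {r : Set.Ioi (0 : ℝ) | r.1 • (θ : V) ∈ A} ∂μ.toSphere := by
  have hmp := Measure.measurePreserving_homeomorphUnitSphereProd μ
  set B : Set (sphere (0 : V) 1 × Set.Ioi (0 : ℝ)) := {y | y.2.1 • (y.1 : V) ∈ A} with hB
  have hBm : MeasurableSet B := by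
    have : Measurable fun y : sphere (0 : V) 1 × Set.Ioi (0 : ℝ) => y.2.1 • (y.1 : V) := by
      fun_prop
    exact this hA
  have h1 := hmp.measure_preimage hBm.nullMeasurableSet
  rw [Measure.prod_apply hBm] at h1
  rw [show (∫⁻ θ, Measure.volumeIoiPow (Module.finrank ℝ V - 1)
      {r : Set.Ioi (0 : ℝ) | r.1 • (θ : V) ∈ A} ∂μ.toSphere) = _ from h1.symm,
    comap_subtype_coe_apply (measurableSet_singleton _).compl]
  have h2 : (Subtype.val '' (homeomorphUnitSphereProd V ⁻¹' B) : Set V) = A \ {0} := by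
    ext y
    simp only [Set.mem_image, Set.mem_preimage, Subtype.exists, Set.mem_compl_iff,
      Set.mem_singleton_iff, exists_and_right, exists_eq_right, Set.mem_sdiff, hB,
      Set.mem_ofPred_eq]
    constructor
    · rintro ⟨hy, h⟩
      refine ⟨?_, hy⟩
      simpa [homeomorphUnitSphereProd, homeomorphSphereProd, smul_smul, hy] using h
    · rintro ⟨h, hy⟩
      refine ⟨hy, ?_⟩
      simpa [homeomorphUnitSphereProd, homeomorphSphereProd, smul_smul, hy] using h
  rw [h2, measure_sdiff_null (by simp)]

/-- A subset of proportion `γ` of a compact convex set has proportion at least `γ / (2 dim)` on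
some segment issuing from a given point. -/
theorem exists_segment_of_origin [Nontrivial V] (μ : Measure V) [μ.IsAddHaarMeasure] {P E : Set V}
    (hP : IsCompact P) (hPc : Convex ℝ P) (h0 : (0 : V) ∈ P) (hP0 : 0 < μ P) (hE : MeasurableSet E)
    (hEP : E ⊆ P) {γ : ℝ} (hγ : 0 < γ) (hγE : ENNReal.ofReal γ * μ P ≤ μ E) :
    ∃ v ∈ P, γ / (2 * Module.finrank ℝ V) ≤ volume.real {t ∈ Set.Icc (0 : ℝ) 1 | t • v ∈ E} := by
  set d := Module.finrank ℝ V with hd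
  have hdpos : 0 < d := Module.finrank_pos
  have hPfin : μ P ≠ ⊤ := hP.measure_lt_top.ne
  obtain ⟨θ, hθ⟩ : ∃ θ : sphere (0 : V) 1, ENNReal.ofReal (γ / 2) *
      Measure.volumeIoiPow (d - 1) {r : Set.Ioi (0 : ℝ) | r.1 • (θ : V) ∈ P} <
      Measure.volumeIoiPow (d - 1) {r : Set.Ioi (0 : ℝ) | r.1 • (θ : V) ∈ E} := by
    by_contra! hcon
    have h1 : μ E ≤ ENNReal.ofReal (γ / 2) * μ P := by
      rw [measure_eq_lintegral_polar μ hE, measure_eq_lintegral_polar μ hP.measurableSet,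
        ← lintegral_const_mul' _ _ ENNReal.ofReal_ne_top]
      exact lintegral_mono hcon
    have h2 := hγE.trans h1
    rw [ENNReal.mul_le_mul_iff_left hP0.ne' hPfin, ENNReal.ofReal_le_ofReal_iff (by linarith)] at h2
    linarith
  have hθn : ‖(θ : V)‖ = 1 := by simp
  set RS : Set ℝ := {r : ℝ | 0 ≤ r ∧ r • (θ : V) ∈ P} with hRS
  have hRSc : IsCompact RS := by
    refine Metric.isCompact_of_isClosed_isBounded ?_ ?_
    · exact isClosed_Ici.inter (hP.isClosed.preimage (by fun_prop))
    · obtain ⟨C, hC⟩ := hP.isBounded.exists_norm_le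
      refine (Metric.isBounded_closedBall (x := (0 : ℝ)) (r := C)).subset fun r hr => ?_
      have := hC _ hr.2
      rw [norm_smul, hθn, mul_one] at this
      simpa using this
  obtain ⟨R, hR, hRmax⟩ := hRSc.exists_isMaxOn ⟨0, le_rfl, by simpa using h0⟩ continuousOn_id
  have hRle : ∀ r ∈ RS, r ≤ R := fun r hr => hRmax hr
  have hR0 : 0 < R := by
    rcases hR.1.eq_or_lt with h | h
    · exfalso
      have : {r : Set.Ioi (0 : ℝ) | r.1 • (θ : V) ∈ E} = ∅ := by
        ext r
        simp only [Set.mem_ofPred_eq, Set.mem_empty_iff_false, iff_false]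
        intro hr
        have h1 := hRle r.1 ⟨le_of_lt r.2, hEP hr⟩
        have h2 : 0 < r.1 := r.2
        linarith
      rw [this, measure_empty] at hθ
      exact not_lt_bot hθ
    · exact h
  have hsub : Set.Iio (⟨R, hR0⟩ : Set.Ioi (0 : ℝ)) ⊆ {r : Set.Ioi (0 : ℝ) | r.1 • (θ : V) ∈ P} := by
    intro r hr
    have hrR : r.1 < R := hr
    have hr0 : 0 < r.1 := r.2
    have := hPc.smul_mem_of_zero_mem h0 hR.2 (t := r.1 / R)
      ⟨by positivity, by rw [div_le_one hR0]; exact hrR.le⟩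
    rw [smul_smul, div_mul_cancel₀ _ hR0.ne'] at this
    exact this
  have hlow := measure_mono (μ := Measure.volumeIoiPow (d - 1)) hsub
  rw [Measure.volumeIoiPow_apply_Iio] at hlow
  set Er : Set ℝ := {r | 0 < r ∧ r • (θ : V) ∈ E} with hEr
  have hErm : MeasurableSet Er := measurableSet_Ioi.inter (hE.preimage (by fun_prop))
  have hErR : Er ⊆ Set.Ioc 0 R := fun r hr => ⟨hr.1, hRle r ⟨hr.1.le, hEP hr.2⟩⟩
  have hErfin : volume Er ≠ ⊤ := ne_top_of_le_ne_top (by simp) (measure_mono hErR)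
  have hup : Measure.volumeIoiPow (d - 1) {r : Set.Ioi (0 : ℝ) | r.1 • (θ : V) ∈ E} ≤
      ENNReal.ofReal (R ^ (d - 1)) * volume Er := by
    have hm : MeasurableSet {r : Set.Ioi (0 : ℝ) | r.1 • (θ : V) ∈ E} := by
      have : Measurable fun r : Set.Ioi (0 : ℝ) => r.1 • (θ : V) := by fun_prop
      exact this hE
    rw [Measure.volumeIoiPow, withDensity_apply _ hm,
      setLIntegral_subtype measurableSet_Ioi _ fun a : ℝ ↦ .ofReal (a ^ (d - 1))]
    have himg : (Subtype.val '' {r : Set.Ioi (0 : ℝ) | r.1 • (θ : V) ∈ E} : Set ℝ) = Er := by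
      ext r
      simp [hEr, and_comm]
    rw [himg, ← setLIntegral_const]
    refine setLIntegral_mono measurable_const fun r hr => ?_
    apply ENNReal.ofReal_le_ofReal
    exact pow_le_pow_left₀ hr.1.le (hErR hr).2 _
  have hmain : γ / 2 * (R ^ d / d) ≤ R ^ (d - 1) * volume.real Er := by
    have h1 : ENNReal.ofReal (γ / 2) * ENNReal.ofReal (R ^ (d - 1 + 1) / ((d - 1 : ℕ) + 1)) ≤
        ENNReal.ofReal (R ^ (d - 1)) * volume Er :=
      (mul_le_mul_right hlow _).trans (hθ.le.trans hup)
    rw [← ENNReal.ofReal_toReal hErfin, ← ENNReal.ofReal_mul (by positivity),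
      ← ENNReal.ofReal_mul (by positivity), ENNReal.ofReal_le_ofReal_iff (by positivity)] at h1
    have h2 : d - 1 + 1 = d := Nat.sub_add_cancel hdpos
    have h3 : (((d - 1 : ℕ) : ℝ) + 1) = d := by exact_mod_cast h2
    rw [h2] at h1
    simp only [h3] at h1
    exact h1
  refine ⟨R • (θ : V), hR.2, ?_⟩
  have hpre : (fun t => R * t) ⁻¹' Er ⊆ {t ∈ Set.Icc (0 : ℝ) 1 | t • (R • (θ : V)) ∈ E} := by
    intro t ht
    have h1 := hErR ht
    refine ⟨⟨by nlinarith [h1.1], ?_⟩, ?_⟩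
    · have := h1.2
      nlinarith
    · rw [smul_smul, mul_comm]; exact ht.2
  have hfin2 : volume {t ∈ Set.Icc (0 : ℝ) 1 | t • (R • (θ : V)) ∈ E} ≠ ⊤ :=
    ne_top_of_le_ne_top (by simp) (measure_mono (fun t ht => ht.1 : _ ⊆ Set.Icc (0 : ℝ) 1))
  refine le_trans ?_ (measureReal_mono hpre hfin2)
  rw [measureReal_def, Real.volume_preimage_mul_left hR0.ne', ENNReal.toReal_mul,
    ENNReal.toReal_ofReal (abs_nonneg _), abs_of_pos (inv_pos.mpr hR0), ← measureReal_def]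
  have hRd : R ^ d = R ^ (d - 1) * R := by
    rw [← pow_succ, Nat.sub_add_cancel hdpos]
  rw [hRd] at hmain
  have hdp : (0 : ℝ) < d := by exact_mod_cast hdpos
  have h4 : γ / 2 * (R / d) ≤ volume.real Er := by
    refine le_of_mul_le_mul_left ?_ (pow_pos hR0 (d - 1))
    calc R ^ (d - 1) * (γ / 2 * (R / d)) = γ / 2 * (R ^ (d - 1) * R / d) := by ring
      _ ≤ _ := hmain
  rw [inv_mul_eq_div, le_div_iff₀ hR0]
  calc γ / (2 * d) * R = γ / 2 * (R / d) := by field_simp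
    _ ≤ _ := h4

theorem exists_segment [Nontrivial V] (μ : Measure V) [μ.IsAddHaarMeasure] {P E : Set V}
    (hP : IsCompact P) (hPc : Convex ℝ P) {x₀ : V} (h0 : x₀ ∈ P) (hP0 : 0 < μ P)
    (hE : MeasurableSet E) (hEP : E ⊆ P) {γ : ℝ} (hγ : 0 < γ)
    (hγE : ENNReal.ofReal γ * μ P ≤ μ E) :
    ∃ v, γ / (2 * Module.finrank ℝ V) ≤
      volume.real {t ∈ Set.Icc (0 : ℝ) 1 | x₀ + t • v ∈ E} := by
  have hm : ∀ A : Set V, μ ((fun y => x₀ + y) ⁻¹' A) = μ A := fun A => measure_preimage_add μ x₀ A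
  obtain ⟨v, -, hv⟩ := exists_segment_of_origin μ (P := (fun y => x₀ + y) ⁻¹' P)
    (E := (fun y => x₀ + y) ⁻¹' E)
    ((Homeomorph.addLeft x₀).isClosedEmbedding.isCompact_preimage hP)
    (hPc.translate_preimage_right x₀) (by simpa using h0) (by rwa [hm])
    (hE.preimage (by fun_prop)) (Set.preimage_mono hEP) hγ (by rwa [hm, hm])
  exact ⟨v, hv⟩

end Segments

section LocalLp

variable {V : Type*} [NormedAddCommGroup V] [NormedSpace ℝ V] [FiniteDimensional ℝ V]
  [MeasurableSpace V] [BorelSpace V]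

/-- On every segment, `r` satisfies the Nazarov–Turán inequality with exponent `N`. -/
def TuranOnSegments (N : ℕ) (r : V → ℂ) : Prop :=
  ∀ (x v : V) (F : Set ℝ) (B : ℝ), MeasurableSet F → F ⊆ Set.Icc 0 1 → 0 < volume.real F →
    (∀ t ∈ F, ‖r (x + t • v)‖ ≤ B) → ‖r x‖ ≤ (Real.exp 501 / volume.real F) ^ N * B

theorem lintegral_le_of_turanOnSegments [Nontrivial V] (μ : Measure V) [μ.IsAddHaarMeasure]
    {N : ℕ} {r : V → ℂ} (hr : Continuous r) (hT : TuranOnSegments N r) {P Q E : Set V}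
    (hP : IsCompact P) (hPc : Convex ℝ P) (hP0 : 0 < μ P) (hQ : Q ⊆ P)
    (hE : MeasurableSet E) (hEP : E ⊆ P) {γ : ℝ} (hγ : 0 < γ)
    (hγE : ENNReal.ofReal γ * μ P ≤ μ E) {p : ℝ} (hp : 1 ≤ p) :
    ∫⁻ x in Q, ‖r x‖ₑ ^ p ∂μ ≤
      ENNReal.ofReal ((4 * Module.finrank ℝ V * Real.exp 501 / γ) ^ (N * p + 1)) *
        ∫⁻ x in E, ‖r x‖ₑ ^ p ∂μ := by
  set d := Module.finrank ℝ V with hd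
  have hdpos : (1 : ℝ) ≤ d := by exact_mod_cast (Module.finrank_pos : 0 < d)
  have hPfin : μ P ≠ ⊤ := hP.measure_lt_top.ne
  have hPne : P.Nonempty := nonempty_of_measure_ne_zero hP0.ne'
  obtain ⟨x₀, hx₀, hmax⟩ := hP.exists_isMaxOn hPne (f := fun x => ‖r x‖) hr.norm.continuousOn
  set M : ℝ := ‖r x₀‖ with hM
  set D : ℝ := 4 * d * Real.exp 501 / γ with hD
  have hexp : (1 : ℝ) ≤ Real.exp 501 := Real.one_le_exp (by norm_num)
  have hDpos : 0 < D := by positivity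
  have hp0 : 0 < p := by linarith
  have hupper : ∫⁻ x in Q, ‖r x‖ₑ ^ p ∂μ ≤ ENNReal.ofReal (M ^ p) * μ P := by
    calc ∫⁻ x in Q, ‖r x‖ₑ ^ p ∂μ ≤ ∫⁻ x in P, ‖r x‖ₑ ^ p ∂μ := lintegral_mono_set hQ
      _ ≤ ∫⁻ x in P, ENNReal.ofReal (M ^ p) ∂μ := by
        refine setLIntegral_mono measurable_const fun x hx => ?_
        rw [← ofReal_norm, ENNReal.ofReal_rpow_of_nonneg (norm_nonneg _) hp0.le]
        exact ENNReal.ofReal_le_ofReal (Real.rpow_le_rpow (norm_nonneg _) (hmax hx) hp0.le)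
      _ = _ := by rw [setLIntegral_const]
  rcases (norm_nonneg (r x₀)).eq_or_lt with hM0 | hM0
  · rw [← hM] at hM0
    rw [← hM0, Real.zero_rpow hp0.ne'] at hupper
    simp only [ENNReal.ofReal_zero, zero_mul, nonpos_iff_eq_zero] at hupper
    rw [hupper]; exact zero_le
  rw [← hM] at hM0
  have hlower : ∀ a ∈ Set.Ioo (0 : ℝ) 1,
      ENNReal.ofReal ((a * (M / D ^ N)) ^ p) * (ENNReal.ofReal (γ / 2) * μ P) ≤
        ∫⁻ x in E, ‖r x‖ₑ ^ p ∂μ := by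
    intro a ha
    set B : ℝ := a * (M / D ^ N) with hB
    have hBpos : 0 < B := by have := ha.1; positivity
    set E₁ : Set V := E ∩ {x | ‖r x‖ ≤ B} with hE₁
    set E₂ : Set V := E ∩ {x | B < ‖r x‖} with hE₂
    have hm1 : MeasurableSet E₁ := hE.inter (measurableSet_le hr.norm.measurable measurable_const)
    have hm2 : MeasurableSet E₂ := hE.inter (measurableSet_lt measurable_const hr.norm.measurable)
    have hsmall : μ E₁ < ENNReal.ofReal (γ / 2) * μ P := by
      by_contra! hcon
      obtain ⟨v, hv⟩ := exists_segment μ hP hPc hx₀ hP0 hm1 (fun x hx => hEP hx.1)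
        (half_pos hγ) hcon
      set F : Set ℝ := {t ∈ Set.Icc (0 : ℝ) 1 | x₀ + t • v ∈ E₁} with hF
      have hFm : MeasurableSet F := measurableSet_Icc.inter (hm1.preimage (by fun_prop))
      have hFpos : 0 < volume.real F := lt_of_lt_of_le (by positivity) hv
      have h1 := hT x₀ v F B hFm (fun t ht => ht.1) hFpos (fun t ht => ht.2.2)
      have h2 : Real.exp 501 / volume.real F ≤ D := by
        rw [hD, div_le_iff₀ hFpos]
        calc Real.exp 501 = 4 * d * Real.exp 501 / γ * (γ / 2 / (2 * d)) := by field_simp; norm_num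
          _ ≤ _ := by gcongr
      have h3 : M ≤ D ^ N * B := h1.trans (by gcongr)
      have h4 : D ^ N * B = a * M := by rw [hB]; field_simp
      rw [h4] at h3
      nlinarith [ha.2]
    have hbig : ENNReal.ofReal (γ / 2) * μ P ≤ μ E₂ := by
      have h1 : μ E ≤ μ E₁ + μ E₂ := by
        refine (measure_mono ?_).trans (measure_union_le _ _)
        intro x hx
        rcases le_or_gt ‖r x‖ B with h | h
        · exact Or.inl ⟨hx, h⟩
        · exact Or.inr ⟨hx, h⟩
      have h2 : ENNReal.ofReal γ * μ P =
          ENNReal.ofReal (γ / 2) * μ P + ENNReal.ofReal (γ / 2) * μ P := by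
        rw [← add_mul, ← ENNReal.ofReal_add (by linarith) (by linarith)]; ring_nf
      have h3 := hγE.trans h1
      rw [h2] at h3
      have h5 : ENNReal.ofReal (γ / 2) * μ P ≠ ⊤ := ENNReal.mul_ne_top ENNReal.ofReal_ne_top hPfin
      by_contra! hcon
      exact absurd h3 (not_le.mpr (ENNReal.add_lt_add hsmall hcon))
    calc ENNReal.ofReal (B ^ p) * (ENNReal.ofReal (γ / 2) * μ P)
        ≤ ENNReal.ofReal (B ^ p) * μ E₂ := by gcongr
      _ = ∫⁻ x in E₂, ENNReal.ofReal (B ^ p) ∂μ := by rw [setLIntegral_const]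
      _ ≤ ∫⁻ x in E₂, ‖r x‖ₑ ^ p ∂μ := by
        refine setLIntegral_mono (by have := hr.measurable; fun_prop) fun x hx => ?_
        rw [← ofReal_norm, ENNReal.ofReal_rpow_of_nonneg (norm_nonneg _) hp0.le]
        exact ENNReal.ofReal_le_ofReal (Real.rpow_le_rpow hBpos.le (le_of_lt hx.2) hp0.le)
      _ ≤ _ := lintegral_mono_set Set.inter_subset_left
  have hlim : ENNReal.ofReal ((1 * (M / D ^ N)) ^ p) * (ENNReal.ofReal (γ / 2) * μ P) ≤
        ∫⁻ x in E, ‖r x‖ₑ ^ p ∂μ := by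
    have ht : Filter.Tendsto (fun a : ℝ =>
        ENNReal.ofReal ((a * (M / D ^ N)) ^ p) * (ENNReal.ofReal (γ / 2) * μ P))
        (nhdsWithin 1 (Set.Iio 1))
        (nhds (ENNReal.ofReal ((1 * (M / D ^ N)) ^ p) * (ENNReal.ofReal (γ / 2) * μ P))) := by
      refine ENNReal.Tendsto.mul_const ?_
        (Or.inr (ENNReal.mul_ne_top ENNReal.ofReal_ne_top hPfin))
      refine (ENNReal.continuous_ofReal.tendsto _).comp (Filter.Tendsto.mono_left ?_
        nhdsWithin_le_nhds)
      refine ((continuous_id.mul continuous_const).tendsto' 1 _ rfl).rpow_const (Or.inr hp0.le)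
    refine le_of_tendsto ht ?_
    filter_upwards [Ioo_mem_nhdsLT (show (0 : ℝ) < 1 by norm_num)] with a ha using hlower a ha
  refine hupper.trans ?_
  have hDp : D ^ (N * p + 1) = (D ^ N) ^ p * D := by
    rw [Real.rpow_add hDpos, Real.rpow_one, Real.rpow_mul hDpos.le, Real.rpow_natCast]
  calc ENNReal.ofReal (M ^ p) * μ P
      ≤ ENNReal.ofReal (D ^ (N * p + 1)) *
        (ENNReal.ofReal ((1 * (M / D ^ N)) ^ p) * (ENNReal.ofReal (γ / 2) * μ P)) := by
        rw [← mul_assoc, ← mul_assoc, ← ENNReal.ofReal_mul (by positivity),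
          ← ENNReal.ofReal_mul (by positivity)]
        gcongr
        rw [hDp, one_mul, Real.div_rpow hM0.le (by positivity)]
        have hDN : 0 < (D ^ N) ^ p := by positivity
        have h1 : (D ^ N) ^ p * D * (M ^ p / (D ^ N) ^ p) * (γ / 2) = M ^ p * (D * γ / 2) := by
          field_simp
        rw [h1]
        refine le_mul_of_one_le_right (by positivity) ?_
        rw [hD, div_mul_cancel₀ _ hγ.ne']
        nlinarith
    _ ≤ _ := by gcongr

end LocalLp

section Multipliers

theorem sum_range_exp_eq {M : ℕ} (hM : 0 < M) {q : ℤ} (hq : |q| < M) :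
    ∑ τ ∈ Finset.range M, Complex.exp (2 * Real.pi * Complex.I * (τ * q / M)) =
      if q = 0 then (M : ℂ) else 0 := by
  have hMc : (M : ℂ) ≠ 0 := by exact_mod_cast hM.ne'
  split_ifs with h
  · simp [h]
  set ζ := Complex.exp (2 * Real.pi * Complex.I * (q / M)) with hζ
  have h1 : ∀ τ : ℕ, Complex.exp (2 * Real.pi * Complex.I * (τ * q / M)) = ζ ^ τ := by
    intro τ
    rw [hζ, ← Complex.exp_nat_mul]
    congr 1; ring
  have hζM : ζ ^ M = 1 := by
    rw [hζ, ← Complex.exp_nat_mul, Complex.exp_eq_one_iff]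
    exact ⟨q, by field_simp⟩
  have hζ1 : ζ ≠ 1 := by
    rw [hζ, Ne, Complex.exp_eq_one_iff]
    rintro ⟨n, hn⟩
    have hpi : (2 * Real.pi * Complex.I : ℂ) ≠ 0 := Complex.two_pi_I_ne_zero
    have h2 : (q / M : ℂ) = n := by
      apply mul_left_cancel₀ hpi
      rw [hn]; ring
    rw [div_eq_iff hMc] at h2
    have h3 : q = n * M := by exact_mod_cast h2
    have h4 : (M : ℤ) ∣ q := ⟨n, by rw [h3]; ring⟩
    exact h (Int.eq_zero_of_abs_lt_dvd h4 hq)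
  simp_rw [h1]
  have := geom_sum_mul ζ M
  rw [hζM, sub_self] at this
  exact (mul_eq_zero.mp this).resolve_right (sub_ne_zero.mpr hζ1)

/-- A seminorm on coefficient families which only sees `F` and is invariant under the
modulations along the integer frequency `m`. -/
structure IsModulationInvariant {K : Type*} (F : Finset K) (N : Seminorm ℂ (K → ℂ))
    (m : K → ℤ) : Prop where
  congr : ∀ c c' : K → ℂ, (∀ k ∈ F, c k = c' k) → N c = N c'
  modulate_le : ∀ (θ : ℝ) (c : K → ℂ),
    N (fun k => Complex.exp (2 * Real.pi * Complex.I * (θ * m k)) * c k) ≤ N c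

variable {K : Type*} {F : Finset K} {N : Seminorm ℂ (K → ℂ)} {m : K → ℤ}

theorem IsModulationInvariant.sub_const (h : IsModulationInvariant F N m) (q : ℤ) :
    IsModulationInvariant F N (fun k => m k - q) := by
  refine ⟨h.congr, fun θ c => ?_⟩
  have h1 : (fun k => Complex.exp (2 * Real.pi * Complex.I * (θ * ((m k - q : ℤ) : ℂ))) * c k) =
      Complex.exp (2 * Real.pi * Complex.I * (θ * (-q))) •
        fun k => Complex.exp (2 * Real.pi * Complex.I * (θ * m k)) * c k := by
    ext k
    simp only [Pi.smul_apply, smul_eq_mul, ← mul_assoc, ← Complex.exp_add]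
    congr 2
    push_cast; ring
  rw [h1, map_smul_eq_mul]
  have h2 : ‖Complex.exp (2 * Real.pi * Complex.I * (θ * (-q)))‖ = 1 := by
    have := Complex.norm_exp_ofReal_mul_I (2 * Real.pi * (θ * (-q)))
    rw [← this]
    congr 2
    push_cast; ring
  rw [h2, one_mul]
  exact h.modulate_le θ c

/-- Parseval's identity for the discrete Fourier transform of the indicator of `A`. -/
theorem sum_norm_sq_dirichlet (A : Finset ℤ) {M : ℕ} (hM : 0 < M)
    (hA : ∀ a ∈ A, ∀ a' ∈ A, |a - a'| < M) :
    ∑ τ ∈ Finset.range M, ‖∑ a ∈ A, Complex.exp (2 * Real.pi * Complex.I * (τ * a / M))‖ ^ 2 =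
      M * A.card := by
  have hconj : ∀ (τ : ℕ) (a : ℤ), (starRingEnd ℂ)
      (Complex.exp (2 * Real.pi * Complex.I * (τ * a / M))) =
      Complex.exp (-(2 * Real.pi * Complex.I * (τ * a / M))) := by
    intro τ a
    rw [← Complex.exp_conj]
    congr 1
    simp [Complex.conj_ofReal, Complex.conj_ofNat]
  have h1 : ∀ τ ∈ Finset.range M,
      ((‖∑ a ∈ A, Complex.exp (2 * Real.pi * Complex.I * (τ * a / M))‖ ^ 2 : ℝ) : ℂ) =
      ∑ a ∈ A, ∑ a' ∈ A, Complex.exp (2 * Real.pi * Complex.I * (τ * ((a - a' : ℤ) : ℂ) / M)) := by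
    intro τ _
    rw [Complex.ofReal_pow, ← Complex.mul_conj', map_sum, Finset.sum_mul_sum]
    refine Finset.sum_congr rfl fun a _ => Finset.sum_congr rfl fun a' _ => ?_
    rw [hconj, ← Complex.exp_add]
    congr 1
    push_cast; ring
  have h2 : ((∑ τ ∈ Finset.range M,
      ‖∑ a ∈ A, Complex.exp (2 * Real.pi * Complex.I * (τ * a / M))‖ ^ 2 : ℝ) : ℂ) =
      ((M * A.card : ℝ) : ℂ) := by
    rw [Complex.ofReal_sum, Finset.sum_congr rfl h1, Finset.sum_comm]
    calc ∑ a ∈ A, ∑ τ ∈ Finset.range M, ∑ a' ∈ A,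
          Complex.exp (2 * Real.pi * Complex.I * (τ * ((a - a' : ℤ) : ℂ) / M))
        = ∑ a ∈ A, (M : ℂ) := by
          refine Finset.sum_congr rfl fun a ha => ?_
          rw [Finset.sum_comm, Finset.sum_congr rfl fun a' ha' =>
            sum_range_exp_eq hM (hA a ha a' ha')]
          simp only [sub_eq_zero]
          rw [Finset.sum_ite_eq]
          simp [ha]
      _ = _ := by simp [mul_comm]
  exact_mod_cast h2

theorem IsModulationInvariant.count_mul_le (h : IsModulationInvariant F N m) (A B : Finset ℤ)
    (c : K → ℂ) :
    N (fun k => ((A.filter fun a => m k - a ∈ B).card : ℂ) * c k) ≤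
      (A.card + B.card) / 2 * N c := by
  classical
  obtain ⟨R, hR0, hRA, hRB, hRF⟩ : ∃ R : ℕ, 0 < R ∧ (∀ a ∈ A, |a| ≤ (R : ℤ)) ∧
      (∀ b ∈ B, |b| ≤ (R : ℤ)) ∧ (∀ k ∈ F, |m k| ≤ (R : ℤ)) := by
    refine ⟨1 + ∑ a ∈ A, a.natAbs + ∑ b ∈ B, b.natAbs + ∑ k ∈ F, (m k).natAbs, by omega, ?_, ?_, ?_⟩
    · intro a ha
      have := Finset.single_le_sum (f := fun a : ℤ => a.natAbs) (fun _ _ => Nat.zero_le _) ha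
      rw [abs_le]; omega
    · intro a ha
      have := Finset.single_le_sum (f := fun a : ℤ => a.natAbs) (fun _ _ => Nat.zero_le _) ha
      rw [abs_le]; omega
    · intro k hk
      have := Finset.single_le_sum (f := fun k => (m k).natAbs) (fun _ _ => Nat.zero_le _) hk
      rw [abs_le]; omega
  set M : ℕ := 4 * R with hM
  have hM0 : 0 < M := by omega
  have hMc : (M : ℂ) ≠ 0 := by exact_mod_cast hM0.ne'
  have hMr : (0 : ℝ) < M := by exact_mod_cast hM0
  set D : Finset ℤ → ℕ → ℂ := fun A τ =>
    ∑ a ∈ A, Complex.exp (2 * Real.pi * Complex.I * (τ * a / M)) with hD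
  set g : ℕ → K → ℂ := fun τ k =>
    Complex.exp (2 * Real.pi * Complex.I * (((-(τ / M) : ℝ) : ℂ) * m k)) * c k with hg
  have hgN : ∀ τ, N (g τ) ≤ N c := fun τ => h.modulate_le _ c
  have key : ∀ k ∈ F, ((A.filter fun a => m k - a ∈ B).card : ℂ) * c k =
      (∑ τ ∈ Finset.range M, ((M : ℂ)⁻¹ * (D A τ * D B τ)) • g τ) k := by
    intro k hk
    rw [Finset.sum_apply]
    have e1 : ∀ τ ∈ Finset.range M, (((M : ℂ)⁻¹ * (D A τ * D B τ)) • g τ) k =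
        ∑ a ∈ A, ∑ b ∈ B, (M : ℂ)⁻¹ * c k *
          Complex.exp (2 * Real.pi * Complex.I * (τ * ((a + b - m k : ℤ) : ℂ) / M)) := by
      intro τ _
      have e0 : D A τ * D B τ = ∑ a ∈ A, ∑ b ∈ B,
          Complex.exp (2 * Real.pi * Complex.I * (τ * a / M)) *
          Complex.exp (2 * Real.pi * Complex.I * (τ * b / M)) := Finset.sum_mul_sum _ _ _ _
      simp only [e0, hg, Pi.smul_apply, smul_eq_mul, Finset.mul_sum, Finset.sum_mul]
      refine Finset.sum_congr rfl fun a _ => Finset.sum_congr rfl fun b _ => ?_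
      rw [show Complex.exp (2 * Real.pi * Complex.I * (τ * ((a + b - m k : ℤ) : ℂ) / M)) =
        Complex.exp (2 * Real.pi * Complex.I * (τ * a / M)) *
        Complex.exp (2 * Real.pi * Complex.I * (τ * b / M)) *
        Complex.exp (2 * Real.pi * Complex.I * (((-(τ / M) : ℝ) : ℂ) * m k)) by
          rw [← Complex.exp_add, ← Complex.exp_add]; congr 1; push_cast; ring]
      ring
    rw [Finset.sum_congr rfl e1, Finset.sum_comm, Finset.card_filter, Nat.cast_sum, Finset.sum_mul]
    refine Finset.sum_congr rfl fun a ha => ?_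
    rw [Finset.sum_comm]
    have e2 : ∀ b ∈ B, ∑ τ ∈ Finset.range M, (M : ℂ)⁻¹ * c k *
          Complex.exp (2 * Real.pi * Complex.I * (τ * ((a + b - m k : ℤ) : ℂ) / M)) =
          if b = m k - a then c k else 0 := by
      intro b hb
      rw [← Finset.mul_sum, sum_range_exp_eq hM0]
      · by_cases hab : b = m k - a
        · rw [if_pos (by omega), if_pos hab]; field_simp
        · rw [if_neg (by omega), if_neg hab, mul_zero]
      · have h1 := abs_le.mp (hRA a ha)
        have h2 := abs_le.mp (hRB b hb)
        have h3 := abs_le.mp (hRF k hk)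
        rw [abs_lt]
        push_cast [hM]
        constructor <;> omega
    rw [Finset.sum_congr rfl e2, Finset.sum_ite_eq']
    split_ifs <;> simp
  have hpars : ∀ X : Finset ℤ, (∀ a ∈ X, |a| ≤ (R : ℤ)) →
      ∑ τ ∈ Finset.range M, ‖D X τ‖ ^ 2 = M * X.card := by
    intro X hX
    refine sum_norm_sq_dirichlet X hM0 fun a ha a' ha' => ?_
    have h1 := abs_le.mp (hX a ha)
    have h2 := abs_le.mp (hX a' ha')
    rw [abs_lt]
    push_cast [hM]
    constructor <;> omega
  rw [h.congr _ _ key]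
  calc N (∑ τ ∈ Finset.range M, ((M : ℂ)⁻¹ * (D A τ * D B τ)) • g τ)
      ≤ ∑ τ ∈ Finset.range M, N (((M : ℂ)⁻¹ * (D A τ * D B τ)) • g τ) :=
        Finset.le_sum_of_subadditive N (map_zero N).le (map_add_le_add N) _ _
    _ ≤ ∑ τ ∈ Finset.range M, (M : ℝ)⁻¹ * ((‖D A τ‖ ^ 2 + ‖D B τ‖ ^ 2) / 2) * N c := by
        refine Finset.sum_le_sum fun τ _ => ?_
        rw [map_smul_eq_mul, norm_mul, norm_mul, norm_inv, Complex.norm_natCast]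
        gcongr
        · nlinarith [sq_nonneg (‖D A τ‖ - ‖D B τ‖)]
        · exact hgN τ
    _ = (A.card + B.card) / 2 * N c := by
        rw [← Finset.sum_mul, ← Finset.mul_sum, ← Finset.sum_div, Finset.sum_add_distrib,
          hpars A hRA, hpars B hRB]
        field_simp

theorem card_filter_Ico (W : ℕ) {q : ℤ} (hq : |q| ≤ W) :
    (((Finset.Ico (0 : ℤ) W).filter fun a => q - a ∈ Finset.Ioc (-W : ℤ) 0).card : ℤ) = W - |q| := by
  have h1 : ((Finset.Ico (0 : ℤ) W).filter fun a => q - a ∈ Finset.Ioc (-W : ℤ) 0) =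
      Finset.Ico (max 0 q) (min (W : ℤ) (q + W)) := by
    ext a
    simp only [Finset.mem_filter, Finset.mem_Ico, Finset.mem_Ioc, max_le_iff, lt_min_iff]
    omega
  rw [h1, Int.card_Ico]
  rcases abs_cases q with ⟨h, _⟩ | ⟨h, _⟩ <;> omega

/-- Bernstein's inequality. -/
theorem IsModulationInvariant.bernstein (h : IsModulationInvariant F N m) {R : ℕ}
    {c : K → ℂ} (hR : ∀ k ∈ F, c k ≠ 0 → |m k| ≤ R) :
    N (fun k => (m k : ℂ) * c k) ≤ 2 * R * N c := by
  set A := Finset.Ico (0 : ℤ) (2 * R : ℕ) with hA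
  set B := Finset.Ioc (-(2 * R : ℕ) : ℤ) 0 with hB
  have hAc : A.card = 2 * R := by rw [hA, Int.card_Ico]; omega
  have hBc : B.card = 2 * R := by rw [hB, Int.card_Ioc]; omega
  have h1 := (h.sub_const R).count_mul_le A B c
  have h2 := (h.sub_const (-R)).count_mul_le A B c
  rw [hAc, hBc] at h1 h2
  set f₁ := fun k => ((A.filter fun a => (m k - R) - a ∈ B).card : ℂ) * c k with hf₁
  set f₂ := fun k => ((A.filter fun a => (m k - -R) - a ∈ B).card : ℂ) * c k with hf₂
  have key : ∀ k ∈ F, (m k : ℂ) * c k = ((1 / 2 : ℂ) • (f₁ - f₂)) k := by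
    intro k hk
    by_cases hc : c k = 0
    · simp [hf₁, hf₂, hc]
    have hk' := abs_le.mp (hR k hk hc)
    have e1 := card_filter_Ico (2 * R) (q := m k - R) (by rw [abs_le]; push_cast; omega)
    have e2 := card_filter_Ico (2 * R) (q := m k - -R) (by rw [abs_le]; push_cast; omega)
    rw [abs_of_nonpos (by omega)] at e1
    rw [abs_of_nonneg (by omega)] at e2
    have e3 := congrArg (Int.cast (R := ℂ)) e1
    have e4 := congrArg (Int.cast (R := ℂ)) e2
    push_cast at e3 e4
    simp only [hf₁, hf₂, Pi.smul_apply, Pi.sub_apply, smul_eq_mul, hA, hB]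
    push_cast
    rw [e3, e4]
    ring
  rw [h.congr _ _ key, map_smul_eq_mul]
  have h3 := map_sub_le_add N f₁ f₂
  have : ‖(1 / 2 : ℂ)‖ = 1 / 2 := by norm_num
  rw [this]
  push_cast at h1 h2
  linarith

/-- A smooth cut-off: a multiplier equal to `1` for `|m| ≤ R` and to `0` for `|m| > 3R`. -/
theorem IsModulationInvariant.exists_cutoff (h : IsModulationInvariant F N m) (R : ℕ) :
    ∃ ψ : K → ℂ, (∀ k, |m k| ≤ R → ψ k = 1) ∧ (∀ k, 3 * (R : ℤ) < |m k| → ψ k = 0) ∧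
      ∀ c : K → ℂ, N (fun k => ψ k * c k) ≤ 3 / 2 * N c := by
  set A := Finset.Icc (-(2 * R) : ℤ) (2 * R) with hA
  set B := Finset.Icc (-R : ℤ) R with hB
  have hAc : A.card = 4 * R + 1 := by rw [hA, Int.card_Icc]; omega
  have hBc : B.card = 2 * R + 1 := by rw [hB, Int.card_Icc]; omega
  have hne : (2 * R + 1 : ℂ) ≠ 0 := by exact_mod_cast (by omega : 2 * R + 1 ≠ 0)
  refine ⟨fun k => (2 * R + 1 : ℂ)⁻¹ * ((A.filter fun a => m k - a ∈ B).card : ℂ), ?_, ?_, ?_⟩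
  · intro k hk
    have hk' := abs_le.mp hk
    have : (A.filter fun a => m k - a ∈ B) = Finset.Icc (m k - R) (m k + R) := by
      ext a
      simp only [hA, hB, Finset.mem_filter, Finset.mem_Icc]
      omega
    have hc : (A.filter fun a => m k - a ∈ B).card = 2 * R + 1 := by
      rw [this, Int.card_Icc]; omega
    simp only [hc]
    push_cast
    exact inv_mul_cancel₀ hne
  · intro k hk
    have : (A.filter fun a => m k - a ∈ B) = ∅ := by
      ext a
      simp only [hA, hB, Finset.mem_filter, Finset.mem_Icc, Finset.notMem_empty, iff_false]
      rcases lt_abs.mp hk with h | h <;> omega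
    simp [this]
  · intro c
    have h1 := h.count_mul_le A B c
    rw [hAc, hBc] at h1
    have h2 : (fun k => (2 * R + 1 : ℂ)⁻¹ * ((A.filter fun a => m k - a ∈ B).card : ℂ) * c k) =
        (2 * R + 1 : ℂ)⁻¹ • fun k => ((A.filter fun a => m k - a ∈ B).card : ℂ) * c k := by
      ext k; simp [mul_assoc]
    rw [h2, map_smul_eq_mul, norm_inv]
    have h3 : ‖(2 * R + 1 : ℂ)‖ = 2 * R + 1 := by
      rw [show (2 * R + 1 : ℂ) = ((2 * R + 1 : ℕ) : ℂ) by push_cast; ring, Complex.norm_natCast]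
      push_cast; ring
    rw [h3]
    push_cast at h1
    have hN : 0 ≤ N c := apply_nonneg N c
    have hRr : (0 : ℝ) ≤ R := by positivity
    rw [inv_mul_le_iff₀ (by positivity)]
    refine h1.trans ?_
    nlinarith [mul_nonneg hRr hN]

end Multipliers

section CoordinateMultipliers

variable {d : ℕ} {F : Finset (Fin d → ℤ)} {N : Seminorm ℂ ((Fin d → ℤ) → ℂ)}

/-- The projection to a box of frequencies separated from the rest of `F`. -/
theorem seminorm_indicator_le (h : ∀ j, IsModulationInvariant F N fun k => k j)
    (k₀ : Fin d → ℤ) (R : Fin d → ℕ)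
    (hsep : ∀ k ∈ F, (∀ j, |k j - k₀ j| ≤ R j) ∨ ∃ j, 3 * (R j : ℤ) < |k j - k₀ j|)
    (c : (Fin d → ℤ) → ℂ) :
    N ({k | ∀ j, |k j - k₀ j| ≤ R j}.indicator c) ≤ (3 / 2) ^ d * N c := by
  classical
  choose ψ hψ1 hψ0 hψN using fun j => ((h j).sub_const (k₀ j)).exists_cutoff (R j)
  have key : ∀ s : Finset (Fin d), N (fun k => (∏ j ∈ s, ψ j k) * c k) ≤
      (3 / 2) ^ s.card * N c := by
    intro s
    induction s using Finset.induction_on with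
    | empty => simp
    | insert j s hj ih =>
      rw [Finset.card_insert_of_notMem hj, pow_succ']
      have h1 := hψN j (fun k => (∏ j ∈ s, ψ j k) * c k)
      simp_rw [Finset.prod_insert hj, mul_assoc]
      refine h1.trans ?_
      calc _ ≤ 3 / 2 * ((3 / 2) ^ s.card * N c) := by gcongr
        _ = _ := by ring
  have hcard := key Finset.univ
  rw [Finset.card_fin] at hcard
  refine le_of_eq_of_le ?_ hcard
  rcases Nat.eq_zero_or_pos d with rfl | hd
  · congr 1
    ext k
    simp
  refine (h ⟨0, hd⟩).congr _ _ fun k hk => ?_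
  by_cases hkR : ∀ j, |k j - k₀ j| ≤ R j
  · rw [Set.indicator_of_mem (show k ∈ {k : Fin d → ℤ | ∀ j, |k j - k₀ j| ≤ R j} from hkR),
      Finset.prod_eq_one fun j _ => hψ1 j k (hkR j), one_mul]
  · rw [Set.indicator_of_notMem (show k ∉ {k : Fin d → ℤ | ∀ j, |k j - k₀ j| ≤ R j} from hkR)]
    obtain ⟨j, hj⟩ := (hsep k hk).resolve_left hkR
    rw [Finset.prod_eq_zero (Finset.mem_univ j) (hψ0 j k hj), zero_mul]

/-- Bernstein's inequality for the multiplier `(k - k₀) · x`. -/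
theorem seminorm_linear_le (h : ∀ j, IsModulationInvariant F N fun k => k j)
    (k₀ : Fin d → ℤ) (R : Fin d → ℕ) (x : Fin d → ℝ) {c : (Fin d → ℤ) → ℂ}
    (hc : ∀ k ∈ F, c k ≠ 0 → ∀ j, |k j - k₀ j| ≤ R j) :
    N (fun k => (∑ j, ((k j - k₀ j : ℤ) : ℂ) * x j) * c k) ≤ (2 * ∑ j, |x j| * R j) * N c := by
  have h1 : (fun k => (∑ j, ((k j - k₀ j : ℤ) : ℂ) * x j) * c k) =
      ∑ j, (x j : ℂ) • fun k => ((k j - k₀ j : ℤ) : ℂ) * c k := by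
    ext k
    rw [Finset.sum_apply, Finset.sum_mul]
    refine Finset.sum_congr rfl fun j _ => ?_
    simp only [Pi.smul_apply, smul_eq_mul]
    ring
  rw [h1]
  refine (Finset.le_sum_of_subadditive N (map_zero N).le (map_add_le_add N) _ _).trans ?_
  rw [Finset.mul_sum, Finset.sum_mul]
  refine Finset.sum_le_sum fun j _ => ?_
  rw [map_smul_eq_mul, Complex.norm_real, Real.norm_eq_abs]
  have := ((h j).sub_const (k₀ j)).bernstein (R := R j) (c := c) fun k hk hck => hc k hk hck j
  calc |x j| * N (fun k => ((k j - k₀ j : ℤ) : ℂ) * c k) ≤ |x j| * (2 * R j * N c) := by gcongr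
    _ = _ := by ring

end CoordinateMultipliers

section Remainder

/-- The remainder of the exponential series after `m` terms. -/
def expRemainder (m : ℕ) (z : ℂ) : ℂ := Complex.exp z - ∑ i ∈ Finset.range m, z ^ i / i.factorial

theorem tendsto_expRemainder (z : ℂ) :
    Filter.Tendsto (fun m => expRemainder m z) Filter.atTop (nhds 0) := by
  have h1 := (NormedSpace.expSeries_div_hasSum_exp z).tendsto_sum_nat
  rw [← Complex.exp_eq_exp_ℂ] at h1
  have h2 := h1.const_sub (Complex.exp z)
  rw [sub_self] at h2
  exact h2

theorem sum_Ico_pow_div_factorial_le {v : ℝ} (hv : 0 ≤ v) (m n : ℕ) :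
    ∑ i ∈ Finset.range n, v ^ (m + i) / (m + i).factorial ≤
      v ^ m / m.factorial * Real.exp v := by
  calc ∑ i ∈ Finset.range n, v ^ (m + i) / (m + i).factorial
      ≤ ∑ i ∈ Finset.range n, v ^ m / m.factorial * (v ^ i / i.factorial) := by
        refine Finset.sum_le_sum fun i _ => ?_
        rw [div_mul_div_comm, ← pow_add]
        gcongr
        exact_mod_cast Nat.le_of_dvd (Nat.factorial_pos _)
          (Nat.factorial_mul_factorial_dvd_factorial_add m i)
    _ = v ^ m / m.factorial * ∑ i ∈ Finset.range n, v ^ i / i.factorial := by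
        rw [Finset.mul_sum]
    _ ≤ _ := by
        gcongr
        exact Real.sum_le_exp_of_nonneg hv n

/-- If multiplication by `w` acts with norm at most `v` on the coefficient families supported in
`A`, the remainder of the exponential series acts with norm at most `v ^ m / m! * exp v`. -/
theorem seminorm_expRemainder_le {K : Type*} {F : Finset K} {N : Seminorm ℂ (K → ℂ)}
    (hN : ∀ c c' : K → ℂ, (∀ k ∈ F, c k = c' k) → N c = N c') {A : Set K} {w : K → ℂ} {v : ℝ}
    (hv : 0 ≤ v) (hw : ∀ c : K → ℂ, (∀ k ∈ F, c k ≠ 0 → k ∈ A) →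
      N (fun k => w k * c k) ≤ v * N c) {c : K → ℂ} (hc : ∀ k ∈ F, c k ≠ 0 → k ∈ A) (m : ℕ) :
    N (fun k => expRemainder m (w k) * c k) ≤ v ^ m / m.factorial * Real.exp v * N c := by
  classical
  have hpow : ∀ i : ℕ, N (fun k => w k ^ i * c k) ≤ v ^ i * N c := by
    intro i
    induction i with
    | zero => simp
    | succ i ih =>
      have h1 := hw (fun k => w k ^ i * c k) fun k hk hck => hc k hk (right_ne_zero_of_mul hck)
      have h2 : (fun k => w k ^ (i + 1) * c k) = fun k => w k * (w k ^ i * c k) := by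
        ext k; ring
      rw [h2, pow_succ']
      refine h1.trans ?_
      rw [mul_assoc]
      gcongr
  have htail : ∀ c' : K → ℂ, N c' ≤ ∑ k ∈ F, ‖c' k‖ * N (Pi.single k 1) := by
    intro c'
    have h1 : N c' = N (∑ k ∈ F, c' k • (Pi.single k 1 : K → ℂ)) := by
      refine hN _ _ fun k hk => ?_
      rw [Finset.sum_apply, Finset.sum_eq_single k]
      · simp
      · intro b _ hb; simp [Pi.single_eq_of_ne hb.symm]
      · intro h; exact absurd hk h
    rw [h1]
    refine (Finset.le_sum_of_subadditive N (map_zero N).le (map_add_le_add N) _ _).trans ?_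
    refine Finset.sum_le_sum fun k _ => ?_
    rw [map_smul_eq_mul]
  have hbound : ∀ n : ℕ, N (fun k => expRemainder m (w k) * c k) ≤
      v ^ m / m.factorial * Real.exp v * N c +
        ∑ k ∈ F, ‖expRemainder (n + m) (w k) * c k‖ * N (Pi.single k 1) := by
    intro n
    have h1 : (fun k => expRemainder m (w k) * c k) =
        (∑ i ∈ Finset.range n, (((m + i).factorial : ℂ)⁻¹) • fun k => w k ^ (m + i) * c k) +
        fun k => expRemainder (n + m) (w k) * c k := by
      ext k
      rw [Pi.add_apply, Finset.sum_apply]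
      simp only [Pi.smul_apply, smul_eq_mul, expRemainder]
      rw [add_comm n m, Finset.sum_range_add, ← sub_sub, sub_mul _ (∑ i ∈ Finset.range n, _),
        Finset.sum_mul, add_comm, sub_add_eq_add_sub, eq_sub_iff_add_eq]
      congr 1
      refine Finset.sum_congr rfl fun i _ => ?_
      ring
    rw [h1]
    refine (map_add_le_add N _ _).trans (add_le_add ?_ (htail _))
    refine (Finset.le_sum_of_subadditive N (map_zero N).le (map_add_le_add N) _ _).trans ?_
    calc _ ≤ ∑ i ∈ Finset.range n, v ^ (m + i) / (m + i).factorial * N c := by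
          refine Finset.sum_le_sum fun i _ => ?_
          rw [map_smul_eq_mul, norm_inv, Complex.norm_natCast, div_eq_inv_mul, mul_assoc]
          gcongr
          exact hpow _
      _ ≤ _ := by
          rw [← Finset.sum_mul]
          gcongr
          exact sum_Ico_pow_div_factorial_le hv m n
  have hlim : Filter.Tendsto (fun n : ℕ => v ^ m / m.factorial * Real.exp v * N c +
        ∑ k ∈ F, ‖expRemainder (n + m) (w k) * c k‖ * N (Pi.single k 1)) Filter.atTop
      (nhds (v ^ m / m.factorial * Real.exp v * N c + ∑ k ∈ F, ‖(0 : ℂ) * c k‖ *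
        N (Pi.single k 1))) := by
    refine tendsto_const_nhds.add (tendsto_finsetSum _ fun k _ => ?_)
    exact ((((tendsto_expRemainder (w k)).comp (Filter.tendsto_add_atTop_nat m)).mul_const
      (c k)).norm).mul_const _
  simpa using ge_of_tendsto' hlim hbound

end Remainder

section TrigPoly

variable {d : ℕ}

/-- The cube `(0, 1]^d`. -/
def unitCell (d : ℕ) : Set (Fin d → ℝ) := {x | ∀ i, x i ∈ Set.Ioc (0 : ℝ) 1}

theorem unitCell_eq_pi : unitCell d = Set.univ.pi fun _ => Set.Ioc (0 : ℝ) 1 := by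
  ext x; simp [unitCell]

theorem measurableSet_unitCell : MeasurableSet (unitCell d) := by
  rw [unitCell_eq_pi]
  exact MeasurableSet.univ_pi fun _ => measurableSet_Ioc

theorem volume_unitCell : volume (unitCell d) = 1 := by
  rw [unitCell_eq_pi, volume_pi_pi]; simp

/-- The exponential `x ↦ exp (2πi k·x)`. -/
def wave (k : Fin d → ℤ) (x : Fin d → ℝ) : ℂ :=
  Complex.exp (2 * Real.pi * Complex.I * ∑ j, (k j : ℂ) * x j)

/-- The trigonometric polynomial with spectrum in `F` and coefficients `c`. -/
def trigPoly (F : Finset (Fin d → ℤ)) (c : (Fin d → ℤ) → ℂ) (x : Fin d → ℝ) : ℂ :=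
  ∑ k ∈ F, c k * wave k x

theorem wave_add (k : Fin d → ℤ) (x y : Fin d → ℝ) : wave k (x + y) = wave k x * wave k y := by
  unfold wave
  rw [← Complex.exp_add, ← mul_add, ← Finset.sum_add_distrib]
  congr 2
  refine Finset.sum_congr rfl fun j _ => ?_
  rw [Pi.add_apply]; push_cast; ring

theorem norm_wave (k : Fin d → ℤ) (x : Fin d → ℝ) : ‖wave k x‖ = 1 := by
  unfold wave
  have := Complex.norm_exp_ofReal_mul_I (2 * Real.pi * ∑ j, (k j : ℝ) * x j)
  rw [← this]
  congr 2
  push_cast; ring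

theorem continuous_wave (k : Fin d → ℤ) : Continuous (wave k) := by
  unfold wave; fun_prop

theorem continuous_trigPoly (F : Finset (Fin d → ℤ)) (c : (Fin d → ℤ) → ℂ) :
    Continuous (trigPoly F c) := by
  unfold trigPoly
  have := fun k => continuous_wave (d := d) k
  fun_prop

theorem norm_trigPoly_le (F : Finset (Fin d → ℤ)) (c : (Fin d → ℤ) → ℂ) (x : Fin d → ℝ) :
    ‖trigPoly F c x‖ ≤ ∑ k ∈ F, ‖c k‖ := by
  refine (norm_sum_le _ _).trans (Finset.sum_le_sum fun k _ => ?_)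
  rw [norm_mul, norm_wave, mul_one]

theorem trigPoly_add (F : Finset (Fin d → ℤ)) (c c' : (Fin d → ℤ) → ℂ) :
    trigPoly F (c + c') = trigPoly F c + trigPoly F c' := by
  ext x
  simp [trigPoly, add_mul, Finset.sum_add_distrib]

theorem trigPoly_smul (F : Finset (Fin d → ℤ)) (a : ℂ) (c : (Fin d → ℤ) → ℂ) :
    trigPoly F (a • c) = a • trigPoly F c := by
  ext x
  simp [trigPoly, Finset.mul_sum, mul_assoc]

theorem mFourier_coe (k : Fin d → ℤ) (x : Fin d → ℝ) :
    UnitAddTorus.mFourier k (fun i => (x i : UnitAddCircle)) = wave k x := by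
  simp only [UnitAddTorus.mFourier, ContinuousMap.coe_mk, fourier_coe_apply, wave]
  rw [← Complex.exp_sum, Finset.mul_sum]
  congr 1
  refine Finset.sum_congr rfl fun j _ => ?_
  simp; ring

theorem setLIntegral_unitCell_add (g : UnitAddTorus (Fin d) → ENNReal) (a : Fin d → ℝ) :
    ∫⁻ x in unitCell d, g (fun i => ((x + a) i : ℝ)) = ∫⁻ x in unitCell d, g (fun i => (x i : ℝ)) := by
  have h1 := (UnitAddTorus.lintegral_preimage g a).symm.trans (UnitAddTorus.lintegral_preimage g 0)
  have h2 : {x : Fin d → ℝ | ∀ i, x i ∈ Set.Ioc ((0 : Fin d → ℝ) i) ((0 : Fin d → ℝ) i + 1)} =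
      unitCell d := by
    simp [unitCell]
  rw [h2] at h1
  rw [← h1]
  have h3 : unitCell d = (fun x => x + a) ⁻¹' {x | ∀ i, x i ∈ Set.Ioc (a i) (a i + 1)} := by
    ext x
    simp only [unitCell, Set.mem_ofPred_eq, Set.mem_preimage, Set.mem_Ioc, Pi.add_apply]
    refine forall_congr' fun i => ?_
    constructor <;> rintro ⟨h1, h2⟩ <;> constructor <;> linarith
  rw [h3]
  exact (measurePreserving_add_right volume a).setLIntegral_comp_preimage_emb
    (measurableEmbedding_addRight a) (fun x : Fin d → ℝ => g fun i => (x i : ℝ)) _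

theorem eLpNorm'_trigPoly_translate (F : Finset (Fin d → ℤ)) (c : (Fin d → ℤ) → ℂ)
    (a : Fin d → ℝ) (p : ℝ) :
    eLpNorm' (fun x => trigPoly F c (x + a)) p (volume.restrict (unitCell d)) =
      eLpNorm' (trigPoly F c) p (volume.restrict (unitCell d)) := by
  unfold eLpNorm'
  congr 1
  have := setLIntegral_unitCell_add (fun z : UnitAddTorus (Fin d) =>
    ‖∑ k ∈ F, c k * UnitAddTorus.mFourier k z‖ₑ ^ p) a
  simp only [mFourier_coe] at this
  exact this

theorem aestronglyMeasurable_trigPoly (F : Finset (Fin d → ℤ)) (c : (Fin d → ℤ) → ℂ)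
    (μ : Measure (Fin d → ℝ)) : AEStronglyMeasurable (trigPoly F c) μ :=
  (continuous_trigPoly F c).aestronglyMeasurable

instance : IsFiniteMeasure (volume.restrict (unitCell d)) :=
  ⟨by rw [Measure.restrict_apply_univ, volume_unitCell]; exact ENNReal.one_lt_top⟩

theorem eLpNorm'_trigPoly_ne_top (F : Finset (Fin d → ℤ)) (c : (Fin d → ℤ) → ℂ) {p : ℝ}
    (hp : 1 ≤ p) : eLpNorm' (trigPoly F c) p (volume.restrict (unitCell d)) ≠ ⊤ := by
  refine ne_top_of_le_ne_top (b := ENNReal.ofReal (∑ k ∈ F, ‖c k‖)) ENNReal.ofReal_ne_top ?_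
  unfold eLpNorm'
  rw [one_div, ENNReal.rpow_inv_le_iff (by linarith)]
  calc _ ≤ ∫⁻ x in unitCell d, ENNReal.ofReal (∑ k ∈ F, ‖c k‖) ^ p := by
        refine lintegral_mono fun x => ?_
        rw [← ofReal_norm]
        exact ENNReal.rpow_le_rpow (ENNReal.ofReal_le_ofReal (norm_trigPoly_le F c x)) (by linarith)
    _ = _ := by rw [setLIntegral_const, volume_unitCell, mul_one]

/-- The `L^p` norm over a period of the trigonometric polynomial with spectrum in `F`. -/
def trigSeminorm (F : Finset (Fin d → ℤ)) (p : ℝ) (hp : 1 ≤ p) : Seminorm ℂ ((Fin d → ℤ) → ℂ) :=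
  Seminorm.of (fun c => (eLpNorm' (trigPoly F c) p (volume.restrict (unitCell d))).toReal)
    (fun c c' => by
      rw [trigPoly_add, ← ENNReal.toReal_add (eLpNorm'_trigPoly_ne_top F c hp)
        (eLpNorm'_trigPoly_ne_top F c' hp)]
      refine ENNReal.toReal_mono (ENNReal.add_ne_top.mpr ⟨eLpNorm'_trigPoly_ne_top F c hp,
        eLpNorm'_trigPoly_ne_top F c' hp⟩) ?_
      exact eLpNorm'_add_le (aestronglyMeasurable_trigPoly F c _)
        (aestronglyMeasurable_trigPoly F c' _) hp)
    (fun a c => by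
      rw [trigPoly_smul, eLpNorm'_const_smul a (by linarith), ENNReal.toReal_mul, toReal_enorm])

theorem trigSeminorm_apply (F : Finset (Fin d → ℤ)) {p : ℝ} (hp : 1 ≤ p) (c : (Fin d → ℤ) → ℂ) :
    trigSeminorm F p hp c =
      (eLpNorm' (trigPoly F c) p (volume.restrict (unitCell d))).toReal := rfl

theorem isModulationInvariant_trigSeminorm (F : Finset (Fin d → ℤ)) {p : ℝ} (hp : 1 ≤ p)
    (j : Fin d) : IsModulationInvariant F (trigSeminorm F p hp) fun k => k j := by
  refine ⟨fun c c' hcc => ?_, fun θ c => ?_⟩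
  · rw [trigSeminorm_apply, trigSeminorm_apply]
    have : trigPoly F c = trigPoly F c' := by
      ext x
      exact Finset.sum_congr rfl fun k hk => by rw [hcc k hk]
    rw [this]
  · rw [trigSeminorm_apply, trigSeminorm_apply,
      ← eLpNorm'_trigPoly_translate F c (Pi.single j θ) p]
    refine le_of_eq ?_
    congr 2
    ext x
    refine Finset.sum_congr rfl fun k _ => ?_
    rw [wave_add]
    have : wave k (Pi.single j θ) = Complex.exp (2 * Real.pi * Complex.I * (θ * k j)) := by
      unfold wave
      rw [Finset.sum_eq_single j]
      · simp; ring_nf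
      · intro i _ hi; simp [Pi.single_eq_of_ne hi]
      · intro h; exact absurd (Finset.mem_univ j) h
    rw [this]; ring

end TrigPoly

section Taylor

variable {d : ℕ}

/-- The frequencies at distance at most `R` from `k₀`, coordinatewise. -/
def freqBox (k₀ : Fin d → ℤ) (R : Fin d → ℕ) : Set (Fin d → ℤ) := {k | ∀ j, |k j - k₀ j| ≤ R j}

/-- The phase `2πi (k - k₀)·h`. -/
def phase (k k₀ : Fin d → ℤ) (h : Fin d → ℝ) : ℂ :=
  2 * Real.pi * Complex.I * ∑ j, ((k j - k₀ j : ℤ) : ℂ) * h j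

theorem wave_eq_mul_exp_phase (k k₀ : Fin d → ℤ) (h : Fin d → ℝ) :
    wave k h = wave k₀ h * Complex.exp (phase k k₀ h) := by
  unfold wave phase
  rw [← Complex.exp_add, ← mul_add, ← Finset.sum_add_distrib]
  congr 2
  refine Finset.sum_congr rfl fun j _ => ?_
  push_cast; ring

/-- The part of `trigPoly F c (y + h)` which is neglected when the factors
`exp (2πi (k - k₀)·h)`, for `k` close to `k₀`, are replaced with Taylor polynomials. -/
def taylorErrorCoeff (s : Finset (Fin d → ℤ)) (R : Fin d → ℕ) (m : ℕ) (c : (Fin d → ℤ) → ℂ)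
    (h : Fin d → ℝ) (k : Fin d → ℤ) : ℂ :=
  ∑ k₀ ∈ s, wave k₀ h * (expRemainder m (phase k k₀ h) * (freqBox k₀ R).indicator c k)

/-- The approximation of `trigPoly F c (y + h)` obtained by Taylor expansion. -/
def taylorModel (F s : Finset (Fin d → ℤ)) (R : Fin d → ℕ) (m : ℕ) (c : (Fin d → ℤ) → ℂ)
    (y h : Fin d → ℝ) : ℂ :=
  ∑ k₀ ∈ s, wave k₀ h * ∑ k ∈ F, (freqBox k₀ R).indicator c k * wave k y *
    ∑ i ∈ Finset.range m, phase k k₀ h ^ i / i.factorial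

/-- The boxes `freqBox k₀ R`, `k₀ ∈ s`, cover `F` and their centers are separated. -/
structure IsSeparatedCover (F s : Finset (Fin d → ℤ)) (R : Fin d → ℕ) : Prop where
  cover : ∀ k ∈ F, ∃ k₀ ∈ s, k ∈ freqBox k₀ R
  sep : ∀ k₀ ∈ s, ∀ k₁ ∈ s, k₀ ≠ k₁ → ∃ j, 4 * (R j : ℤ) < |k₀ j - k₁ j|

theorem IsSeparatedCover.mem_or_far {F s : Finset (Fin d → ℤ)} {R : Fin d → ℕ}
    (hs : IsSeparatedCover F s R) {k₀ : Fin d → ℤ} (hk₀ : k₀ ∈ s) {k : Fin d → ℤ} (hk : k ∈ F) :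
    k ∈ freqBox k₀ R ∨ ∃ j, 3 * (R j : ℤ) < |k j - k₀ j| := by
  obtain ⟨k₁, hk₁, hkk⟩ := hs.cover k hk
  by_cases h : k₁ = k₀
  · exact Or.inl (h ▸ hkk)
  · obtain ⟨j, hj⟩ := hs.sep k₀ hk₀ k₁ hk₁ (Ne.symm h)
    refine Or.inr ⟨j, ?_⟩
    have h1 := abs_le.mp (hkk j)
    rw [lt_abs] at hj ⊢
    omega

theorem IsSeparatedCover.sum_indicator {F s : Finset (Fin d → ℤ)} {R : Fin d → ℕ}
    (hs : IsSeparatedCover F s R) {k : Fin d → ℤ} (hk : k ∈ F) (c : (Fin d → ℤ) → ℂ)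
    (g : (Fin d → ℤ) → ℂ) {a : ℂ} (hg : ∀ k₀, g k₀ = a) :
    ∑ k₀ ∈ s, g k₀ * (freqBox k₀ R).indicator c k = a * c k := by
  obtain ⟨k₁, hk₁, hkk⟩ := hs.cover k hk
  rw [Finset.sum_eq_single k₁]
  · rw [Set.indicator_of_mem hkk, hg]
  · intro k₀ hk₀ hne
    rw [Set.indicator_of_notMem, mul_zero]
    intro hmem
    obtain ⟨j, hj⟩ := hs.sep k₀ hk₀ k₁ hk₁ hne
    have h1 := abs_le.mp (hkk j)
    have h2 := abs_le.mp (hmem j)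
    rw [lt_abs] at hj
    omega
  · intro h; exact absurd hk₁ h

theorem IsSeparatedCover.trigPoly_sub_taylorModel {F s : Finset (Fin d → ℤ)} {R : Fin d → ℕ}
    (hs : IsSeparatedCover F s R) (m : ℕ) (c : (Fin d → ℤ) → ℂ) (y h : Fin d → ℝ) :
    trigPoly F c (y + h) - taylorModel F s R m c y h =
      trigPoly F (taylorErrorCoeff s R m c h) y := by
  rw [sub_eq_iff_eq_add]
  unfold trigPoly taylorModel taylorErrorCoeff
  simp_rw [Finset.mul_sum (s := F)]
  rw [Finset.sum_comm (s := s), ← Finset.sum_add_distrib]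
  refine Finset.sum_congr rfl fun k hk => ?_
  rw [wave_add, Finset.sum_mul, ← Finset.sum_add_distrib]
  have h1 := hs.sum_indicator hk c
    (fun k₀ => wave k₀ h * Complex.exp (phase k k₀ h)) (a := wave k h)
    fun k₀ => (wave_eq_mul_exp_phase k k₀ h).symm
  calc c k * (wave k y * wave k h) = (wave k h * c k) * wave k y := by ring
    _ = _ := by
      rw [← h1, Finset.sum_mul]
      refine Finset.sum_congr rfl fun k₀ _ => ?_
      unfold expRemainder
      ring

theorem IsSeparatedCover.seminorm_taylorErrorCoeff_le {F s : Finset (Fin d → ℤ)} {R : Fin d → ℕ}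
    (hs : IsSeparatedCover F s R) {N : Seminorm ℂ ((Fin d → ℤ) → ℂ)}
    (hd : 0 < d) (hN : ∀ j, IsModulationInvariant F N fun k => k j) {h : Fin d → ℝ} {v : ℝ}
    (hv : 4 * Real.pi * ∑ j, |h j| * R j ≤ v) (m : ℕ) (c : (Fin d → ℤ) → ℂ) :
    N (taylorErrorCoeff s R m c h) ≤
      s.card * (3 / 2) ^ d * (v ^ m / m.factorial * Real.exp v) * N c := by
  have hv0 : 0 ≤ v := le_trans (by positivity) hv
  have h1 : taylorErrorCoeff s R m c h = ∑ k₀ ∈ s, wave k₀ h • fun k =>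
      expRemainder m (phase k k₀ h) * (freqBox k₀ R).indicator c k := by
    ext k
    rw [Finset.sum_apply]
    rfl
  rw [h1]
  refine (Finset.le_sum_of_subadditive N (map_zero N).le (map_add_le_add N) _ _).trans ?_
  have h2 : ∀ k₀ ∈ s, N (wave k₀ h • fun k =>
      expRemainder m (phase k k₀ h) * (freqBox k₀ R).indicator c k) ≤
      (3 / 2) ^ d * (v ^ m / m.factorial * Real.exp v) * N c := by
    intro k₀ hk₀
    rw [map_smul_eq_mul, norm_wave, one_mul]
    have h3 := seminorm_expRemainder_le (hN ⟨0, hd⟩).congr (A := freqBox k₀ R)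
      (w := fun k => phase k k₀ h) hv0 (fun c' hc' => ?_) (c := (freqBox k₀ R).indicator c)
      (fun k _ hk => Set.mem_of_indicator_ne_zero hk) m
    · refine h3.trans ?_
      have h4 := seminorm_indicator_le hN k₀ R (fun k hk => hs.mem_or_far hk₀ hk) c
      calc _ ≤ v ^ m / m.factorial * Real.exp v * ((3 / 2) ^ d * N c) := by gcongr; exact h4
        _ = _ := by ring
    · have h4 := seminorm_linear_le hN k₀ R h (c := c') fun k hk hck j => hc' k hk hck j
      have h5 : (fun k => phase k k₀ h * c' k) = (2 * Real.pi * Complex.I : ℂ) •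
          fun k => (∑ j, ((k j - k₀ j : ℤ) : ℂ) * h j) * c' k := by
        ext k
        simp only [phase, Pi.smul_apply, smul_eq_mul]
        ring
      rw [h5, map_smul_eq_mul]
      have h6 : ‖(2 * Real.pi * Complex.I : ℂ)‖ = 2 * Real.pi := by
        simp [abs_of_pos Real.pi_pos]
      rw [h6]
      calc _ ≤ 2 * Real.pi * ((2 * ∑ j, |h j| * R j) * N c') := by gcongr
        _ = (4 * Real.pi * ∑ j, |h j| * R j) * N c' := by ring
        _ ≤ _ := by gcongr
  refine (Finset.sum_le_sum h2).trans (le_of_eq ?_)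
  rw [Finset.sum_const, nsmul_eq_mul]
  ring

theorem continuous_phase (k k₀ : Fin d → ℤ) : Continuous (phase k k₀) := by
  unfold phase; fun_prop

theorem continuous_taylorModel (F s : Finset (Fin d → ℤ)) (R : Fin d → ℕ) (m : ℕ)
    (c : (Fin d → ℤ) → ℂ) :
    Continuous fun z : (Fin d → ℝ) × (Fin d → ℝ) => taylorModel F s R m c z.1 z.2 := by
  unfold taylorModel
  have h1 := fun k => continuous_wave (d := d) k
  have h2 := fun k k₀ => continuous_phase (d := d) k k₀
  fun_prop

theorem turanOnSegments_taylorModel (F s : Finset (Fin d → ℤ)) (R : Fin d → ℕ) {m N : ℕ}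
    (hN : s.card * m = N + 1) (c : (Fin d → ℤ) → ℂ) (y : Fin d → ℝ) :
    TuranOnSegments N fun x => taylorModel F s R m c y (x - y) := by
  intro x v E B hE hEI hE0 hB
  have hm : 0 < m := by
    rcases Nat.eq_zero_or_pos m with h | h
    · rw [h] at hN; omega
    · exact h
  set P : (Fin d → ℤ) → Polynomial ℂ := fun k₀ => Polynomial.C (wave k₀ (x - y)) *
    ∑ k ∈ F, Polynomial.C ((freqBox k₀ R).indicator c k * wave k y) *
      ∑ i ∈ Finset.range m, Polynomial.C ((i.factorial : ℂ)⁻¹) *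
        (Polynomial.C (phase k k₀ (x - y)) + Polynomial.C (phase k k₀ v) * Polynomial.X) ^ i with hP
  have hPdeg : ∀ k₀ ∈ s, (P k₀).natDegree < m := by
    intro k₀ _
    rw [← Nat.le_sub_one_iff_lt hm]
    refine (Polynomial.natDegree_C_mul_le _ _).trans ?_
    refine Polynomial.natDegree_sum_le_of_forall_le _ _ fun k _ => ?_
    refine (Polynomial.natDegree_C_mul_le _ _).trans ?_
    refine Polynomial.natDegree_sum_le_of_forall_le _ _ fun i hi => ?_
    refine (Polynomial.natDegree_C_mul_le _ _).trans ?_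
    refine (Polynomial.natDegree_pow_le_of_le i (show _ ≤ 1 from ?_)).trans ?_
    · refine (Polynomial.natDegree_add_le _ _).trans (max_le ?_ ?_)
      · simp
      · exact (Polynomial.natDegree_C_mul_le _ _).trans Polynomial.natDegree_X_le
    · have := Finset.mem_range.mp hi
      omega
  set ω : (Fin d → ℤ) → ℝ := fun k₀ => 2 * Real.pi * ∑ j, (k₀ j : ℝ) * v j with hω
  have hphase : ∀ (k k₀ : Fin d → ℤ) (t : ℝ),
      phase k k₀ (x + t • v - y) = phase k k₀ (x - y) + phase k k₀ v * t := by
    intro k k₀ t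
    unfold phase
    rw [mul_assoc _ _ (t : ℂ), ← mul_add, Finset.sum_mul, ← Finset.sum_add_distrib]
    congr 1
    refine Finset.sum_congr rfl fun j _ => ?_
    simp only [Pi.sub_apply, Pi.add_apply, Pi.smul_apply, smul_eq_mul]
    push_cast; ring
  have heq : ∀ t : ℝ, taylorModel F s R m c y (x + t • v - y) =
      ∑ k₀ ∈ s, (P k₀).eval (t : ℂ) * Complex.exp (Complex.I * ω k₀ * t) := by
    intro t
    unfold taylorModel
    refine Finset.sum_congr rfl fun k₀ _ => ?_
    have e1 : wave k₀ (x + t • v - y) = wave k₀ (x - y) * Complex.exp (Complex.I * ω k₀ * t) := by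
      rw [show x + t • v - y = (x - y) + t • v by abel, wave_add]
      congr 1
      unfold wave
      congr 1
      simp only [hω, Pi.smul_apply, smul_eq_mul]
      push_cast
      rw [Finset.mul_sum, Finset.mul_sum, Finset.mul_sum, Finset.sum_mul]
      refine Finset.sum_congr rfl fun j _ => ?_
      ring
    rw [e1, hP]
    simp only [Polynomial.eval_mul, Polynomial.eval_C, Polynomial.eval_finsetSum,
      Polynomial.eval_pow, Polynomial.eval_add, Polynomial.eval_X]
    rw [mul_right_comm]
    congr 2
    refine Finset.sum_congr rfl fun k _ => ?_
    congr 1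
    refine Finset.sum_congr rfl fun i _ => ?_
    rw [hphase, div_eq_inv_mul]
  have h0 := nazarov_turan_polynomial hE hEI hE0 hN P hPdeg ω (B := B) (fun t ht => by
    rw [← heq]; exact hB t ht) (x := 0) ⟨le_rfl, zero_le_one⟩
  rw [← heq, zero_smul, add_zero] at h0
  exact h0

end Taylor

section Grid

variable {d : ℕ} {M : Fin d → ℕ}

/-- The cell containing `y` of the grid of half-open boxes of side lengths `1 / M j`. -/
def gridCell (M : Fin d → ℕ) (y : Fin d → ℝ) : Set (Fin d → ℝ) :=
  {x | ∀ j, ⌈(M j : ℝ) * x j⌉ = ⌈(M j : ℝ) * y j⌉}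

/-- The volume of the cells of the grid. -/
def cellVolume (M : Fin d → ℕ) : ENNReal := ∏ j, ENNReal.ofReal (M j : ℝ)⁻¹

theorem gridCell_eq_pi (hM : ∀ j, 0 < M j) (y : Fin d → ℝ) :
    gridCell M y = Set.univ.pi fun j =>
      Set.Ioc (((⌈(M j : ℝ) * y j⌉ : ℝ) - 1) / M j) ((⌈(M j : ℝ) * y j⌉ : ℝ) / M j) := by
  ext x
  simp only [gridCell, Set.mem_ofPred_eq, Set.mem_univ_pi]
  refine forall_congr' fun j => ?_
  have hMj : (0 : ℝ) < M j := by exact_mod_cast hM j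
  rw [Int.ceil_eq_iff, Set.mem_Ioc, div_lt_iff₀ hMj, le_div_iff₀ hMj, mul_comm (x j)]

theorem measurableSet_gridCell (hM : ∀ j, 0 < M j) (y : Fin d → ℝ) :
    MeasurableSet (gridCell M y) := by
  rw [gridCell_eq_pi hM]
  exact MeasurableSet.univ_pi fun _ => measurableSet_Ioc

theorem volume_gridCell (hM : ∀ j, 0 < M j) (y : Fin d → ℝ) :
    volume (gridCell M y) = cellVolume M := by
  rw [gridCell_eq_pi hM, volume_pi_pi, cellVolume]
  refine Finset.prod_congr rfl fun j _ => ?_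
  rw [Real.volume_Ioc]
  congr 1
  ring

theorem cellVolume_ne_zero (hM : ∀ j, 0 < M j) : cellVolume M ≠ 0 := by
  rw [cellVolume, Finset.prod_ne_zero_iff]
  intro j _
  simpa using (hM j).ne'

theorem cellVolume_ne_top : cellVolume M ≠ ⊤ := ENNReal.prod_ne_top fun _ _ => ENNReal.ofReal_ne_top

theorem gridCell_subset_unitCell (hM : ∀ j, 0 < M j) {y : Fin d → ℝ} (hy : y ∈ unitCell d) :
    gridCell M y ⊆ unitCell d := by
  intro x hx j
  have hMj : (0 : ℝ) < M j := by exact_mod_cast hM j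
  have h1 : 0 < ⌈(M j : ℝ) * y j⌉ := Int.ceil_pos.mpr (mul_pos hMj (hy j).1)
  have h2 : ⌈(M j : ℝ) * y j⌉ ≤ M j := by
    rw [Int.ceil_le]
    push_cast
    nlinarith [(hy j).2]
  rw [← hx j] at h1 h2
  rw [Int.ceil_pos] at h1
  rw [Int.ceil_le] at h2
  push_cast at h2
  constructor
  · exact pos_of_mul_pos_right h1 hMj.le
  · nlinarith

theorem mem_gridCell_comm {x y : Fin d → ℝ} : x ∈ gridCell M y ↔ y ∈ gridCell M x :=
  forall_congr' fun _ => eq_comm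

/-- The pairs of points in the same cell. -/
def samePairs (M : Fin d → ℕ) : Set ((Fin d → ℝ) × (Fin d → ℝ)) := {z | z.2 ∈ gridCell M z.1}

theorem measurableSet_samePairs : MeasurableSet (samePairs M) := by
  have : samePairs M = ⋂ j, {z : (Fin d → ℝ) × (Fin d → ℝ) |
      ⌈(M j : ℝ) * z.2 j⌉ = ⌈(M j : ℝ) * z.1 j⌉} := by
    ext z
    simp [samePairs, gridCell]
  rw [this]
  refine MeasurableSet.iInter fun j => measurableSet_eq_fun ?_ ?_
  · exact Int.measurable_ceil.comp (by fun_prop)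
  · exact Int.measurable_ceil.comp (by fun_prop)

theorem setLIntegral_samePairs {g : (Fin d → ℝ) × (Fin d → ℝ) → ENNReal} (hM : ∀ j, 0 < M j)
    (hg : Measurable g) :
    ∫⁻ z in samePairs M, g z ∂((volume.restrict (unitCell d)).prod volume) =
      ∫⁻ y in unitCell d, ∫⁻ x in gridCell M y, g (y, x) := by
  rw [← lintegral_indicator measurableSet_samePairs,
    lintegral_prod _ (hg.indicator measurableSet_samePairs).aemeasurable]
  refine lintegral_congr fun y => ?_
  rw [← lintegral_indicator (measurableSet_gridCell hM y)]
  rfl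

theorem setLIntegral_samePairs_snd {g : (Fin d → ℝ) → ENNReal} (hM : ∀ j, 0 < M j)
    (hg : Measurable g) :
    ∫⁻ z in samePairs M, g z.2 ∂((volume.restrict (unitCell d)).prod volume) =
      cellVolume M * ∫⁻ x in unitCell d, g x := by
  rw [← lintegral_indicator measurableSet_samePairs, lintegral_prod_symm
    ((samePairs M).indicator fun z => g z.2)
    ((hg.comp measurable_snd).indicator measurableSet_samePairs).aemeasurable,
    ← lintegral_indicator measurableSet_unitCell, ← lintegral_const_mul _
    (hg.indicator measurableSet_unitCell)]
  refine lintegral_congr fun x => ?_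
  have h1 : ∀ y, (samePairs M).indicator (fun z => g z.2) (y, x) =
      (gridCell M x).indicator (fun _ => g x) y := by
    intro y
    by_cases h : y ∈ gridCell M x
    · rw [Set.indicator_of_mem h, Set.indicator_of_mem]
      exact mem_gridCell_comm.mp h
    · rw [Set.indicator_of_notMem h, Set.indicator_of_notMem]
      exact fun h' => h (mem_gridCell_comm.mp h')
  simp only [h1]
  rw [lintegral_indicator (measurableSet_gridCell hM x), lintegral_const,
    Measure.restrict_restrict (measurableSet_gridCell hM x), Measure.restrict_apply_univ]
  by_cases hx : x ∈ unitCell d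
  · rw [Set.inter_eq_left.mpr (gridCell_subset_unitCell hM hx), volume_gridCell hM,
      Set.indicator_of_mem hx, mul_comm]
  · have : gridCell M x ∩ unitCell d = ∅ := by
      ext y
      simp only [Set.mem_inter_iff, Set.mem_empty_iff_false, iff_false, not_and]
      exact fun hyx hy => hx (gridCell_subset_unitCell hM hy (mem_gridCell_comm.mp hyx))
    rw [this, measure_empty, Set.indicator_of_notMem hx, mul_zero, mul_zero]

/-- The differences of the points of a cell. -/
def differenceBox (M : Fin d → ℕ) : Set (Fin d → ℝ) :=
  Set.univ.pi fun j => Set.Icc (-(M j : ℝ)⁻¹) (M j : ℝ)⁻¹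

theorem volume_differenceBox : volume (differenceBox M) = 2 ^ d * cellVolume M := by
  rw [differenceBox, volume_pi_pi, cellVolume]
  have : ∀ j, volume (Set.Icc (-(M j : ℝ)⁻¹) (M j : ℝ)⁻¹) = 2 * ENNReal.ofReal (M j : ℝ)⁻¹ := by
    intro j
    rw [Real.volume_Icc, sub_neg_eq_add, ← two_mul, ENNReal.ofReal_mul (by norm_num)]
    simp
  simp_rw [this, Finset.prod_mul_distrib]
  simp

theorem sub_mem_differenceBox (hM : ∀ j, 0 < M j) {x y : Fin d → ℝ} (h : x ∈ gridCell M y) :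
    x - y ∈ differenceBox M := by
  intro j _
  have hMj : (0 : ℝ) < M j := by exact_mod_cast hM j
  have h1 := h j
  have h2 := Int.ceil_lt_add_one ((M j : ℝ) * x j)
  have h3 := Int.ceil_lt_add_one ((M j : ℝ) * y j)
  have h4 := Int.le_ceil ((M j : ℝ) * x j)
  have h5 := Int.le_ceil ((M j : ℝ) * y j)
  rw [h1] at h2 h4
  have e : (M j : ℝ) * (M j : ℝ)⁻¹ = 1 := mul_inv_cancel₀ hMj.ne'
  rw [Pi.sub_apply]
  constructor
  · refine le_of_mul_le_mul_left ?_ hMj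
    rw [mul_neg, e]; linarith
  · refine le_of_mul_le_mul_left ?_ hMj
    rw [e]; linarith

theorem setLIntegral_samePairs_le {g : (Fin d → ℝ) → (Fin d → ℝ) → ENNReal} (hM : ∀ j, 0 < M j)
    (hg : Measurable (Function.uncurry g)) {B : ENNReal}
    (hB : ∀ h ∈ differenceBox M, ∫⁻ y in unitCell d, g y h ≤ B) :
    ∫⁻ z in samePairs M, g z.1 (z.2 - z.1) ∂((volume.restrict (unitCell d)).prod volume) ≤
      2 ^ d * cellVolume M * B := by
  rw [setLIntegral_samePairs (g := fun z => g z.1 (z.2 - z.1)) hM (by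
    exact hg.comp (measurable_fst.prodMk (measurable_snd.sub measurable_fst)))]
  have hH : MeasurableSet (differenceBox M) := MeasurableSet.univ_pi fun _ => measurableSet_Icc
  calc ∫⁻ y in unitCell d, ∫⁻ x in gridCell M y, g y (x - y)
      ≤ ∫⁻ y in unitCell d, ∫⁻ h in differenceBox M, g y h := by
        refine lintegral_mono fun y => ?_
        rw [← (measurePreserving_sub_right volume y).setLIntegral_comp_preimage_emb
          (MeasurableEquiv.subRight y).measurableEmbedding (fun h => g y h)]
        refine lintegral_mono_set fun x hx => ?_
        exact sub_mem_differenceBox hM hx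
    _ = ∫⁻ h in differenceBox M, ∫⁻ y in unitCell d, g y h :=
        lintegral_lintegral_swap hg.aemeasurable
    _ ≤ ∫⁻ h in differenceBox M, B := setLIntegral_mono measurable_const hB
    _ = _ := by rw [setLIntegral_const, volume_differenceBox, mul_comm]

theorem setLIntegral_gridCell_le {E : Set (Fin d → ℝ)} (hd : 0 < d) (hM : ∀ j, 0 < M j)
    (hE : MeasurableSet E) {γ : ℝ} (hγ : 0 < γ) {y : Fin d → ℝ}
    (hthick : ENNReal.ofReal γ * cellVolume M ≤ volume (E ∩ gridCell M y))
    {N : ℕ} {r : (Fin d → ℝ) → ℂ} (hr : Continuous r) (hT : TuranOnSegments N r) {p : ℝ}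
    (hp : 1 ≤ p) :
    ∫⁻ x in gridCell M y, ‖r x‖ₑ ^ p ≤
      ENNReal.ofReal ((4 * d * Real.exp 501 / γ) ^ (N * p + 1)) *
        ∫⁻ x in gridCell M y, E.indicator (fun x => ‖r x‖ₑ ^ p) x := by
  have : Nonempty (Fin d) := ⟨⟨0, hd⟩⟩
  set P : Set (Fin d → ℝ) := Set.univ.pi fun j =>
      Set.Icc (((⌈(M j : ℝ) * y j⌉ : ℝ) - 1) / M j) ((⌈(M j : ℝ) * y j⌉ : ℝ) / M j) with hP
  have hPvol : volume P = cellVolume M := by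
    rw [hP, volume_pi_pi, cellVolume]
    refine Finset.prod_congr rfl fun j _ => ?_
    rw [Real.volume_Icc]
    congr 1
    ring
  have hsub : gridCell M y ⊆ P := by
    rw [gridCell_eq_pi hM]
    exact Set.pi_mono fun _ _ => Set.Ioc_subset_Icc_self
  have h1 := lintegral_le_of_turanOnSegments (volume : Measure (Fin d → ℝ)) hr hT (P := P)
    (Q := gridCell M y) (E := E ∩ gridCell M y) (isCompact_univ_pi fun _ => isCompact_Icc)
    (convex_pi fun _ _ => convex_Icc _ _) (by rw [hPvol]; exact (cellVolume_ne_zero hM).bot_lt) hsub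
    (hE.inter (measurableSet_gridCell hM y)) (Set.inter_subset_right.trans hsub) hγ
    (by rwa [hPvol]) hp
  rw [Module.finrank_fin_fun] at h1
  rwa [lintegral_indicator hE, Measure.restrict_restrict hE]

end Grid

section LocalStep

variable {d : ℕ} {M : Fin d → ℕ}

theorem continuous_taylorModel_sub (F s : Finset (Fin d → ℤ)) (R : Fin d → ℕ) (m : ℕ)
    (c : (Fin d → ℤ) → ℂ) : Continuous fun z : (Fin d → ℝ) × (Fin d → ℝ) =>
      taylorModel F s R m c z.1 (z.2 - z.1) := by
  unfold taylorModel
  have h1 := fun k => continuous_wave (d := d) k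
  have h2 := fun k k₀ => continuous_phase (d := d) k k₀
  fun_prop

/-- Comparison with the Taylor models on the cells of a grid, up to a multiple of the norm. -/
theorem eLpNorm'_le_add_of_grid {E : Set (Fin d → ℝ)} (hd : 0 < d) (hM : ∀ j, 0 < M j)
    (hE : MeasurableSet E) {γ : ℝ} (hγ : 0 < γ)
    (hthick : ∀ y ∈ unitCell d, ENNReal.ofReal γ * cellVolume M ≤ volume (E ∩ gridCell M y))
    {F s : Finset (Fin d → ℤ)} {R : Fin d → ℕ} (hs : IsSeparatedCover F s R) {m N : ℕ}
    (hN : s.card * m = N + 1) {v : ℝ} (hv : 4 * Real.pi * ∑ j, (M j : ℝ)⁻¹ * R j ≤ v)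
    (c : (Fin d → ℤ) → ℂ) {p : ℝ} (hp : 1 ≤ p) :
    eLpNorm' (trigPoly F c) p (volume.restrict (unitCell d)) ≤
      ENNReal.ofReal ((4 * d * Real.exp 501 / γ) ^ (N + 1 / p)) *
        eLpNorm' (trigPoly F c) p (volume.restrict (E ∩ unitCell d)) +
      (1 + ENNReal.ofReal ((4 * d * Real.exp 501 / γ) ^ (N + 1 / p))) *
        ENNReal.ofReal (2 ^ d * (s.card * (3 / 2) ^ d * (v ^ m / m.factorial * Real.exp v))) *
        eLpNorm' (trigPoly F c) p (volume.restrict (unitCell d)) := by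
  set f := trigPoly F c with hf
  have hfc : Continuous f := continuous_trigPoly F c
  set X := eLpNorm' f p (volume.restrict (unitCell d)) with hX
  set Λ := ENNReal.ofReal ((4 * d * Real.exp 501 / γ) ^ (N + 1 / p)) with hΛ
  set δ := s.card * (3 / 2) ^ d * (v ^ m / m.factorial * Real.exp v) with hδ
  have hv0 : 0 ≤ v := le_trans (by positivity) hv
  have hδ0 : 0 ≤ δ := by positivity
  have hp0 : 0 < p := by linarith
  have hXtop : X ≠ ⊤ := eLpNorm'_trigPoly_ne_top F c hp
  set w := cellVolume M with hw
  have hw0 : w ≠ 0 := cellVolume_ne_zero hM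
  have hwtop : w ≠ ⊤ := cellVolume_ne_top
  set ν := ((volume.restrict (unitCell d)).prod volume).restrict (samePairs M) with hν
  have hES : MeasurableSet {z : (Fin d → ℝ) × (Fin d → ℝ) | z.2 ∈ E} := measurable_snd hE
  set νE := ν.restrict {z | z.2 ∈ E} with hνE
  set Ff : (Fin d → ℝ) × (Fin d → ℝ) → ℂ := fun z => f z.2 with hFf
  set Rr : (Fin d → ℝ) × (Fin d → ℝ) → ℂ :=
    fun z => taylorModel F s R m c z.1 (z.2 - z.1) with hRr
  have hFc : Continuous Ff := hfc.comp continuous_snd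
  have hRc : Continuous Rr := continuous_taylorModel_sub F s R m c
  have hmeas : ∀ {G : (Fin d → ℝ) × (Fin d → ℝ) → ℂ}, Continuous G →
      Measurable fun z => ‖G z‖ₑ ^ p := fun hG => (hG.measurable.enorm.pow_const p)
  have hn1 : eLpNorm' Ff p ν = w ^ (1 / p) * X := by
    rw [hX]
    unfold eLpNorm'
    rw [← ENNReal.mul_rpow_of_nonneg _ _ (by positivity)]
    congr 1
    exact setLIntegral_samePairs_snd (g := fun x => ‖f x‖ₑ ^ p) hM
      (hfc.measurable.enorm.pow_const p)
  have hn2 : eLpNorm' Ff p νE = w ^ (1 / p) * eLpNorm' f p (volume.restrict (E ∩ unitCell d)) := by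
    unfold eLpNorm'
    rw [← ENNReal.mul_rpow_of_nonneg _ _ (by positivity)]
    congr 1
    have h1 := setLIntegral_samePairs_snd (g := E.indicator fun x => ‖f x‖ₑ ^ p) hM
      ((hfc.measurable.enorm.pow_const p).indicator hE)
    rw [lintegral_indicator hE, Measure.restrict_restrict hE] at h1
    rw [← h1, hνE, ← lintegral_indicator hES]
    rfl
  have hn3 : eLpNorm' Rr p ν ≤ Λ * eLpNorm' Rr p νE := by
    have hD : 0 < 4 * d * Real.exp 501 / γ := by
      have : (0 : ℝ) < d := by exact_mod_cast hd
      positivity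
    have hΛp : Λ = ENNReal.ofReal ((4 * d * Real.exp 501 / γ) ^ (N * p + 1)) ^ (1 / p) := by
      rw [hΛ, ENNReal.ofReal_rpow_of_pos (by positivity), ← Real.rpow_mul hD.le]
      congr 2
      field_simp
    unfold eLpNorm'
    rw [hΛp, ← ENNReal.mul_rpow_of_nonneg _ _ (by positivity)]
    refine ENNReal.rpow_le_rpow ?_ (by positivity)
    rw [hνE, ← lintegral_indicator hES, hν, setLIntegral_samePairs hM (hmeas hRc),
      setLIntegral_samePairs hM ((hmeas hRc).indicator hES),
      ← lintegral_const_mul' _ _ ENNReal.ofReal_ne_top]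
    refine setLIntegral_mono' measurableSet_unitCell fun y hy => ?_
    have hrc : Continuous fun x => Rr (y, x) := hRc.comp (continuous_const.prodMk continuous_id)
    exact setLIntegral_gridCell_le hd hM hE hγ (hthick y hy) hrc
      (turanOnSegments_taylorModel F s R hN c y) hp
  have hn4 : eLpNorm' (Ff - Rr) p ν ≤ w ^ (1 / p) * (ENNReal.ofReal (2 ^ d * δ) * X) := by
    have hB : ∀ h ∈ differenceBox M, ∫⁻ y in unitCell d,
        ‖trigPoly F c (y + h) - taylorModel F s R m c y h‖ₑ ^ p ≤
          (ENNReal.ofReal δ * X) ^ p := by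
      intro h hh
      have h1 := hs.seminorm_taylorErrorCoeff_le (N := trigSeminorm F p hp) hd
        (isModulationInvariant_trigSeminorm F hp) (h := h) (v := v) (le_trans ?_ hv) m c
      · rw [trigSeminorm_apply, trigSeminorm_apply] at h1
        have h2 : eLpNorm' (trigPoly F (taylorErrorCoeff s R m c h)) p
            (volume.restrict (unitCell d)) ≤ ENNReal.ofReal δ * X := by
          rw [← ENNReal.ofReal_toReal (eLpNorm'_trigPoly_ne_top F _ hp),
            ← ENNReal.ofReal_toReal hXtop, ← ENNReal.ofReal_mul hδ0]
          exact ENNReal.ofReal_le_ofReal h1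
        simp only [hs.trigPoly_sub_taylorModel]
        unfold eLpNorm' at h2
        rwa [one_div, ENNReal.rpow_inv_le_iff hp0] at h2
      · have hj : ∀ j, |h j| ≤ (M j : ℝ)⁻¹ := fun j => abs_le.mpr (hh j trivial)
        gcongr with j
        exact hj j
    have h1 := setLIntegral_samePairs_le hM (g := fun y h =>
      ‖trigPoly F c (y + h) - taylorModel F s R m c y h‖ₑ ^ p) (by
        refine hmeas (G := fun z => trigPoly F c (z.1 + z.2) - taylorModel F s R m c z.1 z.2) ?_
        exact (hfc.comp (continuous_fst.add continuous_snd)).sub (continuous_taylorModel F s R m c))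
      hB
    unfold eLpNorm'
    rw [one_div, ENNReal.rpow_inv_le_iff hp0]
    have h2 : ∀ z : (Fin d → ℝ) × (Fin d → ℝ), z.1 + (z.2 - z.1) = z.2 := fun z => by abel
    simp only [h2] at h1
    refine h1.trans ?_
    have h2d : (2 : ENNReal) ^ d ≤ (2 ^ d : ENNReal) ^ p := by
      refine ENNReal.le_rpow_self_of_one_le ?_ hp
      exact one_le_pow₀ (by norm_num)
    have h2δ : ENNReal.ofReal (2 ^ d * δ) = 2 ^ d * ENNReal.ofReal δ := by
      rw [ENNReal.ofReal_mul (by positivity), ENNReal.ofReal_pow (by norm_num),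
        ENNReal.ofReal_ofNat]
    rw [h2δ, ENNReal.mul_rpow_of_nonneg (w ^ p⁻¹) _ hp0.le, ENNReal.rpow_inv_rpow hp0.ne',
      mul_assoc (2 ^ d) w, mul_assoc (2 ^ d) (ENNReal.ofReal δ),
      ENNReal.mul_rpow_of_nonneg (2 ^ d) _ hp0.le]
    calc (2 : ENNReal) ^ d * (w * (ENNReal.ofReal δ * X) ^ p)
        ≤ (2 ^ d : ENNReal) ^ p * (w * (ENNReal.ofReal δ * X) ^ p) := by gcongr
      _ = _ := by ring
  have hsub : AEStronglyMeasurable (Ff - Rr) ν := (hFc.sub hRc).aestronglyMeasurable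
  have t1 : eLpNorm' Ff p ν ≤ eLpNorm' Rr p ν + eLpNorm' (Ff - Rr) p ν := by
    have := eLpNorm'_add_le (μ := ν) (f := Rr) (g := Ff - Rr) hRc.aestronglyMeasurable hsub hp
    rwa [add_sub_cancel] at this
  have t2 : eLpNorm' Rr p νE ≤ eLpNorm' Ff p νE + eLpNorm' (Ff - Rr) p νE := by
    have := eLpNorm'_add_le (μ := νE) (f := Ff) (g := Rr - Ff) hFc.aestronglyMeasurable
      (hRc.sub hFc).aestronglyMeasurable hp
    rw [add_sub_cancel] at this
    have h2 : eLpNorm' (Rr - Ff) p νE = eLpNorm' (Ff - Rr) p νE := by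
      rw [← neg_sub, eLpNorm'_neg]
    rwa [h2] at this
  have t3 : eLpNorm' (Ff - Rr) p νE ≤ eLpNorm' (Ff - Rr) p ν :=
    eLpNorm'_mono_measure _ Measure.restrict_le_self hp0.le
  have hfin : w ^ (1 / p) * X ≤ w ^ (1 / p) *
      (Λ * eLpNorm' f p (volume.restrict (E ∩ unitCell d)) +
        (1 + Λ) * ENNReal.ofReal (2 ^ d * δ) * X) := by
    rw [← hn1]
    calc eLpNorm' Ff p ν ≤ Λ * (eLpNorm' Ff p νE + eLpNorm' (Ff - Rr) p ν) +
          eLpNorm' (Ff - Rr) p ν := by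
          refine t1.trans (add_le_add_left (hn3.trans ?_) _)
          gcongr
          exact t2.trans (by gcongr)
      _ ≤ Λ * (w ^ (1 / p) * eLpNorm' f p (volume.restrict (E ∩ unitCell d)) +
          w ^ (1 / p) * (ENNReal.ofReal (2 ^ d * δ) * X)) +
          w ^ (1 / p) * (ENNReal.ofReal (2 ^ d * δ) * X) := by
          rw [hn2]; gcongr
      _ = _ := by ring
  have hw1 : w ^ (1 / p) ≠ 0 := by
    rw [Ne, ENNReal.rpow_eq_zero_iff]
    simp [hw0, hwtop]
  have hw2 : w ^ (1 / p) ≠ ⊤ := ENNReal.rpow_ne_top_of_nonneg (by positivity) hwtop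
  exact (ENNReal.mul_le_mul_iff_right hw1 hw2).mp hfin

end LocalStep

section Constants

/-- The base of the local Turán estimate. -/
def turanBase (d : ℕ) (γ : ℝ) : ℝ := 4 * d * Real.exp 501 / γ

/-- The base of the global estimate. -/
def gridBase (d : ℕ) (γ : ℝ) : ℝ := Real.exp 520 ^ d / γ

variable {d : ℕ} {γ : ℝ}

theorem two_pow_le_gridBase (hγ : 0 < γ) (hγ1 : γ ≤ 1) : (2 : ℝ) ^ (520 * d) ≤ gridBase d γ := by
  unfold gridBase
  rw [le_div_iff₀ hγ]
  have h1 : (2 : ℝ) ^ (520 * d) ≤ Real.exp 520 ^ d := by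
    rw [pow_mul]
    gcongr
    have h2 : Real.exp 520 = Real.exp 1 ^ 520 := by rw [← Real.exp_nat_mul]; norm_num
    rw [h2]
    gcongr
    exact (by norm_num : (2 : ℝ) ≤ 2.7182818283).trans Real.exp_one_gt_d9.le
  nlinarith [pow_pos (two_pos : (0 : ℝ) < 2) (520 * d)]

theorem le_gridBase (hd : 0 < d) (hγ : 0 < γ) (hγ1 : γ ≤ 1) : 100 * (d : ℝ) ≤ gridBase d γ := by
  refine le_trans ?_ (two_pow_le_gridBase (d := d) hγ hγ1)
  have h1 : (d : ℝ) ≤ 2 ^ d := by exact_mod_cast Nat.lt_two_pow_self.le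
  calc 100 * (d : ℝ) ≤ 2 ^ 7 * 2 ^ d := by gcongr; norm_num
    _ = 2 ^ (7 + d) := by rw [pow_add]
    _ ≤ 2 ^ (520 * d) := by gcongr <;> [norm_num; omega]

theorem one_le_turanBase (hd : 0 < d) (hγ : 0 < γ) (hγ1 : γ ≤ 1) : 1 ≤ turanBase d γ := by
  unfold turanBase
  rw [le_div_iff₀ hγ]
  have h1 : (1 : ℝ) ≤ d := by exact_mod_cast hd
  have h2 : (1 : ℝ) ≤ Real.exp 501 := Real.one_le_exp (by norm_num)
  nlinarith

theorem turanBase_le (hd : 0 < d) (hγ : 0 < γ) :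
    turanBase d γ ≤ (1 / 2) ^ (16 * d) * gridBase d γ := by
  unfold turanBase gridBase
  rw [← mul_div_assoc]
  refine div_le_div_of_nonneg_right ?_ hγ.le
  have h1 : (d : ℝ) ≤ 2 ^ d := by exact_mod_cast Nat.lt_two_pow_self.le
  have h2 : Real.exp 501 * 2 ^ (19 * d) ≤ Real.exp 520 ^ d := by
    have h3 : (2 : ℝ) ^ (19 * d) ≤ Real.exp (19 * d) := by
      rw [show (19 * d : ℝ) = ((19 * d : ℕ) : ℝ) * 1 by push_cast; ring, Real.exp_nat_mul]
      gcongr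
      exact (by norm_num : (2 : ℝ) ≤ 2.7182818283).trans Real.exp_one_gt_d9.le
    calc Real.exp 501 * 2 ^ (19 * d) ≤ Real.exp 501 * Real.exp (19 * d) := by gcongr
      _ = Real.exp (501 + 19 * d) := by rw [Real.exp_add]
      _ ≤ Real.exp (d * 520) := by
        gcongr
        have : (1 : ℝ) ≤ d := by exact_mod_cast hd
        linarith
      _ = _ := by rw [Real.exp_nat_mul]
  have h4 : (4 : ℝ) ≤ 2 ^ (2 * d) := by
    calc (4 : ℝ) = 2 ^ 2 := by norm_num
      _ ≤ _ := by gcongr <;> [norm_num; omega]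
  calc 4 * d * Real.exp 501 ≤ 2 ^ (2 * d) * 2 ^ d * Real.exp 501 := by gcongr
    _ = (1 / 2) ^ (16 * d) * (Real.exp 501 * 2 ^ (19 * d)) := by
      rw [one_div, inv_pow, show 19 * d = 16 * d + (2 * d + d) by ring, pow_add, pow_add]
      field_simp
    _ ≤ _ := by gcongr

theorem turanBase_pow_le (hd : 0 < d) (hγ : 0 < γ) {n : ℕ} (hn : 0 < n) :
    3 ^ d * n * (200 * d) * turanBase d γ ^ n ≤ 1 / 40 * gridBase d γ ^ n := by
  have hG : 0 < gridBase d γ := by unfold gridBase; positivity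
  have hA : 0 ≤ turanBase d γ := by unfold turanBase; positivity
  have h1 : (d : ℝ) ≤ 2 ^ d := by exact_mod_cast Nat.lt_two_pow_self.le
  have h0 : ((1 / 2 : ℝ) ^ (16 * d)) ≤ 1 / 2 := by
    calc ((1 / 2 : ℝ) ^ (16 * d)) ≤ (1 / 2) ^ 1 :=
          pow_le_pow_of_le_one (by norm_num) (by norm_num) (by omega)
      _ = _ := pow_one _
  have h2 : (n : ℝ) * ((1 / 2 : ℝ) ^ (16 * d)) ^ n ≤ (1 / 2) ^ (16 * d) := by
    obtain ⟨k, rfl⟩ := Nat.exists_eq_succ_of_ne_zero hn.ne'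
    rw [Nat.succ_eq_add_one, pow_succ, ← mul_assoc]
    refine mul_le_of_le_one_left (by positivity) ?_
    have h3 : ((k + 1 : ℕ) : ℝ) ≤ 2 ^ k := by exact_mod_cast Nat.lt_two_pow_self
    calc ((k + 1 : ℕ) : ℝ) * ((1 / 2 : ℝ) ^ (16 * d)) ^ k ≤ 2 ^ k * (1 / 2) ^ k := by gcongr
      _ = 1 := by rw [← mul_pow]; norm_num
  calc 3 ^ d * n * (200 * d) * turanBase d γ ^ n
      ≤ 4 ^ d * n * (200 * 2 ^ d) * ((1 / 2) ^ (16 * d) * gridBase d γ) ^ n := by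
        gcongr
        · norm_num
        · exact turanBase_le hd hγ
    _ = 4 ^ d * 200 * 2 ^ d * (n * ((1 / 2) ^ (16 * d)) ^ n) * gridBase d γ ^ n := by
        rw [mul_pow]; ring
    _ ≤ 4 ^ d * 200 * 2 ^ d * (1 / 2) ^ (16 * d) * gridBase d γ ^ n := by gcongr
    _ = 200 * (1 / 2) ^ (13 * d) * gridBase d γ ^ n := by
        rw [show 16 * d = 13 * d + (2 * d + d) by ring, pow_add, pow_add, pow_mul _ 2 d,
          show (4 : ℝ) = 2 ^ 2 by norm_num]
        rw [one_div]
        simp only [inv_pow]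
        field_simp
    _ ≤ 200 * (1 / 2) ^ 13 * gridBase d γ ^ n := by
        gcongr 200 * ?_ * _
        exact pow_le_pow_of_le_one (by norm_num) (by norm_num) (by omega)
    _ ≤ _ := by
        gcongr
        norm_num

set_option maxHeartbeats 800000 in
/-- The number of Taylor coefficients can be chosen so that the error is absorbed. -/
theorem exists_taylor_order (hd : 0 < d) (hγ : 0 < γ) (hγ1 : γ ≤ 1) {n : ℕ} (hn : 0 < n) {t : ℝ}
    (ht : 0 ≤ t) {p : ℝ} (hp : 1 ≤ p) :
    ∃ m N : ℕ, n * m = N + 1 ∧ ∃ η : ℝ, 0 ≤ η ∧ η < 1 ∧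
      (1 + turanBase d γ ^ (N + 1 / p)) * (2 ^ d * (n * (3 / 2) ^ d *
        ((4 * Real.pi * d * t) ^ m / m.factorial * Real.exp (4 * Real.pi * d * t)))) ≤ η ∧
      turanBase d γ ^ (N + 1 / p) / (1 - η) ≤
        gridBase d γ ^ ((16 * gridBase d γ) ^ n * t + n - 1 + 1 / p) := by
  set A := turanBase d γ with hAdef
  set G := gridBase d γ with hGdef
  have hdr : (1 : ℝ) ≤ d := by exact_mod_cast hd
  have hA1 : 1 ≤ A := one_le_turanBase hd hγ hγ1
  have hA0 : 0 < A := by linarith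
  have hG100 : 100 * (d : ℝ) ≤ G := le_gridBase hd hγ hγ1
  have hG1 : 100 ≤ G := by linarith
  have hG0 : 0 < G := by linarith
  have hAG : A ≤ G := by
    refine (turanBase_le hd hγ).trans ?_
    exact mul_le_of_le_one_left hG0.le (pow_le_one₀ (by norm_num) (by norm_num))
  have hκ : 3 ^ d * n * (200 * d) * A ^ n ≤ 1 / 40 * G ^ n := turanBase_pow_le hd hγ hn
  have hGn : 0 < G ^ n := by positivity
  have hGn1 : G ≤ G ^ n := le_self_pow₀ (by linarith) hn.ne'
  have hp1 : 1 / p ≤ 1 := by rw [div_le_one (by linarith)]; exact hp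
  have hp0 : 0 < 1 / p := by positivity
  set u := G ^ n * t with hu
  have hu0 : 0 ≤ u := by positivity
  set v := 4 * Real.pi * d * t with hv
  have hv0 : 0 ≤ v := by positivity
  have hpi : Real.pi ≤ 3.15 := Real.pi_lt_d2.le
  have hexp1 : Real.exp 1 ≤ 2.72 := Real.exp_one_lt_d9.le.trans (by norm_num)
  have hGt : (16 * G) ^ n * t = 16 ^ n * u := by rw [hu, mul_pow]; ring
  have hvG : v * G ^ n ≤ 12.6 * d * u := by
    rw [hv, hu]
    have : 0 ≤ d * t * G ^ n := by positivity
    nlinarith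
  have h23 : (2 : ℝ) ^ d * (3 / 2) ^ d = 3 ^ d := by rw [← mul_pow]; norm_num
  have hmain : 200 * (3 ^ d * n * A ^ n) * v ≤ 12.6 / 40 * u := by
    refine le_of_mul_le_mul_right ?_ hGn
    calc 200 * (3 ^ d * n * A ^ n) * v * G ^ n = 200 * (3 ^ d * n * A ^ n) * (v * G ^ n) := by ring
      _ ≤ 200 * (3 ^ d * n * A ^ n) * (12.6 * d * u) := by gcongr
      _ = (3 ^ d * n * (200 * d) * A ^ n) * (12.6 * u) := by ring
      _ ≤ (1 / 40 * G ^ n) * (12.6 * u) := by gcongr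
      _ = _ := by ring
  have hn1 : (1 : ℝ) ≤ n := by exact_mod_cast hn
  clear_value A G u v
  have h16 : (8 * n + 2 : ℝ) ≤ 16 ^ n := by
    have h1 : ∀ k : ℕ, (8 * (k + 1) + 2 : ℝ) ≤ 16 ^ (k + 1) := by
      intro k
      induction k with
      | zero => norm_num
      | succ k ih => rw [pow_succ]; push_cast; nlinarith
    obtain ⟨k, rfl⟩ := Nat.exists_eq_succ_of_ne_zero hn.ne'
    have := h1 k
    push_cast
    exact this
  rcases le_or_gt u (1 / 2) with hcase | hcase
  · have hN : ((n - 1 : ℕ) : ℝ) = n - 1 := by rw [Nat.cast_sub hn]; simp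
    refine ⟨1, n - 1, by omega, u / 2, by positivity, by linarith, ?_, ?_⟩
    · have hΛ : A ^ (((n - 1 : ℕ) : ℝ) + 1 / p) ≤ A ^ n := by
        rw [← Real.rpow_natCast]
        refine Real.rpow_le_rpow_of_exponent_le hA1 ?_
        rw [hN]; linarith
      have hv1 : v ≤ 1 := by
        by_contra! h
        nlinarith
      have hev : Real.exp v ≤ 2.72 := (Real.exp_le_exp.mpr hv1).trans hexp1
      have hAn1 : (1 : ℝ) ≤ A ^ n := one_le_pow₀ hA1
      calc (1 + A ^ (((n - 1 : ℕ) : ℝ) + 1 / p)) * (2 ^ d * (n * (3 / 2) ^ d *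
            (v ^ 1 / (Nat.factorial 1 : ℕ) * Real.exp v)))
          ≤ (A ^ n + A ^ n) * (2 ^ d * (n * (3 / 2) ^ d * (v * 2.72))) := by
            gcongr
            · simp
        _ = 200 * (2 ^ d * (3 / 2) ^ d * n * A ^ n) * v * (5.44 / 200) := by ring
        _ ≤ 12.6 / 40 * u * (5.44 / 200) := by rw [h23]; gcongr
        _ ≤ u / 2 := by linarith
    · have h1 : 1 / (1 - u / 2) ≤ G ^ u := by
        calc 1 / (1 - u / 2) ≤ 1 + u := by
              rw [div_le_iff₀ (by linarith)]
              nlinarith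
          _ ≤ Real.exp u := by linarith [Real.add_one_le_exp u]
          _ = Real.exp 1 ^ u := by rw [← Real.exp_mul, one_mul]
          _ ≤ G ^ u := Real.rpow_le_rpow (Real.exp_pos _).le (by linarith) hu0
      rw [hN]
      calc A ^ ((n : ℝ) - 1 + 1 / p) / (1 - u / 2)
          = A ^ ((n : ℝ) - 1 + 1 / p) * (1 / (1 - u / 2)) := by ring
        _ ≤ G ^ ((n : ℝ) - 1 + 1 / p) * G ^ u := by
            gcongr
            exact one_div_nonneg.mpr (by linarith)
        _ = G ^ ((n : ℝ) - 1 + 1 / p + u) := (Real.rpow_add hG0 _ u).symm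
        _ ≤ G ^ ((16 * G) ^ n * t + n - 1 + 1 / p) := by
            have h2 : u ≤ 16 ^ n * u := le_mul_of_one_le_left hu0 (one_le_pow₀ (by norm_num))
            have hG1' : 1 ≤ G := by linarith
            refine Real.rpow_le_rpow_of_exponent_le hG1' ?_
            rw [hGt]
            linarith
  · set m := ⌈8 * u⌉₊ with hm
    have hm1 : 8 * u ≤ m := Nat.le_ceil _
    have hm2 : (m : ℝ) < 8 * u + 1 := Nat.ceil_lt_add_one (by linarith)
    have hm0 : 0 < m := Nat.ceil_pos.mpr (by linarith)
    have hnm : 0 < n * m := Nat.mul_pos hn hm0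
    have hN : ((n * m - 1 : ℕ) : ℝ) = n * m - 1 := by rw [Nat.cast_sub hnm]; simp
    have hmr : (0 : ℝ) < m := by exact_mod_cast hm0
    refine ⟨m, n * m - 1, by omega, 1 / 2, by norm_num, by norm_num, ?_, ?_⟩
    · have hΛ : A ^ (((n * m - 1 : ℕ) : ℝ) + 1 / p) ≤ A ^ (n * m) := by
        rw [← Real.rpow_natCast]
        refine Real.rpow_le_rpow_of_exponent_le hA1 ?_
        rw [hN]; push_cast; linarith
      have hAn1 : (1 : ℝ) ≤ A ^ (n * m) := one_le_pow₀ hA1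
      have hvm : v ≤ 1.6 * d / G ^ n * m := by
        rw [div_mul_eq_mul_div, le_div_iff₀ hGn]
        have h1 : (d : ℝ) * (8 * u) ≤ d * m := by gcongr
        have h2 : (0 : ℝ) ≤ d * m := by positivity
        linarith
      have hvm1 : v ≤ m := by
        refine hvm.trans (mul_le_of_le_one_left hmr.le ?_)
        rw [div_le_one hGn]
        linarith
      have hfact : v ^ m / m.factorial * Real.exp v ≤ (12 * d / G ^ n) ^ m := by
        calc v ^ m / m.factorial * Real.exp v
            ≤ (1.6 * d / G ^ n * m) ^ m / m.factorial * Real.exp m := by gcongr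
          _ = (1.6 * d / G ^ n) ^ m * ((m : ℝ) ^ m / m.factorial) * Real.exp m := by
              rw [mul_pow]; ring
          _ ≤ (1.6 * d / G ^ n) ^ m * Real.exp m * Real.exp m := by
              gcongr
              exact Real.pow_div_factorial_le_exp _ hmr.le _
          _ = (1.6 * d / G ^ n * Real.exp 1 * Real.exp 1) ^ m := by
              rw [mul_pow, mul_pow, ← Real.exp_nat_mul, mul_one]
          _ ≤ (12 * d / G ^ n) ^ m := by
              gcongr
              rw [div_mul_eq_mul_div, div_mul_eq_mul_div]
              refine div_le_div_of_nonneg_right ?_ hGn.le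
              rw [mul_assoc, mul_right_comm, mul_comm 12, mul_comm _ (d : ℝ)]
              refine mul_le_mul_of_nonneg_left ?_ (by positivity)
              have h2 : Real.exp 1 * Real.exp 1 ≤ 2.72 * 2.72 := by gcongr
              linarith
      have h3n : (1 : ℝ) ≤ 2 * 3 ^ d * n := by
        have : (1 : ℝ) ≤ 3 ^ d := one_le_pow₀ (by norm_num)
        nlinarith
      calc (1 + A ^ (((n * m - 1 : ℕ) : ℝ) + 1 / p)) * (2 ^ d * (n * (3 / 2) ^ d *
            (v ^ m / m.factorial * Real.exp v)))
          ≤ (A ^ (n * m) + A ^ (n * m)) * (2 ^ d * (n * (3 / 2) ^ d * (12 * d / G ^ n) ^ m)) := by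
            gcongr
        _ = 2 * (2 ^ d * (3 / 2) ^ d) * n * ((A ^ n) ^ m * (12 * d / G ^ n) ^ m) := by
            rw [pow_mul]; ring
        _ ≤ (2 * 3 ^ d * n) ^ m * ((A ^ n) ^ m * (12 * d / G ^ n) ^ m) := by
            rw [h23]
            gcongr
            exact le_self_pow₀ h3n hm0.ne'
        _ = (2 * 3 ^ d * n * (A ^ n * (12 * d / G ^ n))) ^ m := by
            rw [← mul_pow (A ^ n), ← mul_pow]
        _ ≤ (1 / 2) ^ m := by
            gcongr
            rw [← mul_div_assoc, ← mul_div_assoc, div_le_iff₀ hGn]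
            have h1 : 2 * 3 ^ d * (n : ℝ) * (A ^ n * (12 * d)) =
              24 / 200 * (3 ^ d * n * (200 * d) * A ^ n) := by ring
            linarith
        _ ≤ (1 / 2) ^ 1 := pow_le_pow_of_le_one (by norm_num) (by norm_num) hm0
        _ = 1 / 2 := pow_one _
    · rw [hN]
      calc A ^ ((n : ℝ) * m - 1 + 1 / p) / (1 - 1 / 2)
          = A ^ ((n : ℝ) * m - 1 + 1 / p) * 2 := by ring
        _ ≤ G ^ ((n : ℝ) * m - 1 + 1 / p) * G ^ (1 : ℝ) := by
            rw [Real.rpow_one]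
            gcongr
            · have : (1 : ℝ) ≤ (n : ℝ) * m := by exact_mod_cast hnm
              linarith
            · linarith
        _ = G ^ ((n : ℝ) * m - 1 + 1 / p + 1) := (Real.rpow_add hG0 _ 1).symm
        _ ≤ G ^ ((16 * G) ^ n * t + n - 1 + 1 / p) := by
            refine Real.rpow_le_rpow_of_exponent_le (by linarith) ?_
            rw [hGt]
            have h1 : (n : ℝ) * m ≤ n * (8 * u + 1) := by gcongr
            have h2 : (8 * n + 2 : ℝ) * u ≤ 16 ^ n * u := by gcongr
            linarith

end Constants

section Induction

variable {d : ℕ} {M : Fin d → ℕ} {E : Set (Fin d → ℝ)} {γ : ℝ}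

/-- The Logvinenko–Sereda inequality for frequencies in boxes with separated centers. -/
theorem eLpNorm'_le_of_separated (hd : 0 < d) (hM : ∀ j, 0 < M j)
    (hE : MeasurableSet E) (hγ : 0 < γ) (hγ1 : γ ≤ 1)
    (hthick : ∀ y ∈ unitCell d, ENNReal.ofReal γ * cellVolume M ≤ volume (E ∩ gridCell M y))
    {F s : Finset (Fin d → ℤ)} (hs : s.Nonempty) {t : ℝ} (ht : 0 ≤ t)
    (hcover : ∀ k ∈ F, ∃ k₀ ∈ s, ∀ j, |((k j - k₀ j : ℤ) : ℝ)| ≤ t * M j)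
    (hsep : ∀ k₀ ∈ s, ∀ k₁ ∈ s, k₀ ≠ k₁ → ∃ j, 4 * (t * M j) < |((k₀ j - k₁ j : ℤ) : ℝ)|)
    (c : (Fin d → ℤ) → ℂ) {p : ℝ} (hp : 1 ≤ p) :
    eLpNorm' (trigPoly F c) p (volume.restrict (unitCell d)) ≤
      ENNReal.ofReal (gridBase d γ ^ ((16 * gridBase d γ) ^ s.card * t + s.card - 1 + 1 / p)) *
        eLpNorm' (trigPoly F c) p (volume.restrict (E ∩ unitCell d)) := by
  obtain ⟨m, N, hmN, η, hη0, hη1, hη, hfin⟩ :=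
    exists_taylor_order hd hγ hγ1 (Finset.card_pos.mpr hs) ht hp
  set R : Fin d → ℕ := fun j => ⌊t * M j⌋₊ with hR
  have hRle : ∀ j, (R j : ℝ) ≤ t * M j := fun j => Nat.floor_le (by positivity)
  have hsR : IsSeparatedCover F s R := by
    refine ⟨fun k hk => ?_, fun k₀ hk₀ k₁ hk₁ hne => ?_⟩
    · obtain ⟨k₀, hk₀, h⟩ := hcover k hk
      refine ⟨k₀, hk₀, fun j => ?_⟩
      have h1 := h j
      rw [← Int.cast_abs, Int.abs_eq_natAbs, Int.cast_natCast] at h1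
      rw [Int.abs_eq_natAbs]
      exact_mod_cast Nat.le_floor h1
    · obtain ⟨j, hj⟩ := hsep k₀ hk₀ k₁ hk₁ hne
      refine ⟨j, ?_⟩
      have h1 : 4 * (R j : ℝ) < |((k₀ j - k₁ j : ℤ) : ℝ)| :=
        lt_of_le_of_lt (by linarith [hRle j]) hj
      exact_mod_cast h1
  have hv : 4 * Real.pi * ∑ j, (M j : ℝ)⁻¹ * R j ≤ 4 * Real.pi * d * t := by
    have h1 : ∑ j, (M j : ℝ)⁻¹ * R j ≤ ∑ _j : Fin d, t := by
      refine Finset.sum_le_sum fun j _ => ?_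
      have hMj : (0 : ℝ) < M j := by exact_mod_cast hM j
      rw [inv_mul_le_iff₀ hMj, mul_comm]
      exact hRle j
    rw [Finset.sum_const, Finset.card_fin, nsmul_eq_mul] at h1
    calc _ ≤ 4 * Real.pi * (d * t) := by gcongr
      _ = _ := by ring
  have h1 := eLpNorm'_le_add_of_grid hd hM hE hγ hthick hsR hmN hv c hp
  have hXtop := eLpNorm'_trigPoly_ne_top F c hp
  have hAdef : 4 * d * Real.exp 501 / γ = turanBase d γ := rfl
  rw [hAdef] at h1
  set A := turanBase d γ with hA
  set X := eLpNorm' (trigPoly F c) p (volume.restrict (unitCell d)) with hX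
  set Y := eLpNorm' (trigPoly F c) p (volume.restrict (E ∩ unitCell d)) with hY
  have hA0 : 0 < A := lt_of_lt_of_le one_pos (one_le_turanBase hd hγ hγ1)
  have hYX : Y ≤ X := by
    refine eLpNorm'_mono_measure _ (Measure.restrict_mono Set.inter_subset_right le_rfl) ?_
    linarith
  have hYtop : Y ≠ ⊤ := ne_top_of_le_ne_top hXtop hYX
  have h2 : X ≤ ENNReal.ofReal (A ^ (N + 1 / p)) * Y + ENNReal.ofReal η * X := by
    refine h1.trans ?_
    gcongr
    rw [show (1 : ENNReal) = ENNReal.ofReal 1 by simp, ← ENNReal.ofReal_add zero_le_one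
      (by positivity), ← ENNReal.ofReal_mul (by positivity)]
    exact ENNReal.ofReal_le_ofReal hη
  rw [← ENNReal.ofReal_toReal hXtop, ← ENNReal.ofReal_toReal hYtop,
    ← ENNReal.ofReal_mul (by positivity), ← ENNReal.ofReal_mul hη0,
    ← ENNReal.ofReal_add (by positivity) (by positivity),
    ENNReal.ofReal_le_ofReal_iff (by positivity)] at h2
  rw [← ENNReal.ofReal_toReal hXtop, ← ENNReal.ofReal_toReal hYtop]
  have hG0 : 0 ≤ gridBase d γ := by unfold gridBase; positivity
  rw [← ENNReal.ofReal_mul (by positivity)]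
  apply ENNReal.ofReal_le_ofReal
  calc X.toReal ≤ A ^ (N + 1 / p) / (1 - η) * Y.toReal := by
        rw [div_mul_eq_mul_div, le_div_iff₀ (by linarith)]
        linarith
    _ ≤ _ := by gcongr

/-- The Logvinenko–Sereda inequality for frequencies in boxes with arbitrary centers: boxes with
close centers are merged. -/
theorem eLpNorm'_le_of_cover (hd : 0 < d) (hM : ∀ j, 0 < M j)
    (hE : MeasurableSet E) (hγ : 0 < γ) (hγ1 : γ ≤ 1)
    (hthick : ∀ y ∈ unitCell d, ENNReal.ofReal γ * cellVolume M ≤ volume (E ∩ gridCell M y))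
    {F : Finset (Fin d → ℤ)} (c : (Fin d → ℤ) → ℂ) {p : ℝ} (hp : 1 ≤ p) :
    ∀ (n : ℕ) {s : Finset (Fin d → ℤ)} (_ : s.card = n + 1) {t : ℝ} (_ : 0 ≤ t)
    (_ : ∀ k ∈ F, ∃ k₀ ∈ s, ∀ j, |((k j - k₀ j : ℤ) : ℝ)| ≤ t * M j),
    eLpNorm' (trigPoly F c) p (volume.restrict (unitCell d)) ≤
      ENNReal.ofReal (gridBase d γ ^ ((16 * gridBase d γ) ^ s.card * t + s.card - 1 + 1 / p)) *
        eLpNorm' (trigPoly F c) p (volume.restrict (E ∩ unitCell d)) := by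
  intro n
  induction n with
  | zero =>
    intro s hs t ht hcover
    refine eLpNorm'_le_of_separated hd hM hE hγ hγ1 hthick (Finset.card_pos.mp (by omega)) ht
      hcover (fun k₀ hk₀ k₁ hk₁ hne => ?_) c hp
    exact absurd (Finset.card_le_one.mp (by omega) k₀ hk₀ k₁ hk₁) hne
  | succ n ih =>
    intro s hs t ht hcover
    by_cases hsep : ∀ k₀ ∈ s, ∀ k₁ ∈ s, k₀ ≠ k₁ → ∃ j, 4 * (t * M j) < |((k₀ j - k₁ j : ℤ) : ℝ)|
    · exact eLpNorm'_le_of_separated hd hM hE hγ hγ1 hthick (Finset.card_pos.mp (by omega)) ht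
        hcover hsep c hp
    push Not at hsep
    obtain ⟨k₀, hk₀, k₁, hk₁, hne, hclose⟩ := hsep
    have hcard : (s.erase k₁).card = n + 1 := by rw [Finset.card_erase_of_mem hk₁]; omega
    have h1 := ih hcard (t := 5 * t) (by positivity) (fun k hk => ?_)
    · refine h1.trans ?_
      have hG : 100 ≤ gridBase d γ := by
        have h2 := le_gridBase hd hγ hγ1
        have h3 : (1 : ℝ) ≤ d := by exact_mod_cast hd
        linarith
      gcongr ENNReal.ofReal ?_ * _
      refine Real.rpow_le_rpow_of_exponent_le (by linarith) ?_
      rw [hcard, hs, pow_succ _ (n + 1)]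
      have h4 : 0 ≤ (16 * gridBase d γ) ^ (n + 1) * t := by positivity
      push_cast
      nlinarith
    · obtain ⟨k₂, hk₂, h⟩ := hcover k hk
      by_cases h21 : k₂ = k₁
      · refine ⟨k₀, Finset.mem_erase.mpr ⟨hne, hk₀⟩, fun j => ?_⟩
        subst h21
        have e : ((k j - k₀ j : ℤ) : ℝ) = ((k j - k₂ j : ℤ) : ℝ) - ((k₀ j - k₂ j : ℤ) : ℝ) := by
          push_cast; ring
        rw [e]
        refine (abs_sub _ _).trans ?_
        linarith [h j, hclose j]
      · refine ⟨k₂, Finset.mem_erase.mpr ⟨h21, hk₂⟩, fun j => (h j).trans ?_⟩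
        have : 0 ≤ t * M j := by positivity
        linarith

end Induction

section LpLimit

theorem eLpNorm_top_le_of_tendsto {α : Type*} [MeasurableSpace α] {μ : Measure α}
    [IsFiniteMeasure μ] {f : α → ℂ} (hf : AEStronglyMeasurable f μ) {K : ℝ → ENNReal} {B : ENNReal}
    (hK : ∀ q : ℝ, 1 ≤ q → eLpNorm f (ENNReal.ofReal q) μ ≤ K q)
    (hlim : Filter.Tendsto K Filter.atTop (nhds B)) : eLpNorm f ⊤ μ ≤ B := by
  rw [eLpNorm_exponent_top]
  refine le_of_forall_lt fun ε hε => ?_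
  obtain ⟨ε', hεε', hε'⟩ := exists_between hε
  refine lt_of_lt_of_le hεε' ?_
  set s := {x | ε' ≤ ‖f x‖ₑ} with hs
  have hs0 : μ s ≠ 0 := by
    intro h0
    refine absurd (eLpNormEssSup_le_of_ae_enorm_bound (C := ε') ?_) (not_le.mpr hε')
    have h1 : ∀ᵐ x ∂μ, x ∉ s := measure_eq_zero_iff_ae_notMem.mp h0
    filter_upwards [h1] with x hx
    exact (not_le.mp hx).le
  have hε'top : ε' ≠ ⊤ := ne_top_of_lt hε'
  have hle : ∀ᶠ q : ℝ in Filter.atTop, ε' * μ s ^ q⁻¹ ≤ K q := by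
    filter_upwards [Filter.eventually_ge_atTop 1] with q hq
    refine le_trans ?_ (hK q hq)
    have hq0 : 0 < q := by linarith
    have h1 := mul_meas_ge_le_pow_eLpNorm' μ (p := ENNReal.ofReal q) (by simpa using hq0)
      ENNReal.ofReal_ne_top hf ε'
    rw [ENNReal.toReal_ofReal hq0.le] at h1
    rw [← ENNReal.rpow_le_rpow_iff hq0, ENNReal.mul_rpow_of_nonneg _ _ hq0.le,
      ENNReal.rpow_inv_rpow hq0.ne']
    exact h1
  have hlim2 : Filter.Tendsto (fun q : ℝ => ε' * μ s ^ q⁻¹) Filter.atTop (nhds (ε' * 1)) := by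
    refine ENNReal.Tendsto.const_mul ?_ (Or.inr hε'top)
    have hr : 0 < (μ s).toReal := ENNReal.toReal_pos hs0 (measure_ne_top μ s)
    have h1 : Filter.Tendsto (fun x : ℝ => μ s ^ x) (nhds 0) (nhds (μ s ^ (0 : ℝ))) := by
      rw [← ENNReal.ofReal_toReal (measure_ne_top μ s)]
      simp_rw [ENNReal.ofReal_rpow_of_pos hr]
      exact (ENNReal.continuous_ofReal.comp (Real.continuous_const_rpow hr.ne')).tendsto 0
    rw [ENNReal.rpow_zero] at h1
    exact h1.comp tendsto_inv_atTop_zero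
  rw [mul_one] at hlim2
  exact le_of_tendsto_of_tendsto hlim2 hlim hle

variable {d : ℕ} {M : Fin d → ℕ} {E : Set (Fin d → ℝ)} {γ : ℝ}

theorem eLpNorm_trigPoly_le_of_cover (hd : 0 < d) (hM : ∀ j, 0 < M j)
    (hE : MeasurableSet E) (hγ : 0 < γ) (hγ1 : γ ≤ 1)
    (hthick : ∀ y ∈ unitCell d, ENNReal.ofReal γ * cellVolume M ≤ volume (E ∩ gridCell M y))
    {F s : Finset (Fin d → ℤ)} (hs : s.Nonempty) {t : ℝ} (ht : 0 ≤ t)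
    (hcover : ∀ k ∈ F, ∃ k₀ ∈ s, ∀ j, |((k j - k₀ j : ℤ) : ℝ)| ≤ t * M j)
    (c : (Fin d → ℤ) → ℂ) {p : ENNReal} (hp : 1 ≤ p) :
    eLpNorm (trigPoly F c) p (volume.restrict (unitCell d)) ≤
      ENNReal.ofReal (gridBase d γ ^
        ((16 * gridBase d γ) ^ s.card * t + s.card - 1 + (p⁻¹).toReal)) *
        eLpNorm (trigPoly F c) p (volume.restrict (E ∩ unitCell d)) := by
  have hreal : ∀ q : ℝ, 1 ≤ q →
      eLpNorm (trigPoly F c) (ENNReal.ofReal q) (volume.restrict (unitCell d)) ≤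
      ENNReal.ofReal (gridBase d γ ^ ((16 * gridBase d γ) ^ s.card * t + s.card - 1 + 1 / q)) *
        eLpNorm (trigPoly F c) (ENNReal.ofReal q) (volume.restrict (E ∩ unitCell d)) := by
    intro q hq
    have hq0 : ENNReal.ofReal q ≠ 0 := by simp; linarith
    rw [eLpNorm_eq_eLpNorm' hq0 ENNReal.ofReal_ne_top, eLpNorm_eq_eLpNorm' hq0
      ENNReal.ofReal_ne_top, ENNReal.toReal_ofReal (by linarith)]
    exact eLpNorm'_le_of_cover hd hM hE hγ hγ1 hthick c hq (s.card - 1)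
      (by have := Finset.card_pos.mpr hs; omega) ht hcover
  have hG : 0 < gridBase d γ := by unfold gridBase; positivity
  rcases eq_or_ne p ⊤ with rfl | hptop
  · set Z := eLpNorm (trigPoly F c) ⊤ (volume.restrict (E ∩ unitCell d)) with hZ
    have hvol : volume (E ∩ unitCell d) ≤ 1 := by
      rw [← volume_unitCell (d := d)]
      exact measure_mono Set.inter_subset_right
    have hZtop : Z ≠ ⊤ := by
      refine ne_top_of_le_ne_top (b := ENNReal.ofReal (∑ k ∈ F, ‖c k‖)) ENNReal.ofReal_ne_top ?_
      rw [hZ, eLpNorm_exponent_top]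
      refine eLpNormEssSup_le_of_ae_bound ?_
      exact Filter.Eventually.of_forall fun x => norm_trigPoly_le F c x
    refine eLpNorm_top_le_of_tendsto (aestronglyMeasurable_trigPoly F c _) (K := fun q =>
      ENNReal.ofReal (gridBase d γ ^ ((16 * gridBase d γ) ^ s.card * t + s.card - 1 + 1 / q)) * Z)
      (fun q hq => (hreal q hq).trans ?_) ?_
    · gcongr
      refine (eLpNorm_le_eLpNorm_mul_rpow_measure_univ (le_top : ENNReal.ofReal q ≤ ⊤)
        (aestronglyMeasurable_trigPoly F c _)).trans ?_
      refine mul_le_of_le_one_right zero_le ?_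
      rw [Measure.restrict_apply_univ, ENNReal.toReal_ofReal (by linarith)]
      refine ENNReal.rpow_le_one hvol ?_
      simp; linarith
    · refine ENNReal.Tendsto.mul_const ?_ (Or.inr hZtop)
      refine (ENNReal.continuous_ofReal.tendsto _).comp ?_
      have h1 : Filter.Tendsto (fun q : ℝ => (16 * gridBase d γ) ^ s.card * t + s.card - 1 + 1 / q)
          Filter.atTop (nhds ((16 * gridBase d γ) ^ s.card * t + s.card - 1 +
            ((⊤ : ENNReal)⁻¹).toReal)) := by
        simp only [ENNReal.inv_top, ENNReal.toReal_zero, one_div]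
        exact tendsto_const_nhds.add tendsto_inv_atTop_zero
      exact (Real.continuous_const_rpow hG.ne').tendsto _ |>.comp h1
  · have h1 := hreal p.toReal (by
      rw [← ENNReal.toReal_one]; exact ENNReal.toReal_mono hptop hp)
    rwa [ENNReal.ofReal_toReal hptop, one_div, ← ENNReal.toReal_inv] at h1

end LpLimit

section Uniqueness

variable {d : ℕ}

theorem integral_mul_eq_zero_of_mFourier {μ : Measure (UnitAddTorus (Fin d))}
    {g : UnitAddTorus (Fin d) → ℂ} (hg : Integrable g μ)
    (h0 : ∀ k, ∫ z, g z * UnitAddTorus.mFourier k z ∂μ = 0) (φ : C(UnitAddTorus (Fin d), ℂ)) :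
    ∫ z, g z * φ z ∂μ = 0 := by
  have hint : ∀ φ : C(UnitAddTorus (Fin d), ℂ), Integrable (fun z => g z * φ z) μ := fun φ =>
    hg.mul_bdd (c := ‖φ‖) φ.continuous.aestronglyMeasurable
      (Filter.Eventually.of_forall fun z => φ.norm_coe_le_norm z)
  let T : C(UnitAddTorus (Fin d), ℂ) →ₗ[ℂ] ℂ :=
    { toFun := fun φ => ∫ z, g z * φ z ∂μ
      map_add' := fun φ ψ => by
        rw [← integral_add (hint φ) (hint ψ)]
        simp only [ContinuousMap.add_apply, mul_add]
      map_smul' := fun a φ => by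
        rw [RingHom.id_apply, smul_eq_mul, ← integral_const_mul]
        simp only [ContinuousMap.smul_apply, smul_eq_mul, mul_left_comm] }
  let T' := T.mkContinuous (∫ z, ‖g z‖ ∂μ) fun φ => by
    calc ‖∫ z, g z * φ z ∂μ‖ ≤ ∫ z, ‖g z‖ * ‖φ‖ ∂μ := by
          refine norm_integral_le_of_norm_le (hg.norm.mul_const _) ?_
          refine Filter.Eventually.of_forall fun z => ?_
          rw [norm_mul]
          gcongr
          exact φ.norm_coe_le_norm z
      _ = _ := integral_mul_const _ _
  have hspan : Submodule.span ℂ (Set.range (UnitAddTorus.mFourier (d := Fin d))) ≤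
      LinearMap.ker T'.toLinearMap := by
    rw [Submodule.span_le]
    rintro _ ⟨k, rfl⟩
    exact h0 k
  have htop := Submodule.topologicalClosure_minimal _ hspan T'.isClosed_ker
  rw [UnitAddTorus.span_mFourier_closure_eq_top] at htop
  exact htop (Submodule.mem_top (x := φ))

theorem ae_eq_zero_of_integral_mul_continuousMap {X : Type*} [PseudoEMetricSpace X]
    [MeasurableSpace X] [BorelSpace X] {μ : Measure X} {g : X → ℂ} (hg : Integrable g μ)
    (h0 : ∀ φ : C(X, ℂ), ∫ z, g z * φ z ∂μ = 0) : g =ᵐ[μ] 0 := by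
  refine ae_eq_zero_of_forall_setIntegral_isClosed_eq_zero hg fun s hs => ?_
  have hδ : ∀ n : ℕ, (0 : ℝ) < 1 / (n + 1) := fun n => Nat.one_div_pos_of_nat
  have h1 := thickenedIndicator_tendsto_indicator_closure hδ tendsto_one_div_add_atTop_nhds_zero_nat s
  rw [hs.closure_eq, tendsto_pi_nhds] at h1
  have h2 : Filter.Tendsto (fun n : ℕ => ∫ z, g z * ((thickenedIndicator (hδ n) s z : ℝ) : ℂ) ∂μ)
      Filter.atTop (nhds (∫ z, s.indicator g z ∂μ)) := by
    refine tendsto_integral_of_dominated_convergence (fun z => ‖g z‖) (fun n => ?_) hg.norm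
      (fun n => ?_) ?_
    · refine hg.aestronglyMeasurable.mul ?_
      exact (Complex.continuous_ofReal.comp (NNReal.continuous_coe.comp
        (thickenedIndicator (hδ n) s).continuous)).aestronglyMeasurable
    · refine Filter.Eventually.of_forall fun z => ?_
      rw [norm_mul, Complex.norm_real, NNReal.norm_eq]
      refine mul_le_of_le_one_right (norm_nonneg _) ?_
      exact_mod_cast thickenedIndicator_le_one (hδ n) s z
    · refine Filter.Eventually.of_forall fun z => ?_
      have h3 : s.indicator g z = g z * (((s.indicator (fun _ => (1 : NNReal)) z : NNReal) : ℝ) : ℂ) := by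
        by_cases hz : z ∈ s <;> simp [hz]
      rw [h3]
      exact ((Complex.continuous_ofReal.comp NNReal.continuous_coe).tendsto _ |>.comp (h1 z)).const_mul _
  have h3 : ∀ n : ℕ, ∫ z, g z * ((thickenedIndicator (hδ n) s z : ℝ) : ℂ) ∂μ = 0 := fun n =>
    h0 ⟨fun z => ((thickenedIndicator (hδ n) s z : ℝ) : ℂ), Complex.continuous_ofReal.comp
      (NNReal.continuous_coe.comp (thickenedIndicator (hδ n) s).continuous)⟩
  simp_rw [h3] at h2
  rw [← integral_indicator hs.measurableSet]
  exact tendsto_nhds_unique h2 tendsto_const_nhds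

theorem ae_eq_zero_of_fourier_eq_zero {h : (Fin d → ℝ) → ℂ}
    (hh : Integrable h (volume.restrict (unitCell d)))
    (h0 : ∀ k, ∫ x in unitCell d, h x * wave k x = 0) :
    h =ᵐ[volume.restrict (unitCell d)] 0 := by
  set μ : Measure (UnitAddTorus (Fin d)) := Measure.pi fun _ => AddCircle.haarAddCircle with hμ
  have hcell : {x : Fin d → ℝ | ∀ i, x i ∈ Set.Ioc ((0 : Fin d → ℝ) i) ((0 : Fin d → ℝ) i + 1)} =
      unitCell d := by simp [unitCell]
  have hlint : ∀ f : UnitAddTorus (Fin d) → ENNReal,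
      ∫⁻ z, f z ∂μ = ∫⁻ x in unitCell d, f fun i => (x i : UnitAddCircle) := by
    intro f
    rw [← hcell]
    exact UnitAddTorus.lintegral_preimage f 0
  have hintg : ∀ f : UnitAddTorus (Fin d) → ℂ,
      ∫ z, f z ∂μ = ∫ x in unitCell d, f fun i => (x i : UnitAddCircle) := by
    intro f
    rw [← hcell]
    exact UnitAddTorus.integral_preimage f 0
  obtain ⟨h', hh'm, hh'⟩ := hh.aestronglyMeasurable
  set ρ : UnitAddTorus (Fin d) → Fin d → ℝ := fun z i => (AddCircle.equivIoc 1 0 (z i)).1 with hρ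
  have hρm : Measurable ρ := by
    refine measurable_pi_lambda _ fun i => ?_
    exact measurable_subtype_coe.comp
      ((AddCircle.measurableEquivIoc 1 0).measurable.comp (measurable_pi_apply i))
  have hρx : ∀ x ∈ unitCell d, ρ (fun i => (x i : UnitAddCircle)) = x := by
    intro x hx
    ext i
    exact AddCircle.equivIoc_coe_of_mem (by simpa using hx i)
  set g : UnitAddTorus (Fin d) → ℂ := h' ∘ ρ with hg
  have hgx : ∀ x ∈ unitCell d, g (fun i => (x i : UnitAddCircle)) = h' x := fun x hx => by
    rw [hg, Function.comp_apply, hρx x hx]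
  have hgm : StronglyMeasurable g := hh'm.comp_measurable hρm
  have hgi : Integrable g μ := by
    refine ⟨hgm.aestronglyMeasurable, ?_⟩
    rw [HasFiniteIntegral, hlint]
    refine lt_of_eq_of_lt ?_ (hh.congr hh').2
    exact setLIntegral_congr_fun measurableSet_unitCell fun x hx => by simp only [hgx x hx]
  have hg0 : g =ᵐ[μ] 0 := by
    refine ae_eq_zero_of_integral_mul_continuousMap hgi
      (integral_mul_eq_zero_of_mFourier hgi fun k => ?_)
    rw [hintg, ← h0 k]
    have h1 : ∀ᵐ x ∂(volume.restrict (unitCell d)), x ∈ unitCell d :=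
      ae_restrict_mem measurableSet_unitCell
    refine integral_congr_ae ?_
    filter_upwards [h1, hh'] with x hx hxh
    rw [hgx x hx, mFourier_coe, hxh]
  have hz : ∫⁻ z, ‖g z‖ₑ ∂μ = 0 := by
    rw [lintegral_eq_zero_iff hgm.measurable.enorm]
    filter_upwards [hg0] with z hz
    simp [hz]
  rw [hlint, setLIntegral_congr_fun measurableSet_unitCell (g := fun x => ‖h' x‖ₑ)
    (fun x hx => by simp only [hgx x hx]), lintegral_eq_zero_iff hh'm.measurable.enorm] at hz
  filter_upwards [hz, hh'] with x hx hxh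
  rw [hxh]
  simpa using hx

end Uniqueness

section Scaling

variable {d : ℕ}

theorem restrict_eq_smul_map {T : ℝ} (hT : 0 < T) (A : Set (Fin d → ℝ)) :
    (volume : Measure (Fin d → ℝ)).restrict A = ENNReal.ofReal (T ^ d) •
      ((volume.restrict ((fun u => T • u) ⁻¹' A)).map fun u : Fin d → ℝ => T • u) := by
  have he : MeasurableEmbedding fun u : Fin d → ℝ => T • u :=
    measurableEmbedding_const_smul₀ hT.ne'
  rw [← he.restrict_map, Measure.map_addHaar_smul _ hT.ne', Module.finrank_fin_fun,
    Measure.restrict_smul, smul_smul, ← ENNReal.ofReal_mul (by positivity),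
    abs_of_pos (by positivity), mul_inv_cancel₀ (by positivity), ENNReal.ofReal_one, one_smul]

theorem eLpNorm_restrict_eq_smul {T : ℝ} (hT : 0 < T) (A : Set (Fin d → ℝ)) (f : (Fin d → ℝ) → ℂ)
    (p : ENNReal) :
    eLpNorm f p (volume.restrict A) = ENNReal.ofReal (T ^ d) ^ (1 / p).toReal *
      eLpNorm (fun u => f (T • u)) p (volume.restrict ((fun u => T • u) ⁻¹' A)) := by
  have he : MeasurableEmbedding fun u : Fin d → ℝ => T • u :=
    measurableEmbedding_const_smul₀ hT.ne'
  rw [restrict_eq_smul_map hT A, eLpNorm_smul_measure_of_ne_zero (by simpa using pow_pos hT d),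
    he.eLpNorm_map_measure, smul_eq_mul]
  rfl

theorem integral_restrict_eq_smul {T : ℝ} (hT : 0 < T) (A : Set (Fin d → ℝ))
    (f : (Fin d → ℝ) → ℂ) :
    ∫ x in A, f x = (T ^ d : ℝ) • ∫ u in (fun u => T • u) ⁻¹' A, f (T • u) := by
  have he : MeasurableEmbedding fun u : Fin d → ℝ => T • u :=
    measurableEmbedding_const_smul₀ hT.ne'
  rw [restrict_eq_smul_map hT A, integral_smul_measure, he.integral_map,
    ENNReal.toReal_ofReal (by positivity)]

theorem preimage_torus_ae_eq {L : ℝ} (hL : 0 < L) :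
    ((fun u : Fin d → ℝ => (2 * Real.pi * L) • u) ⁻¹' torus d L) =ᵐ[volume] unitCell d := by
  have hT : 0 < 2 * Real.pi * L := by positivity
  have h1 : ((fun u : Fin d → ℝ => (2 * Real.pi * L) • u) ⁻¹' torus d L) =
      Set.Icc (fun _ => 0) fun _ => 1 := by
    ext u
    simp only [torus, Set.mem_preimage, Set.mem_ofPred_eq, Pi.smul_apply, smul_eq_mul, Set.mem_Icc,
      Pi.le_def, ← forall_and]
    refine forall_congr' fun j => ?_
    rw [mul_nonneg_iff_of_pos_left hT, mul_le_iff_le_one_right hT]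
  rw [h1, unitCell_eq_pi]
  exact (Measure.univ_pi_Ioc_ae_eq_Icc (μ := fun _ : Fin d => (volume : Measure ℝ))).symm

end Scaling

section FourierSeries

variable {d : ℕ}

theorem integral_unitCell_wave (k : Fin d → ℤ) :
    ∫ x in unitCell d, wave k x = if k = 0 then 1 else 0 := by
  split_ifs with hk
  · subst hk
    have : ∀ x : Fin d → ℝ, wave 0 x = 1 := fun x => by simp [wave]
    simp only [this]
    rw [setIntegral_const, measureReal_def, volume_unitCell]
    simp
  · obtain ⟨j, hj⟩ := Function.ne_iff.mp hk
    have hj' : (k j : ℝ) ≠ 0 := by exact_mod_cast hj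
    set a : Fin d → ℝ := Pi.single j (1 / (2 * k j)) with ha
    have hwa : wave k a = -1 := by
      unfold wave
      rw [Finset.sum_eq_single j]
      · rw [ha, Pi.single_eq_same, ← Complex.exp_pi_mul_I]
        congr 1
        have hjc : (k j : ℂ) ≠ 0 := by exact_mod_cast hj
        push_cast
        field_simp
      · intro i _ hi; simp [ha, Pi.single_eq_of_ne hi]
      · intro h; exact absurd (Finset.mem_univ j) h
    have h1 := (UnitAddTorus.integral_preimage (UnitAddTorus.mFourier k) a).symm.trans
      (UnitAddTorus.integral_preimage (UnitAddTorus.mFourier k) 0)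
    have h2 : {x : Fin d → ℝ | ∀ i, x i ∈ Set.Ioc ((0 : Fin d → ℝ) i) ((0 : Fin d → ℝ) i + 1)} =
      unitCell d := by simp [unitCell]
    have h3 : unitCell d = (fun x => x + a) ⁻¹' {x | ∀ i, x i ∈ Set.Ioc (a i) (a i + 1)} := by
      ext x
      simp only [unitCell, Set.mem_ofPred_eq, Set.mem_preimage, Set.mem_Ioc, Pi.add_apply]
      refine forall_congr' fun i => ?_
      constructor <;> rintro ⟨h1, h2⟩ <;> constructor <;> linarith
    simp only [mFourier_coe, h2] at h1
    rw [← (measurePreserving_add_right volume a).setIntegral_preimage_emb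
      (measurableEmbedding_addRight a), ← h3] at h1
    simp only [wave_add, hwa] at h1
    rw [integral_mul_const] at h1
    set I := ∫ x in unitCell d, wave k x
    linear_combination -(1 / 2 : ℂ) * h1

theorem integrable_trigPoly (F : Finset (Fin d → ℤ)) (c : (Fin d → ℤ) → ℂ) :
    Integrable (trigPoly F c) (volume.restrict (unitCell d)) :=
  Integrable.of_bound (aestronglyMeasurable_trigPoly F c _) (∑ k ∈ F, ‖c k‖)
    (Filter.Eventually.of_forall fun x => norm_trigPoly_le F c x)

theorem wave_mul_wave (k k' : Fin d → ℤ) (x : Fin d → ℝ) :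
    wave k x * wave k' x = wave (k + k') x := by
  unfold wave
  rw [← Complex.exp_add, ← mul_add, ← Finset.sum_add_distrib]
  congr 2
  refine Finset.sum_congr rfl fun j _ => ?_
  rw [Pi.add_apply]; push_cast; ring

/-- An integrable function with finitely many nonzero Fourier coefficients is a trigonometric
polynomial. -/
theorem ae_eq_trigPoly {g : (Fin d → ℝ) → ℂ} (hg : Integrable g (volume.restrict (unitCell d)))
    {F : Finset (Fin d → ℤ)} {c : (Fin d → ℤ) → ℂ}
    (hc : ∀ k, c k = ∫ x in unitCell d, g x * wave (-k) x) (hF : ∀ k, c k ≠ 0 → k ∈ F) :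
    g =ᵐ[volume.restrict (unitCell d)] trigPoly F c := by
  have hbdd : ∀ {h : (Fin d → ℝ) → ℂ} (k : Fin d → ℤ),
      Integrable h (volume.restrict (unitCell d)) →
      Integrable (fun x => h x * wave k x) (volume.restrict (unitCell d)) := fun k hh =>
    hh.mul_bdd (c := 1) (continuous_wave k).aestronglyMeasurable
      (Filter.Eventually.of_forall fun x => (norm_wave k x).le)
  have h1 := ae_eq_zero_of_fourier_eq_zero (h := g - trigPoly F c)
    (hg.sub (integrable_trigPoly F c)) fun k => ?_
  · filter_upwards [h1] with x hx
    exact sub_eq_zero.mp hx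
  · simp only [Pi.sub_apply, sub_mul]
    rw [integral_sub (hbdd k hg) (hbdd k (integrable_trigPoly F c))]
    have h2 := hc (-k)
    rw [neg_neg] at h2
    rw [← h2]
    simp only [trigPoly, Finset.sum_mul, mul_assoc, wave_mul_wave]
    have hint : ∀ k' : Fin d → ℤ, Integrable (wave k') (volume.restrict (unitCell d)) := fun k' =>
      Integrable.of_bound (continuous_wave k').aestronglyMeasurable 1
        (Filter.Eventually.of_forall fun x => (norm_wave k' x).le)
    rw [integral_finsetSum _ fun k' _ => (hint _).const_mul _]
    simp only [integral_const_mul, integral_unitCell_wave, mul_ite, mul_one, mul_zero]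
    simp only [add_eq_zero_iff_eq_neg]
    rw [Finset.sum_ite_eq']
    split_ifs with hk
    · exact sub_self _
    · rw [sub_zero]
      by_contra hne
      exact hk (hF _ hne)

theorem fourierCoeffTorus_eq {L : ℝ} (hL : 0 < L) (f : (Fin d → ℝ) → ℂ) (k : Fin d → ℤ) :
    fourierCoeffTorus L f k = ∫ u in unitCell d, f ((2 * Real.pi * L) • u) * wave (-k) u := by
  have hT : 0 < 2 * Real.pi * L := by positivity
  unfold fourierCoeffTorus
  rw [integral_restrict_eq_smul hT, Measure.restrict_congr_set (preimage_torus_ae_eq hL),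
    Complex.real_smul, ← mul_assoc, Complex.ofReal_pow, one_div_mul_cancel, one_mul]
  · refine integral_congr_ae (Filter.Eventually.of_forall fun u => ?_)
    simp only
    congr 1
    unfold wave
    congr 1
    simp only [Pi.smul_apply, smul_eq_mul, Pi.neg_apply]
    push_cast
    rw [Finset.mul_sum, Finset.mul_sum, Finset.mul_sum]
    refine Finset.sum_congr rfl fun j _ => ?_
    have hLc : (L : ℂ) ≠ 0 := by exact_mod_cast hL.ne'
    field_simp
  · exact pow_ne_zero _ (by exact_mod_cast hT.ne')

end FourierSeries

section Thickness

variable {d : ℕ}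

/-- The numbers of grid intervals into which `[0, T]` is divided. -/
def gridNumber (T : ℝ) (a : Fin d → ℝ) (j : Fin d) : ℕ := ⌊T / a j⌋₊

theorem gridNumber_pos {T : ℝ} {a : Fin d → ℝ} (ha : ∀ j, 0 < a j) (haT : ∀ j, a j ≤ T)
    (j : Fin d) : 0 < gridNumber T a j :=
  Nat.floor_pos.mpr (by rw [le_div_iff₀ (ha j), one_mul]; exact haT j)

theorem gridNumber_mul_le {T : ℝ} (hT : 0 < T) {a : Fin d → ℝ} (ha : ∀ j, 0 < a j) (j : Fin d) :
    gridNumber T a j * a j ≤ T := by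
  rw [← le_div_iff₀ (ha j)]
  exact Nat.floor_le (div_nonneg hT.le (ha j).le)

theorem lt_two_mul_gridNumber {T : ℝ} {a : Fin d → ℝ} (ha : ∀ j, 0 < a j)
    (haT : ∀ j, a j ≤ T) (j : Fin d) : T ≤ 2 * gridNumber T a j * a j := by
  have h1 : T / a j < gridNumber T a j + 1 := Nat.lt_floor_add_one _
  have h2 : (1 : ℝ) ≤ gridNumber T a j := by exact_mod_cast gridNumber_pos ha haT j
  rw [div_lt_iff₀ (ha j)] at h1
  nlinarith [ha j]

theorem IsThick.le_volume_gridCell {S : Set (Fin d → ℝ)} {γ : ℝ} {a : Fin d → ℝ}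
    (hS : IsThick S γ a) {T : ℝ} (hT : 0 < T) (haT : ∀ j, a j ≤ T) {E : Set (Fin d → ℝ)}
    (hE : E =ᵐ[volume] (fun u : Fin d → ℝ => T • u) ⁻¹' S) (y : Fin d → ℝ) :
    ENNReal.ofReal (γ / 2 ^ d) * cellVolume (gridNumber T a) ≤
      volume (E ∩ gridCell (gridNumber T a) y) := by
  set M := gridNumber T a with hM
  have hMpos : ∀ j, 0 < M j := gridNumber_pos hS.side_pos haT
  set P : Set (Fin d → ℝ) := Set.Icc (fun j => ((⌈(M j : ℝ) * y j⌉ : ℝ) - 1) / M j)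
    (fun j => (⌈(M j : ℝ) * y j⌉ : ℝ) / M j) with hP
  have hPcell : gridCell M y =ᵐ[volume] P := by
    rw [gridCell_eq_pi hMpos]
    exact Measure.univ_pi_Ioc_ae_eq_Icc (μ := fun _ : Fin d => (volume : Measure ℝ))
  rw [measure_congr (hE.inter hPcell)]
  set x : Fin d → ℝ := fun j => T * (((⌈(M j : ℝ) * y j⌉ : ℝ) - 1 / 2) / M j) with hx
  have hbox : (fun u : Fin d → ℝ => T • u) ⁻¹' box x a ⊆ P := by
    intro u hu
    have key : ∀ j, ((⌈(M j : ℝ) * y j⌉ : ℝ) - 1) / M j ≤ u j ∧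
        u j ≤ (⌈(M j : ℝ) * y j⌉ : ℝ) / M j := by
      intro j
      have hMj : (0 : ℝ) < M j := by exact_mod_cast hMpos j
      obtain ⟨h1, h2⟩ := hu j
      simp only [hx, Pi.smul_apply, smul_eq_mul] at h1 h2
      have h3 : a j ≤ T * (1 / M j) := by
        rw [mul_one_div, le_div_iff₀ hMj, mul_comm]
        exact gridNumber_mul_le hT hS.side_pos j
      constructor
      · refine le_of_mul_le_mul_left ?_ hT
        have e : T * (((⌈(M j : ℝ) * y j⌉ : ℝ) - 1) / M j) =
            T * (((⌈(M j : ℝ) * y j⌉ : ℝ) - 1 / 2) / M j) - T * (1 / M j) / 2 := by ring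
        linarith
      · refine le_of_mul_le_mul_left ?_ hT
        have e : T * ((⌈(M j : ℝ) * y j⌉ : ℝ) / M j) =
            T * (((⌈(M j : ℝ) * y j⌉ : ℝ) - 1 / 2) / M j) + T * (1 / M j) / 2 := by ring
        linarith
    exact ⟨fun j => (key j).1, fun j => (key j).2⟩
  have hvolbox : volume (box x a) = ENNReal.ofReal (∏ j, a j) := by
    have : box x a = Set.univ.pi fun j => Set.Icc (x j - a j / 2) (x j + a j / 2) := by
      ext z; simp only [box, Set.mem_ofPred_eq, Set.mem_univ_pi]
    rw [this, volume_pi_pi, ENNReal.ofReal_prod_of_nonneg fun j _ => (hS.side_pos j).le]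
    refine Finset.prod_congr rfl fun j _ => ?_
    rw [Real.volume_Icc]
    congr 1
    ring
  have hγ := hS.gamma_mem.1
  calc ENNReal.ofReal (γ / 2 ^ d) * cellVolume M
      ≤ ENNReal.ofReal |(T ^ d)⁻¹| * (ENNReal.ofReal γ * volume (box x a)) := by
        rw [hvolbox, cellVolume, ← ENNReal.ofReal_prod_of_nonneg fun j _ => by positivity,
          ← ENNReal.ofReal_mul (by positivity), ← ENNReal.ofReal_mul hγ.le,
          ← ENNReal.ofReal_mul (by positivity)]
        apply ENNReal.ofReal_le_ofReal
        have h1 : ∏ j, (2 * (M j : ℝ))⁻¹ ≤ ∏ j, T⁻¹ * a j := by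
          refine Finset.prod_le_prod (fun j _ => by positivity) fun j _ => ?_
          have hMj : (0 : ℝ) < M j := by exact_mod_cast hMpos j
          rw [inv_mul_eq_div, inv_le_iff_one_le_mul₀ (by positivity), div_mul_eq_mul_div,
            le_div_iff₀ hT, one_mul, mul_comm (a j)]
          exact lt_two_mul_gridNumber hS.side_pos haT j
        simp only [mul_inv, Finset.prod_mul_distrib, Finset.prod_const, Finset.card_univ,
          Fintype.card_fin, inv_pow] at h1
        rw [abs_of_pos (by positivity)]
        calc γ / 2 ^ d * ∏ j, (M j : ℝ)⁻¹ = γ * ((2 ^ d)⁻¹ * ∏ j, (M j : ℝ)⁻¹) := by ring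
          _ ≤ γ * ((T ^ d)⁻¹ * ∏ j, a j) := by
            gcongr
          _ = _ := by ring
    _ ≤ ENNReal.ofReal |(T ^ d)⁻¹| * volume (S ∩ box x a) := by
        gcongr
        exact hS.le_volume x
    _ = volume ((fun u : Fin d → ℝ => T • u) ⁻¹' (S ∩ box x a)) := by
        rw [Measure.addHaar_preimage_smul _ hT.ne', Module.finrank_fin_fun]
    _ ≤ _ := by
        refine measure_mono ?_
        rw [Set.preimage_inter]
        exact Set.inter_subset_inter_right _ hbox

end Thickness

section Spectrum

variable {d n : ℕ}

/-- Frequencies in a union of `n` boxes are close to at most `n` of them. -/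
theorem exists_centers {L : ℝ} (hL : 0 < L) {b : Fin d → ℝ} {center : Fin n → Fin d → ℝ}
    {K : Set (Fin d → ℤ)} (hK : ∀ k ∈ K, (fun j => (k j : ℝ) / L) ∈ ⋃ l, box (center l) b) :
    ∃ s : Finset (Fin d → ℤ), s.card ≤ n ∧
      ∀ k ∈ K, ∃ k₀ ∈ s, ∀ j, |((k j - k₀ j : ℤ) : ℝ)| ≤ L * b j := by
  classical
  set A : Fin n → Set (Fin d → ℤ) :=
    fun l => {k | k ∈ K ∧ (fun j => (k j : ℝ) / L) ∈ box (center l) b} with hA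
  set φ : Fin n → Fin d → ℤ := fun l => if h : (A l).Nonempty then h.choose else 0 with hφ
  refine ⟨Finset.univ.image φ, Finset.card_image_le.trans (by simp), fun k hk => ?_⟩
  obtain ⟨l, hl⟩ := Set.mem_iUnion.mp (hK k hk)
  have hne : (A l).Nonempty := ⟨k, hk, hl⟩
  have hφl : φ l ∈ A l := by
    simp only [hφ, dif_pos hne]
    exact hne.choose_spec
  refine ⟨φ l, Finset.mem_image_of_mem φ (Finset.mem_univ l), fun j => ?_⟩
  have h1 := hl j
  have h2 := hφl.2 j
  simp only [Set.mem_Icc] at h1 h2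
  have e : ((k j - φ l j : ℤ) : ℝ) = L * ((k j : ℝ) / L - (φ l j : ℝ) / L) := by
    push_cast; field_simp
  rw [e, abs_mul, abs_of_pos hL]
  gcongr
  rw [abs_le]
  constructor <;> linarith

theorem finite_of_centers {s : Finset (Fin d → ℤ)} {r : Fin d → ℝ} {K : Set (Fin d → ℤ)}
    (hK : ∀ k ∈ K, ∃ k₀ ∈ s, ∀ j, |((k j - k₀ j : ℤ) : ℝ)| ≤ r j) : K.Finite := by
  refine (s.finite_toSet.biUnion fun k₀ _ => Set.finite_Icc (k₀ - fun j => ⌊r j⌋)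
    (k₀ + fun j => ⌊r j⌋)).subset fun k hk => ?_
  obtain ⟨k₀, hk₀, h⟩ := hK k hk
  refine Set.mem_biUnion hk₀ ?_
  have key : ∀ j, k₀ j - ⌊r j⌋ ≤ k j ∧ k j ≤ k₀ j + ⌊r j⌋ := by
    intro j
    have h1 := h j
    rw [← Int.cast_abs, ← Int.le_floor, abs_le] at h1
    omega
  exact ⟨fun j => (key j).1, fun j => (key j).2⟩

end Spectrum

section Main

theorem gridBase_div_two_pow {d : ℕ} {γ : ℝ} :
    gridBase d (γ / 2 ^ d) = (2 * Real.exp 520) ^ d / γ := by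
  unfold gridBase
  rw [mul_pow]
  field_simp

theorem gridBase_rpow_le {d : ℕ} (hd : 0 < d) {γ : ℝ} (hγ : 0 < γ) (hγ1 : γ ≤ 1) {m n : ℕ}
    (hmn : m ≤ n) {t q : ℝ} (ht : 0 ≤ t) (hm : 0 < m) (hq : 0 ≤ q) :
    gridBase d (γ / 2 ^ d) ^ ((16 * gridBase d (γ / 2 ^ d)) ^ m * t + m - 1 + q) ≤
      ((32 * Real.exp 520) ^ d / γ) ^ (((32 * Real.exp 520) ^ d / γ) ^ n * t + n - (1 - q)) := by
  rw [gridBase_div_two_pow]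
  set G := (2 * Real.exp 520) ^ d / γ with hG
  set C := (32 * Real.exp 520) ^ d / γ with hC
  have hexp : (1 : ℝ) ≤ Real.exp 520 := Real.one_le_exp (by norm_num)
  have hG1 : 1 ≤ G := by
    rw [hG, le_div_iff₀ hγ, one_mul]
    exact hγ1.trans (one_le_pow₀ (by linarith))
  have hGC : 16 * G ≤ C := by
    rw [hG, hC, ← mul_div_assoc]
    gcongr
    rw [show (32 * Real.exp 520) = 16 * (2 * Real.exp 520) by ring, mul_pow 16]
    gcongr
    exact le_self_pow₀ (by norm_num) hd.ne'
  have hC1 : 1 ≤ C := by linarith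
  have hm1 : (1 : ℝ) ≤ m := by exact_mod_cast hm
  have hexpo : (16 * G) ^ m * t + m - 1 + q ≤ C ^ n * t + n - (1 - q) := by
    have h1 : (16 * G) ^ m ≤ C ^ n := by
      calc (16 * G) ^ m ≤ C ^ m := by gcongr
        _ ≤ C ^ n := pow_le_pow_right₀ hC1 hmn
    have h2 : (16 * G) ^ m * t ≤ C ^ n * t := by gcongr
    have h3 : (m : ℝ) ≤ n := by exact_mod_cast hmn
    linarith
  have h0 : 0 ≤ (16 * G) ^ m * t := by positivity
  calc G ^ ((16 * G) ^ m * t + m - 1 + q) ≤ C ^ ((16 * G) ^ m * t + m - 1 + q) :=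
        Real.rpow_le_rpow (by linarith) (by linarith) (by linarith)
    _ ≤ _ := Real.rpow_le_rpow_of_exponent_le hC1 hexpo

/-- The Logvinenko–Sereda inequality on the torus, with an explicit constant. -/
theorem eLpNorm_torus_le {d : ℕ} (hd : 1 ≤ d) {L : ℝ} (hL : 0 < L) {p : ENNReal} (hp : 1 ≤ p)
    {n : ℕ} {b : Fin d → ℝ} (hb : ∀ j, 0 ≤ b j) {center : Fin n → Fin d → ℝ} {γ : ℝ}
    {a : Fin d → ℝ} {S : Set (Fin d → ℝ)} (hS : IsThick S γ a) (ha : ∀ j, a j ≤ 2 * Real.pi * L)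
    {f : (Fin d → ℝ) → ℂ} (hf : MemLp f p (volume.restrict (torus d L)))
    (hsupp : fourierSupport L f ⊆ ⋃ l, box (center l) b) :
    eLpNorm f p (volume.restrict (torus d L)) ≤
      ENNReal.ofReal (((32 * Real.exp 520) ^ d / γ) ^ (((32 * Real.exp 520) ^ d / γ) ^ n *
        (∑ j, a j * b j) + n - (1 - (p⁻¹).toReal))) *
        eLpNorm f p (volume.restrict (S ∩ torus d L)) := by
  classical
  set T := 2 * Real.pi * L with hTdef
  have hT : 0 < T := by positivity
  have hγ := hS.gamma_mem.1
  have hγ1 := hS.gamma_mem.2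
  set g : (Fin d → ℝ) → ℂ := fun u => f (T • u) with hg
  have hcellae : ((fun u : Fin d → ℝ => T • u) ⁻¹' torus d L) =ᵐ[volume] unitCell d :=
    preimage_torus_ae_eq hL
  have hscale := eLpNorm_restrict_eq_smul hT (torus d L) f p
  rw [Measure.restrict_congr_set hcellae] at hscale
  have hcT0 : ENNReal.ofReal (T ^ d) ^ (1 / p).toReal ≠ 0 := by
    rw [Ne, ENNReal.rpow_eq_zero_iff]
    have : ENNReal.ofReal (T ^ d) ≠ 0 := by simpa using pow_pos hT d
    simp [this]
  have he : MeasurableEmbedding fun u : Fin d → ℝ => T • u :=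
    measurableEmbedding_const_smul₀ hT.ne'
  have hgm : AEStronglyMeasurable g (volume.restrict (unitCell d)) := by
    have h1 := hf.aestronglyMeasurable
    rw [restrict_eq_smul_map hT, Measure.restrict_congr_set hcellae] at h1
    have h2 := h1.mono_ac (Measure.AbsolutelyContinuous.rfl.smul_right
      (c := ENNReal.ofReal (T ^ d)) (by simpa using pow_pos hT d))
    exact he.aestronglyMeasurable_map_iff.mp h2
  have hgp : MemLp g p (volume.restrict (unitCell d)) := by
    refine ⟨hgm, ?_⟩
    by_contra! htop
    have h1 := hf.2
    rw [hscale, top_le_iff.mp htop, ENNReal.mul_top hcT0] at h1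
    exact absurd h1 (lt_irrefl _)
  have hgi : Integrable g (volume.restrict (unitCell d)) := hgp.integrable hp
  set K : Set (Fin d → ℤ) := {k | fourierCoeffTorus L f k ≠ 0} with hK
  obtain ⟨s, hsn, hs⟩ := exists_centers hL (b := b) (center := center) (K := K)
    fun k hk => hsupp ⟨k, fun j => rfl, hk⟩
  have hKfin : K.Finite := finite_of_centers hs
  set F := hKfin.toFinset with hF
  set c : (Fin d → ℤ) → ℂ := fourierCoeffTorus L f with hc
  have hgF : g =ᵐ[volume.restrict (unitCell d)] trigPoly F c :=
    ae_eq_trigPoly hgi (fun k => fourierCoeffTorus_eq hL f k) fun k hk => by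
      rw [hF, Set.Finite.mem_toFinset]; exact hk
  rcases s.eq_empty_or_nonempty with hse | hsne
  · have hFe : F = ∅ := by
      rw [hF, Set.Finite.toFinset_eq_empty, Set.eq_empty_iff_forall_notMem]
      intro k hk
      obtain ⟨k₀, hk₀, -⟩ := hs k hk
      rw [hse] at hk₀
      exact absurd hk₀ (Finset.notMem_empty _)
    have hzero : trigPoly F c = 0 := by ext x; simp [trigPoly, hFe]
    rw [hscale, eLpNorm_congr_ae hgF, hzero, eLpNorm_zero, mul_zero]
    exact zero_le
  have hSnull : NullMeasurableSet ((fun u : Fin d → ℝ => T • u) ⁻¹' S) volume := by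
    refine hS.measurable.preimage ⟨he.measurable, ?_⟩
    rw [Measure.map_addHaar_smul _ hT.ne']
    exact Measure.smul_absolutelyContinuous
  obtain ⟨E, -, hEm, hES⟩ := hSnull.exists_measurable_subset_ae_eq
  set M := gridNumber T a with hM
  have hMpos : ∀ j, 0 < M j := gridNumber_pos hS.side_pos ha
  have hthick : ∀ y ∈ unitCell d, ENNReal.ofReal (γ / 2 ^ d) * cellVolume M ≤
      volume (E ∩ gridCell M y) := fun y _ => hS.le_volume_gridCell hT ha hES y
  set t := ∑ j, a j * b j with ht
  have habj : ∀ j, 0 ≤ a j * b j := fun j => mul_nonneg (hS.side_pos j).le (hb j)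
  have ht0 : 0 ≤ t := Finset.sum_nonneg fun j _ => habj j
  have hcover : ∀ k ∈ F, ∃ k₀ ∈ s, ∀ j, |((k j - k₀ j : ℤ) : ℝ)| ≤ t * M j := by
    intro k hk
    obtain ⟨k₀, hk₀, h⟩ := hs k ((Set.Finite.mem_toFinset _).mp hk)
    refine ⟨k₀, hk₀, fun j => (h j).trans ?_⟩
    have h1 : T ≤ 2 * M j * a j := lt_two_mul_gridNumber hS.side_pos ha j
    have h2 : 2 * L ≤ T := by
      rw [hTdef]
      have := Real.pi_gt_three
      nlinarith
    have h3 : L ≤ M j * a j := by linarith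
    have h4 : a j * b j ≤ t := Finset.single_le_sum (fun i _ => habj i) (Finset.mem_univ j)
    calc L * b j ≤ M j * a j * b j := by have := hb j; gcongr
      _ = (a j * b j) * M j := by ring
      _ ≤ t * M j := by gcongr
  have hγ2 : γ / 2 ^ d ≤ 1 := by
    rw [div_le_one (by positivity)]
    exact hγ1.trans (one_le_pow₀ (by norm_num))
  have hmain := eLpNorm_trigPoly_le_of_cover hd hMpos hEm (by positivity : 0 < γ / 2 ^ d) hγ2 hthick
    hsne ht0 hcover c hp
  have hscaleS := eLpNorm_restrict_eq_smul hT (S ∩ torus d L) f p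
  rw [Set.preimage_inter, Measure.restrict_congr_set (hES.symm.inter hcellae)] at hscaleS
  have hgFE : g =ᵐ[volume.restrict (E ∩ unitCell d)] trigPoly F c :=
    ae_mono (Measure.restrict_mono Set.inter_subset_right le_rfl) hgF
  rw [hscale, hscaleS, eLpNorm_congr_ae hgF, eLpNorm_congr_ae hgFE, mul_left_comm]
  gcongr
  refine hmain.trans ?_
  gcongr ENNReal.ofReal ?_ * _
  exact gridBase_rpow_le hd hγ hγ1 hsn ht0 (Finset.card_pos.mpr hsne) ENNReal.toReal_nonneg

end Main

end LogvinenkoSereda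

end

theorem theorem2 :
    ∃ c : ℝ, 3 ≤ c ∧
      ∀ (d : ℕ) (_hd : 1 ≤ d) (L : ℝ) (_hL : 0 < L) (p : ENNReal) (_hp : 1 ≤ p)
        (n : ℕ) (b : Fin d → ℝ) (_hb : ∀ j, 0 ≤ b j) (center : Fin n → Fin d → ℝ)
        (γ : ℝ) (a : Fin d → ℝ) (S : Set (Fin d → ℝ))
        (_hS : LogvinenkoSereda.IsThick S γ a) (_ha : ∀ j, a j ≤ 2 * Real.pi * L)
        (f : (Fin d → ℝ) → ℂ)
        (_hf : MemLp f p (volume.restrict (LogvinenkoSereda.torus d L)))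
        (_hsupp : LogvinenkoSereda.fourierSupport L f ⊆
          ⋃ l, LogvinenkoSereda.box (center l) b),
        eLpNorm f p (volume.restrict (LogvinenkoSereda.torus d L)) ≤
          ENNReal.ofReal
            ((c ^ d / γ) ^ ((c ^ d / γ) ^ n * (∑ j, a j * b j) + n - (1 - (p⁻¹).toReal))) *
          eLpNorm f p (volume.restrict (S ∩ LogvinenkoSereda.torus d L)) := by
  refine ⟨32 * Real.exp 520, ?_, ?_⟩
  · have : (1 : ℝ) ≤ Real.exp 520 := Real.one_le_exp (by norm_num)
    linarith
  · intro d hd L hL p hp n b hb center γ a S hS ha f hf hsupp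
    exact LogvinenkoSereda.eLpNorm_torus_le hd hL hp hb hS ha hf hsupp
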